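/- Let $X$ be an oriented smooth manifold of dimension $n\ge 1$ (Hausdorff, second countable) and let $\pi:Y^{(m)}\to X$ be a fibered manifold (a surjective submersion), whose sections $y^\sigma(x)$ are the matter fields. Let $\mathrm{Met}(X)$ be the bundle of symmetric nondegenerate tensors of type $(2,0)$, with fibre coordinates $g^{ij}=g^{ji}$, and let $Y=\mathrm{Met}(X)\times_X Y^{(m)}$; thus the metric is the only background variable. Suppose given a canonical lifting of the diffeomorphisms of $X$ to $Y^{(m)}$: a group morphism $\mathrm{Diff}(X)\to\mathrm{Aut}(Y^{(m)})$, $\varphi\mapsto\Phi$, with $\pi\circ\Phi=\varphi\circ\pi$, which takes smoothly parametrized families to smoothly parametrized families and induces on vector fields an $\mathbb R$-linear lifting $l$ with $\pi_*\circ l=\mathrm{id}$ and $\pi(\mathrm{supp}\, l(\xi))\subset\mathrm{supp}\,\xi$; on $\mathrm{Met}(X)$, $\mathrm{Diff}(X)$ acts by pushforward. Let $\lambda_m=L_m\,dV_g$ be a natural matter Lagrangian of arbitrary order $r$: $L_m$ is a smooth function on the jet prolongation $J^rY$ invariant under the lifts of the (orientation preserving) diffeomorphisms of $X$. In positively oriented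 fibered charts write $\lambda_m=\mathcal L_m\,dx^1\wedge\dots\wedge dx^n$, $\mathcal L_m=L_m\sqrt{|\det g|}$, where $\det g=\det(g_{ij})$, and let $\omega_0=dx^1\wedge\dots\wedge dx^n$, $\omega_j=\mathbf i_{\partial_j}\omega_0$. Let $\tau=\frac{\delta\mathcal L_m}{\delta g^{jk}}\,\omega^{jk}\wedge\omega_0$, with $\omega^{jk}=dg^{jk}-g^{jk}{}_{,i}dx^i$, be the energy-momentum source form, where $\frac{\delta}{\delta g^{jk}}$ is the (symmetric) Euler-Lagrange expression; let $\Xi$ be the lift to $Y$ of a vector field $\xi$ on $X$, with $\mathrm{Met}(X)$-components $\Xi^{jk}=\xi^j_{,h}g^{hk}+\xi^k_{,h}g^{jh}$, and let $h$ denote horizontalization of differential forms on jet prolongations. The energy-momentum tensor of $\lambda_m$ is the map $\mathcal T$, linear over the smooth functions on $X$, from the vector fields on $X$ to the horizontal $(n-1)$-forms on $J^{2r}Y$, determined by the splitting $$h\,\mathbf i_{J\Xi}\tau=\mathcal B(\xi)+h\,d(\mathcal T(\xi))\qquad\text{for all }\xi,$$ where $\mathcal B$ is a map, linear over the smooth functions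 on $X$, to the horizontal $n$-forms on $J^{2r+1}Y$. Then $\mathcal T$ exists and is unique. In every positively oriented fibered chart, $\mathcal T(\xi)=T^j{}_i\,\xi^i\sqrt{|\det g|}\;\omega_j$, and $T_{ij}=g_{ih}T^h{}_j$ is the Hilbert tensor: $$T_{ij}=\frac{2}{\sqrt{|\det g|}}\,\frac{\delta\mathcal L_m}{\delta g^{ij}}.$$ Moreover, along every smooth (local) section $\gamma$ of $Y$ which is on-shell for the matter variables, i.e. along which $\frac{\delta\mathcal L_m}{\delta y^\sigma}=0$, the covariant conservation law holds: $$T^j{}_{i;j}=0,\qquad i=1,\dots,n,$$ where the semicolon denotes the Levi-Civita covariant derivative of the metric component of $\gamma$. -/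

import Mathlib

open scoped Manifold ContDiff

noncomputable section

namespace MetricBackground

/-! ## Model spaces, partial derivatives, jet coordinates -/

/-- The model `ℝⁿ` of the spacetime manifold, `n = d + 1 ≥ 1`. -/
abbrev Base (d : ℕ) := EuclideanSpace ℝ (Fin (d + 1))

/-- The model `ℝᵐ` of the fibres of the matter manifold. -/
abbrev Fibre (m : ℕ) := EuclideanSpace ℝ (Fin m)

/-- Symmetric arrays `(g^{ij})`: the fibre coordinates of the bundle of metrics. -/
abbrev SymArray (d : ℕ) : Submodule ℝ (Fin (d + 1) → Fin (d + 1) → ℝ) where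
  carrier := {A | ∀ i j, A i j = A j i}
  add_mem' := fun ha hb i j => by simp only [Pi.add_apply, ha i j, hb i j]
  zero_mem' := fun _ _ => rfl
  smul_mem' := fun c A ha i j => by simp only [Pi.smul_apply, ha i j]

/-- The symmetric array `(e_i ⊗ e_j + e_j ⊗ e_i) / 2`. -/
def symUnit {d : ℕ} (i j : Fin (d + 1)) : SymArray d :=
  ⟨fun a b => ((if a = i ∧ b = j then 1 else 0) + (if a = j ∧ b = i then 1 else 0)) / 2,
    fun a b => by simp only [and_comm, add_comm]⟩

section Calculus

variable {d : ℕ} {V : Type*} [NormedAddCommGroup V] [NormedSpace ℝ V]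

/-- `∂f/∂xⁱ` for a function on `ℝⁿ`. -/
def partialD (i : Fin (d + 1)) (f : Base d → V) : Base d → V :=
  fun x => fderiv ℝ f x (EuclideanSpace.single i 1)

/-- The partial derivative `∂_{i₁} ⋯ ∂_{i_k} f` along a multi-index, i.e. an unordered word
`{i₁, …, i_k}`. -/
def multiPartial (s : Multiset (Fin (d + 1))) (f : Base d → V) : Base d → V :=
  (s.sort (· ≤ ·)).foldr partialD f

end Calculus

/-- The multi-indices of length at most `r`, as unordered words `j₁ … j_k` with `k ≤ r`. -/
abbrev MultiIdx (d r : ℕ) := Σ k : Fin (r + 1), Sym (Fin (d + 1)) k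

/-- The empty multi-index. -/
def MultiIdx.nil (d r : ℕ) : MultiIdx d r := ⟨0, Sym.nil⟩

/-- Coordinates `(xⁱ, g^{jk}_{i₁…i_l}, y^σ_{i₁…i_l})`, `l ≤ r`, on the `r`-jet prolongation of the
configuration manifold. -/
abbrev JetCoord (d m r : ℕ) :=
  Base d × (MultiIdx d r → SymArray d) × (MultiIdx d r → Fibre m)

/-- The coordinates of the `r`-jet at `x` of the local field `x ↦ (g^{jk}(x), y^σ(x))`. -/
def jetCoord {d m : ℕ} (r : ℕ) (G : Base d → SymArray d) (y : Base d → Fibre m) (x : Base d) :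
    JetCoord d m r :=
  (x, fun s => multiPartial (s.2 : Multiset (Fin (d + 1))) G x,
    fun s => multiPartial (s.2 : Multiset (Fin (d + 1))) y x)

/-- The matrix `(g^{ij})` of an array. -/
def invMetric {d : ℕ} (A : SymArray d) : Matrix (Fin (d + 1)) (Fin (d + 1)) ℝ :=
  Matrix.of (A : Fin (d + 1) → Fin (d + 1) → ℝ)

/-- The matrix `(g_{ij})`, inverse to `(g^{ij})`. -/
def covMetric {d : ℕ} (A : SymArray d) : Matrix (Fin (d + 1)) (Fin (d + 1)) ℝ := (invMetric A)⁻¹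

/-- `√|det g|`, where `det g = det (g_{ij})`. -/
def volDensity {d : ℕ} (A : SymArray d) : ℝ := Real.sqrt |(covMetric A).det|

/-- The variational derivative `δℒ/δg^{ij}` of `ℒ = ℒ(x, g, ∂g, …, y, ∂y, …)`, along the local field
`(G, y)` and at the point `x`:
`∑_s (-1)^{|s|} ∂_s (∂ℒ/∂g^{ij}_s)`, the sum being over the multi-indices `s` with `|s| ≤ r`.
The derivatives with respect to `g^{ij}` are the symmetric ones, so that
`δℒ = (∂ℒ/∂g^{ij}) δg^{ij}` with summation over all pairs `(i, j)`. -/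
def varDerivMetric {d m r : ℕ} (Lag : JetCoord d m r → ℝ) (G : Base d → SymArray d)
    (y : Base d → Fibre m) (x : Base d) (i j : Fin (d + 1)) : ℝ :=
  ∑ s : MultiIdx d r, (-1 : ℝ) ^ (s.1 : ℕ) *
    multiPartial (s.2 : Multiset (Fin (d + 1)))
      (fun x' => fderiv ℝ Lag (jetCoord r G y x') (0, Pi.single s (symUnit i j), 0)) x

/-- The variational derivative `δℒ/δy^σ` along the local field `(G, y)` at `x`. -/
def varDerivMatter {d m r : ℕ} (Lag : JetCoord d m r → ℝ) (G : Base d → SymArray d)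
    (y : Base d → Fibre m) (x : Base d) (σ : Fin m) : ℝ :=
  ∑ s : MultiIdx d r, (-1 : ℝ) ^ (s.1 : ℕ) *
    multiPartial (s.2 : Multiset (Fin (d + 1)))
      (fun x' => fderiv ℝ Lag (jetCoord r G y x')
        (0, 0, Pi.single s (EuclideanSpace.single σ 1))) x

/-- `ω₀ = dx¹ ∧ ⋯ ∧ dxⁿ`. -/
def omegaZero (d : ℕ) : Base d [⋀^Fin (d + 1)]→L[ℝ] ℝ :=
  { (EuclideanSpace.basisFun (Fin (d + 1)) ℝ).toBasis.det with
    cont := by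
      change Continuous fun v : Fin (d + 1) → Base d =>
        (EuclideanSpace.basisFun (Fin (d + 1)) ℝ).toBasis.det v
      simp only [Module.Basis.det_apply]
      refine Continuous.matrix_det (continuous_matrix fun i j => ?_)
      simp only [Module.Basis.toMatrix_apply, OrthonormalBasis.coe_toBasis_repr_apply,
        EuclideanSpace.basisFun_repr]
      fun_prop }

/-- `ω_j = i_{∂/∂x^j} ω₀`. -/
def omega {d : ℕ} (j : Fin (d + 1)) : Base d [⋀^Fin d]→L[ℝ] ℝ :=
  (omegaZero d).curryLeft (EuclideanSpace.single j 1)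

/-- The Christoffel symbols `Γ^k_{ij}` of the metric with contravariant components `G`. -/
def christoffel {d : ℕ} (G : Base d → SymArray d) (x : Base d) (k i j : Fin (d + 1)) : ℝ :=
  ∑ l, invMetric (G x) k l / 2 *
    (partialD i (fun x' => covMetric (G x') l j) x + partialD j (fun x' => covMetric (G x') l i) x
      - partialD l (fun x' => covMetric (G x') i j) x)

/-- The Levi-Civita divergence `T^j_{i;j}` of a tensor field of type (1,1), `T x j i = T^j_i(x)`. -/
def covDivergence {d : ℕ} (G : Base d → SymArray d)
    (T : Base d → Matrix (Fin (d + 1)) (Fin (d + 1)) ℝ) (x : Base d) (i : Fin (d + 1)) : ℝ :=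
  ∑ j, (partialD j (fun x' => T x' j i) x
    + ∑ k, (christoffel G x j j k * T x k i - christoffel G x k j i * T x j k))

/-! ## Spacetime, matter manifold, fibered charts, fields -/

section Geometry

variable {d m : ℕ}
variable {X : Type*} [TopologicalSpace X] [ChartedSpace (Base d) X]
variable {Y : Type*} [TopologicalSpace Y] [ChartedSpace (Base d × Fibre m) Y]

/-- An orientation of `X`, given by an atlas of smooth charts with positive transition Jacobians. -/
structure OrientedAtlas (d : ℕ) (X : Type*) [TopologicalSpace X] [ChartedSpace (Base d) X] where
  charts : Set (OpenPartialHomeomorph X (Base d))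
  smooth : charts ⊆ IsManifold.maximalAtlas 𝓘(ℝ, Base d) ∞ X
  covers : ∀ x : X, ∃ e ∈ charts, x ∈ e.source
  jacobian_pos : ∀ e ∈ charts, ∀ e' ∈ charts, ∀ x ∈ e.source ∩ e'.source,
    0 < (fderiv ℝ (e' ∘ e.symm) (e x)).det

/-- The positively oriented smooth charts of `X`. -/
def OrientedAtlas.IsPositive (o : OrientedAtlas d X) (e : OpenPartialHomeomorph X (Base d)) : Prop :=
  e ∈ IsManifold.maximalAtlas 𝓘(ℝ, Base d) ∞ X ∧
    ∀ e' ∈ o.charts, ∀ x ∈ e.source ∩ e'.source, 0 < (fderiv ℝ (e' ∘ e.symm) (e x)).det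

/-- A fibered chart `(x^i, y^σ)` of the matter manifold `π : Y → X`, over a positively oriented
chart `(x^i)` of `X`. Together with `(x^i)` it determines the fibered chart
`(x^i, g^{jk}, y^σ)` of the configuration manifold `Met(X) ×_X Y`. -/
structure FiberedChart (o : OrientedAtlas d X) (π : Y → X) where
  base : OpenPartialHomeomorph X (Base d)
  total : OpenPartialHomeomorph Y (Base d × Fibre m)
  base_positive : o.IsPositive base
  total_smooth : total ∈ IsManifold.maximalAtlas 𝓘(ℝ, Base d × Fibre m) ∞ Y
  image_source : π '' total.source = base.source
  fst_total : ∀ y ∈ total.source, (total y).1 = base (π y)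

/-- The differential `dx^i` at `x` of the `i`-th coordinate of the chart `e`. -/
def coframe (e : OpenPartialHomeomorph X (Base d)) (x : X) (i : Fin (d + 1)) :
    TangentSpace 𝓘(ℝ, Base d) x →L[ℝ] ℝ :=
  (EuclideanSpace.proj i : Base d →L[ℝ] ℝ).comp (mfderiv 𝓘(ℝ, Base d) 𝓘(ℝ, Base d) e x)

/-- The fibre over `x` of the bundle `Met(X)`: symmetric nondegenerate tensors of type (2,0), i.e.
bilinear forms on the cotangent space. -/
def MetricAt (d : ℕ) {X : Type*} [TopologicalSpace X] [ChartedSpace (Base d) X] (x : X) :=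
  {b : LinearMap.BilinForm ℝ (TangentSpace 𝓘(ℝ, Base d) x →L[ℝ] ℝ) // b.IsSymm ∧ b.Nondegenerate}

/-- The components `g^{ij}` of a field of metrics in the chart `e`, as functions on `ℝⁿ`. -/
def metricComp (g : ∀ x : X, MetricAt d x) (e : OpenPartialHomeomorph X (Base d)) (u : Base d) :
    SymArray d :=
  ⟨fun i j => (g (e.symm u)).1 (coframe e (e.symm u) i) (coframe e (e.symm u) j),
    fun _ _ => (g (e.symm u)).2.1.eq _ _⟩

/-- A smooth section of the configuration manifold `Met(X) ×_X Y`, over an open set `dom ⊆ X`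
(the values outside of `dom` are irrelevant). -/
structure LocalField (π : Y → X) where
  dom : Set X
  isOpen_dom : IsOpen dom
  metric : ∀ x : X, MetricAt d x
  matter : X → Y
  isSection : ∀ x ∈ dom, π (matter x) = x
  metric_smooth : ∀ e ∈ IsManifold.maximalAtlas 𝓘(ℝ, Base d) ∞ X,
    ContDiffOn ℝ ∞ (metricComp metric e) (e.target ∩ e.symm ⁻¹' dom)
  matter_smooth : ContMDiffOn 𝓘(ℝ, Base d) 𝓘(ℝ, Base d × Fibre m) ∞ matter dom

variable {o : OrientedAtlas d X} {π : Y → X}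

namespace FiberedChart

/-- The image of the chart on the `r`-jet prolongation of `Met(X) ×_X Y`. -/
def jetTarget (c : FiberedChart (m := m) o π) (r : ℕ) : Set (JetCoord d m r) :=
  {q | (q.1, q.2.2 (MultiIdx.nil d r)) ∈ c.total.target ∧
    (invMetric (q.2.1 (MultiIdx.nil d r))).det ≠ 0}

/-- The functions `g^{jk}(x)` representing a field in the chart. -/
def metricRep (c : FiberedChart (m := m) o π) (γ : LocalField (d := d) (m := m) π) : Base d → SymArray d :=
  metricComp γ.metric c.base

/-- The functions `y^σ(x)` representing a field in the chart. -/
def matterRep (c : FiberedChart (m := m) o π) (γ : LocalField (d := d) (m := m) π) : Base d → Fibre m :=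
  fun u => (c.total (γ.matter (c.base.symm u))).2

/-- The points `x`, in coordinates, at which the field is defined and takes its values in the
domain of the chart. -/
def fieldDomain (c : FiberedChart (m := m) o π) (γ : LocalField (d := d) (m := m) π) : Set (Base d) :=
  {u | u ∈ c.base.target ∧ c.base.symm u ∈ γ.dom ∧ γ.matter (c.base.symm u) ∈ c.total.source}

/-- The coordinates of the `r`-jet of a field. -/
def jet (c : FiberedChart (m := m) o π) (r : ℕ) (γ : LocalField (d := d) (m := m) π) (u : Base d) :
    JetCoord d m r :=
  jetCoord r (c.metricRep γ) (c.matterRep γ) u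

end FiberedChart

/-- Smooth vector fields on `X`. -/
abbrev VectorFieldX (d : ℕ) (X : Type*) [TopologicalSpace X] [ChartedSpace (Base d) X]
    [IsManifold 𝓘(ℝ, Base d) ∞ X] :=
  Cₛ^∞⟮𝓘(ℝ, Base d); Base d, fun x : X => TangentSpace 𝓘(ℝ, Base d) x⟯

/-- Smooth vector fields on `Y`. -/
abbrev VectorFieldY (d m : ℕ) (Y : Type*) [TopologicalSpace Y]
    [ChartedSpace (Base d × Fibre m) Y] [IsManifold 𝓘(ℝ, Base d × Fibre m) ∞ Y] :=
  Cₛ^∞⟮𝓘(ℝ, Base d × Fibre m); Base d × Fibre m,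
    fun y : Y => TangentSpace 𝓘(ℝ, Base d × Fibre m) y⟯

/-- The components `ξ^i` of a vector field in the chart `e`, as functions on `ℝⁿ`. -/
def vectorComp [IsManifold 𝓘(ℝ, Base d) ∞ X] (ξ : VectorFieldX d X)
    (e : OpenPartialHomeomorph X (Base d)) (u : Base d) (i : Fin (d + 1)) : ℝ :=
  coframe e (e.symm u) i (ξ (e.symm u))

/-! ## Functions and horizontal forms on jet prolongations -/

/-- A smooth real function on the `r`-jet prolongation of `Met(X) ×_X Y`, given by its coordinate
expressions, which agree on jets of local fields (every jet is one); a coordinate expression is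
extended by zero outside of the image of the chart. -/
@[ext]
structure JetFunction (o : OrientedAtlas d X) (π : Y → X) (r : ℕ) where
  expr : FiberedChart (m := m) o π → JetCoord d m r → ℝ
  smooth : ∀ c, ContDiffOn ℝ ∞ (expr c) (c.jetTarget r)
  eq_zero : ∀ c, ∀ q ∉ c.jetTarget r, expr c q = 0
  compat : ∀ (c c' : FiberedChart (m := m) o π) (γ : LocalField (d := d) (m := m) π), ∀ x ∈ γ.dom,
    γ.matter x ∈ c.total.source → γ.matter x ∈ c'.total.source →
    expr c (c.jet r γ (c.base x)) = expr c' (c'.jet r γ (c'.base x))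

/-- A smooth horizontal `k`-form `(1/k!) A_{i₁…i_k} dx^{i₁} ∧ ⋯ ∧ dx^{i_k}` on the `r`-jet
prolongation of `Met(X) ×_X Y`, given by its coordinate expressions: these are functions of the jet
coordinates with values in the `k`-forms on `ℝⁿ`, related by pullback under the change of the
coordinates of `X`; they are extended by zero outside of the image of the chart. -/
@[ext]
structure HorizontalForm (o : OrientedAtlas d X) (π : Y → X) (k r : ℕ) where
  expr : FiberedChart (m := m) o π → JetCoord d m r → Base d [⋀^Fin k]→L[ℝ] ℝ
  smooth : ∀ c, ContDiffOn ℝ ∞ (expr c) (c.jetTarget r)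
  eq_zero : ∀ c, ∀ q ∉ c.jetTarget r, expr c q = 0
  compat : ∀ (c c' : FiberedChart (m := m) o π) (γ : LocalField (d := d) (m := m) π), ∀ x ∈ γ.dom,
    γ.matter x ∈ c.total.source → γ.matter x ∈ c'.total.source →
    expr c (c.jet r γ (c.base x)) =
      (expr c' (c'.jet r γ (c'.base x))).compContinuousLinearMap
        (fderiv ℝ (c'.base ∘ c.base.symm) (c.base x))

/-- `F(X)`-linearity of a map from vector fields on `X` to horizontal forms. -/
def IsFunctionLinear [IsManifold 𝓘(ℝ, Base d) ∞ X] {k r : ℕ}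
    (A : VectorFieldX d X → HorizontalForm (m := m) o π k r) : Prop :=
  (∀ ξ η c q, (A (ξ + η)).expr c q = (A ξ).expr c q + (A η).expr c q) ∧
  (∀ (f : C^∞⟮𝓘(ℝ, Base d), X; 𝓘(ℝ, ℝ), ℝ⟯) (ξ η : VectorFieldX d X), (∀ x, η x = f x • ξ x) →
    ∀ c, ∀ q ∈ c.jetTarget r, (A η).expr c q = f (c.base.symm q.1) • (A ξ).expr c q)

/-! ## Diffeomorphisms and natural Lagrangians -/

/-- The group of diffeomorphisms of `X`. -/
abbrev DiffX (d : ℕ) (X : Type*) [TopologicalSpace X] [ChartedSpace (Base d) X] :=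
  X ≃ₘ^∞⟮𝓘(ℝ, Base d), 𝓘(ℝ, Base d)⟯ X

/-- The group of diffeomorphisms of `Y`. -/
abbrev DiffY (d m : ℕ) (Y : Type*) [TopologicalSpace Y] [ChartedSpace (Base d × Fibre m) Y] :=
  Y ≃ₘ^∞⟮𝓘(ℝ, Base d × Fibre m), 𝓘(ℝ, Base d × Fibre m)⟯ Y

/-- A canonical lifting of the diffeomorphisms of `X` to automorphisms of the matter manifold:
a group morphism `Diff(X) → Aut(Y)`, smooth (smoothly parametrized families are lifted to smoothly
parametrized families), together with the lifting `l` of vector fields which it induces, such that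
the support of `l(ξ)` projects into the support of `ξ`. -/
structure CanonicalLifting (π : Y → X) [IsManifold 𝓘(ℝ, Base d) ∞ X]
    [IsManifold 𝓘(ℝ, Base d × Fibre m) ∞ Y] where
  lift : DiffX d X → DiffY d m Y
  covers : ∀ φ y, π (lift φ y) = φ (π y)
  lift_comp : ∀ φ ψ : DiffX d X, lift (φ.trans ψ) = (lift φ).trans (lift ψ)
  lift_smooth : ∀ φ : ℝ → DiffX d X,
    ContMDiff (𝓘(ℝ, ℝ).prod 𝓘(ℝ, Base d)) 𝓘(ℝ, Base d) ∞ (fun p : ℝ × X => φ p.1 p.2) →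
    ContMDiff (𝓘(ℝ, ℝ).prod 𝓘(ℝ, Base d × Fibre m)) 𝓘(ℝ, Base d × Fibre m) ∞
      (fun p : ℝ × Y => lift (φ p.1) p.2)
  l : VectorFieldX d X →ₗ[ℝ] VectorFieldY d m Y
  l_generates : ∀ (φ : ℝ → DiffX d X) (ξ : VectorFieldX d X),
    ContMDiff (𝓘(ℝ, ℝ).prod 𝓘(ℝ, Base d)) 𝓘(ℝ, Base d) ∞ (fun p : ℝ × X => φ p.1 p.2) →
    (∀ x, φ 0 x = x) →
    (∀ x, mfderiv 𝓘(ℝ, ℝ) 𝓘(ℝ, Base d) (fun t : ℝ => φ t x) 0 (1 : ℝ) = ξ x) →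
    ∀ y, mfderiv 𝓘(ℝ, ℝ) 𝓘(ℝ, Base d × Fibre m) (fun t : ℝ => lift (φ t) y) 0 (1 : ℝ) = l ξ y
  l_projects : ∀ ξ y,
    mfderiv 𝓘(ℝ, Base d × Fibre m) 𝓘(ℝ, Base d) π y (l ξ y) = ξ (π y)
  l_support : ∀ ξ, π '' closure {y | l ξ y ≠ 0} ⊆ closure {x | ξ x ≠ 0}

/-- A diffeomorphism of `X` preserving the orientation. -/
def PreservesOrientation (o : OrientedAtlas d X) (φ : DiffX d X) : Prop :=
  ∀ e ∈ o.charts, ∀ e' ∈ o.charts, ∀ x ∈ e.source, φ x ∈ e'.source →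
    0 < (fderiv ℝ (e' ∘ φ ∘ e.symm) (e x)).det

/-- `γ'` extends the image of `γ` under the automorphism of `Met(X) ×_X Y` which lifts `φ`: metrics
are pushed forward by `φ`, matter fields are transported by `Φ`. -/
def IsTransported (φ : DiffX d X) (Φ : DiffY d m Y) (γ γ' : LocalField (d := d) (m := m) π) :
    Prop :=
  ∀ x ∈ γ.dom, φ x ∈ γ'.dom ∧ γ'.matter (φ x) = Φ (γ.matter x) ∧
    ∀ α β : TangentSpace 𝓘(ℝ, Base d) (φ x) →L[ℝ] ℝ,
      (γ'.metric (φ x)).1 α β =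
        (γ.metric x).1 (α.comp (mfderiv 𝓘(ℝ, Base d) 𝓘(ℝ, Base d) φ x))
          (β.comp (mfderiv 𝓘(ℝ, Base d) 𝓘(ℝ, Base d) φ x))

/-- `L` is a differential invariant: it is preserved by the lifts of the (orientation preserving)
diffeomorphisms of `X`. -/
def JetFunction.IsInvariant [IsManifold 𝓘(ℝ, Base d) ∞ X]
    [IsManifold 𝓘(ℝ, Base d × Fibre m) ∞ Y] {r : ℕ} (L : JetFunction (m := m) o π r)
    (Λ : CanonicalLifting (d := d) (m := m) π) : Prop :=
  ∀ φ : DiffX d X, PreservesOrientation o φ →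
    ∀ γ γ' : LocalField (d := d) (m := m) π, IsTransported φ (Λ.lift φ) γ γ' →
      ∀ c c' : FiberedChart (m := m) o π, ∀ x ∈ γ.dom,
        γ.matter x ∈ c.total.source → γ'.matter (φ x) ∈ c'.total.source →
        L.expr c' (c'.jet r γ' (c'.base (φ x))) = L.expr c (c.jet r γ (c.base x))

/-- The function `ℒ = L √|det g|`, for which `λ = L dV_g = ℒ ω₀` in the chart `c`. -/
def JetFunction.lagrangian {r : ℕ} (L : JetFunction (m := m) o π r) (c : FiberedChart (m := m) o π)
    (q : JetCoord d m r) : ℝ :=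
  L.expr c q * volDensity (q.2.1 (MultiIdx.nil d r))

/-- `γ` is on-shell for the matter variables: `δℒ/δy^σ` vanishes along `γ`. -/
def JetFunction.OnShell {r : ℕ} (L : JetFunction (m := m) o π r)
    (γ : LocalField (d := d) (m := m) π) : Prop :=
  ∀ c : FiberedChart (m := m) o π, ∀ u ∈ c.fieldDomain γ, ∀ σ : Fin m,
    varDerivMatter (L.lagrangian c) (c.metricRep γ) (c.matterRep γ) u σ = 0

/-! ## The energy-momentum tensor -/

variable [IsManifold 𝓘(ℝ, Base d) ∞ X]

/-- `Ξ^{jk} - g^{jk}_{,i} ξ^i` along the field `γ`, where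
`Ξ^{jk} = ξ^j_{,h} g^{hk} + ξ^k_{,h} g^{jh}` is the fibre component of the canonical lift of `ξ` to
`Met(X)`. -/
def evolutionary (c : FiberedChart (m := m) o π) (γ : LocalField (d := d) (m := m) π)
    (ξ : VectorFieldX d X) (u : Base d) (j k : Fin (d + 1)) : ℝ :=
  ∑ h, (partialD h (fun u' => vectorComp ξ c.base u' j) u * invMetric (c.metricRep γ u) h k
      + partialD h (fun u' => vectorComp ξ c.base u' k) u * invMetric (c.metricRep γ u) j h)
    - ∑ i, partialD i (fun u' => invMetric (c.metricRep γ u') j k) u * vectorComp ξ c.base u i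

/-- The horizontal `n`-form `h i_{JΞ} τ`, evaluated along the field `γ`, where
`τ = (δℒ/δg^{jk}) ω^{jk} ∧ ω₀`, `ω^{jk} = dg^{jk} - g^{jk}_{,i} dx^i`, is the energy-momentum source
form of `λ = L dV_g` and `Ξ` is the canonical lift of `ξ`. -/
def contractedSource {r : ℕ} (L : JetFunction (m := m) o π r) (c : FiberedChart (m := m) o π)
    (γ : LocalField (d := d) (m := m) π) (ξ : VectorFieldX d X) (u : Base d) :
    Base d [⋀^Fin (d + 1)]→L[ℝ] ℝ :=
  (∑ j, ∑ k, varDerivMetric (L.lagrangian c) (c.metricRep γ) (c.matterRep γ) u j k *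
    evolutionary c γ ξ u j k) • omegaZero d

/-- `𝒯` is an energy-momentum tensor of `λ = L dV_g`: it is an `F(X)`-linear map from vector fields
on `X` to horizontal `(n-1)`-forms such that, for an `F(X)`-linear map `ℬ` with values in the
horizontal `n`-forms, `h i_{JΞ} τ = ℬ(ξ) + h d(𝒯(ξ))` for all `ξ`. Both sides are evaluated along
arbitrary local fields; `h dρ` is characterized by `J^{q+1}γ^*(h dρ) = d(J^qγ^*ρ)`. -/
def IsEnergyMomentumTensor {r : ℕ} (L : JetFunction (m := m) o π r)
    (𝒯 : VectorFieldX d X → HorizontalForm (m := m) o π d (2 * r)) : Prop :=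
  IsFunctionLinear 𝒯 ∧
  ∃ ℬ : VectorFieldX d X → HorizontalForm (m := m) o π (d + 1) (2 * r + 1),
    IsFunctionLinear ℬ ∧
    ∀ (ξ : VectorFieldX d X) (c : FiberedChart (m := m) o π) (γ : LocalField (d := d) (m := m) π),
      ∀ u ∈ c.fieldDomain γ,
        contractedSource L c γ ξ u =
          (ℬ ξ).expr c (c.jet (2 * r + 1) γ u) +
            extDeriv (fun u' => (𝒯 ξ).expr c (c.jet (2 * r) γ u')) u

/-- `T = (T^j_i)`, `T q j i = T^j_i(q)`, are the components of `𝒯` in the chart `c`: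
`𝒯(ξ) = T^j_i ξ^i √|det g| ω_j`. -/
def AreComponents {q : ℕ} (𝒯 : VectorFieldX d X → HorizontalForm (m := m) o π d q)
    (c : FiberedChart (m := m) o π) (T : JetCoord d m q → Matrix (Fin (d + 1)) (Fin (d + 1)) ℝ) : Prop :=
  ∀ ξ : VectorFieldX d X, ∀ p ∈ c.jetTarget q,
    (𝒯 ξ).expr c p =
      ∑ j, (∑ i, T p j i * vectorComp ξ c.base p.1 i * volDensity (p.2.1 (MultiIdx.nil d q))) •
        omega j

end Geometry

end MetricBackground

end

open MetricBackground

open scoped Manifold ContDiff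

noncomputable section

namespace MetricBackground

open Set Filter Topology

set_option linter.unusedSectionVars false

/-! ## Iterated directional derivatives -/

section DirectionalDerivatives

variable {E V W : Type*} [NormedAddCommGroup E] [NormedSpace ℝ E]
  [NormedAddCommGroup V] [NormedSpace ℝ V] [NormedAddCommGroup W] [NormedSpace ℝ W]
  {ι : Type*} [LinearOrder ι] {U : Set E} {f g : E → V}

/-! Write `E_{jk}` for the symmetric Euler-Lagrange expression `δℒ/δg^{jk}` and `S^j_i = 2 g^{jh}
E_{hi}`. Along a field, `h i_{JΞ} τ` is `E_{jk}(ξ^j_{,h} g^{hk} + ξ^k_{,h} g^{jh} - g^{jk}_{,i} ξ^i)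
ω₀`. Symmetry of `E` turns the first two terms into `S^h_j ξ^j_{,h}`, and the Leibniz rule gives
`∂_j(S^j_i ξ^i) - ξ^i b_i` with `b_i = ∂_j S^j_i + E_{jk} ∂_i g^{jk}` (`splitting`). So `𝒯(ξ) =
S^j_i ξ^i ω_j` and `ℬ(ξ) = -ξ^i b_i ω₀`, and dividing `S` by the density and lowering the index
gives the Hilbert tensor.

Existence also requires these to be horizontal forms on the jet prolongations. They are functions of
the jet because a derivative of order `k` of a function of `r`-jets depends on the `(r + k)`-jet
only (`multiPartial_comp_jetCoord_congr`); evaluation on the polynomial field with a given jet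
(`taylor`) makes them smooth functions of that jet. They agree across charts because `E` is a tensor
density (`eulerMatrix_change`): the first variation is natural under changes of chart, so its
integrals in two charts agree for all test variations, and the fundamental lemma compares the
coefficients. The law for `ℬ` follows by subtraction, since `d` commutes with pullback.

Uniqueness comes from function linearity. If `f` vanishes at a point, the splitting for `f ξ` reads
`df ∧ 𝒯(ξ)` there, because `ℬ(f ξ) = f ℬ(ξ)` vanishes. As `df` is arbitrary, an `(n-1)`-form is
thereby determined (`form_eq_zero`, `expr_eq_of_splitting`).

For conservation, `√|det g|` times the Levi-Civita divergence of `T` is exactly `b_i`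
(`covDivergence_eq`), so it suffices that `b` vanishes on-shell. A compactly supported vector `η` in
a chart is the initial velocity of an explicit family of diffeomorphisms (`exists_isotopy`),
extended to `X` by the identity and lifted to the fields. Differentiating the invariance of the
Lagrangian at time zero shows that its first variation is a divergence (`infinitesimal_invariance`),
with integral zero. By `integral_first_variation` the same integral pairs the variational
derivatives with the variations of the fields. The matter part dies on-shell, the metric variation
is the one in `splitting`, and there remains `∫ η^i b_i = 0` (`integral_balance`), whence `b = 0`.
-/

/-- The derivative of `f` in the direction of the constant vector `v`. -/
def dirD (v : E) (f : E → V) : E → V := fun x => fderiv ℝ f x v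

/-- The iterated derivative of `f` along the vectors `e i`, for `i` in the multi-index `s`. -/
def multiD (e : ι → E) (s : Multiset ι) (f : E → V) : E → V :=
  (s.sort (· ≤ ·)).foldr (fun i => dirD (e i)) f

theorem dirD_congr (hU : IsOpen U) (h : EqOn f g U) (v : E) : EqOn (dirD v f) (dirD v g) U := by
  intro x hx
  have : f =ᶠ[𝓝 x] g := h.eventuallyEq_of_mem (hU.mem_nhds hx)
  simp only [dirD, this.fderiv_eq]

theorem contDiffOn_dirD (hU : IsOpen U) (hf : ContDiffOn ℝ ∞ f U) (v : E) :
    ContDiffOn ℝ ∞ (dirD v f) U :=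
  (hf.fderiv_of_isOpen hU (by simp)).clm_apply contDiffOn_const

theorem differentiableAt_of_contDiffOn (hf : ContDiffOn ℝ ∞ f U) (hU : IsOpen U)
    {x : E} (hx : x ∈ U) : DifferentiableAt ℝ f x :=
  (hf.contDiffAt (hU.mem_nhds hx)).differentiableAt (by simp)

theorem dirD_comm (hU : IsOpen U) (hf : ContDiffOn ℝ ∞ f U) (v w : E) :
    EqOn (dirD v (dirD w f)) (dirD w (dirD v f)) U := by
  intro x hx
  have hd : DifferentiableAt ℝ (fderiv ℝ f) x :=
    ((hf.fderiv_of_isOpen hU (m := ∞) (by simp)).contDiffAt (hU.mem_nhds hx)).differentiableAt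
      (by simp)
  have key (a b : E) : dirD a (dirD b f) x = fderiv ℝ (fderiv ℝ f) x a b := by
    change fderiv ℝ (fun y => fderiv ℝ f y b) x a = _
    rw [fderiv_clm_apply hd (differentiableAt_const b)]
    simp
  rw [key, key]
  exact ((hf.contDiffAt (hU.mem_nhds hx)).isSymmSndFDerivAt
    (by rw [minSmoothness_of_isRCLikeNormedField]; exact WithTop.coe_le_coe.2 le_top)).eq v w

theorem foldr_dirD_contDiffOn (hU : IsOpen U) (hf : ContDiffOn ℝ ∞ f U) (e : ι → E) (l : List ι) :
    ContDiffOn ℝ ∞ (l.foldr (fun i => dirD (e i)) f) U := by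
  induction l with
  | nil => exact hf
  | cons a l ih => exact contDiffOn_dirD hU ih _

theorem foldr_dirD_congr (hU : IsOpen U) (h : EqOn f g U) (e : ι → E) (l : List ι) :
    EqOn (l.foldr (fun i => dirD (e i)) f) (l.foldr (fun i => dirD (e i)) g) U := by
  induction l with
  | nil => exact h
  | cons a l ih => exact dirD_congr hU ih _

/-- The sorting built into `multiD` is only a choice of order: by symmetry of second derivatives,
smooth functions do not see it. This is what permits recursion on multisets through `multiD_cons`.
-/
theorem foldr_dirD_perm (hU : IsOpen U) (hf : ContDiffOn ℝ ∞ f U) (e : ι → E) {l l' : List ι}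
    (h : l.Perm l') :
    EqOn (l.foldr (fun i => dirD (e i)) f) (l'.foldr (fun i => dirD (e i)) f) U := by
  induction h with
  | nil => exact eqOn_refl _ _
  | cons a _ ih => exact dirD_congr hU ih _
  | swap a b l => exact dirD_comm hU (foldr_dirD_contDiffOn hU hf e l) _ _
  | trans _ _ h1 h2 => exact h1.trans h2

theorem multiD_zero (e : ι → E) (f : E → V) : multiD e 0 f = f := by simp [multiD]

theorem contDiffOn_multiD (hU : IsOpen U) (hf : ContDiffOn ℝ ∞ f U) (e : ι → E) (s : Multiset ι) :
    ContDiffOn ℝ ∞ (multiD e s f) U := foldr_dirD_contDiffOn hU hf e _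

theorem multiD_congr (hU : IsOpen U) (h : EqOn f g U) (e : ι → E) (s : Multiset ι) :
    EqOn (multiD e s f) (multiD e s g) U := foldr_dirD_congr hU h e _

theorem multiD_cons (hU : IsOpen U) (hf : ContDiffOn ℝ ∞ f U) (e : ι → E) (i : ι)
    (s : Multiset ι) : EqOn (multiD e (i ::ₘ s) f) (dirD (e i) (multiD e s f)) U := by
  have h : ((i ::ₘ s).sort (· ≤ ·)).Perm (i :: s.sort (· ≤ ·)) := by
    rw [← Multiset.coe_eq_coe, Multiset.sort_eq, ← Multiset.cons_coe, Multiset.sort_eq]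
  exact foldr_dirD_perm hU hf e h

theorem multiD_dirD (hU : IsOpen U) (hf : ContDiffOn ℝ ∞ f U) (e : ι → E) (v : E)
    (s : Multiset ι) : EqOn (multiD e s (dirD v f)) (dirD v (multiD e s f)) U := by
  induction s using Multiset.induction with
  | empty => simp only [multiD_zero]; exact eqOn_refl _ _
  | cons i s ih =>
    refine (multiD_cons hU (contDiffOn_dirD hU hf v) e i s).trans ?_
    refine (dirD_congr hU ih _).trans ?_
    refine (dirD_comm hU (contDiffOn_multiD hU hf e s) _ _).trans ?_
    exact dirD_congr hU (multiD_cons hU hf e i s).symm _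

theorem multiD_cons' (hU : IsOpen U) (hf : ContDiffOn ℝ ∞ f U) (e : ι → E) (i : ι)
    (s : Multiset ι) : EqOn (multiD e (i ::ₘ s) f) (multiD e s (dirD (e i) f)) U :=
  (multiD_cons hU hf e i s).trans (multiD_dirD hU hf e _ s).symm

theorem multiD_add (hU : IsOpen U) (hf : ContDiffOn ℝ ∞ f U) (e : ι → E)
    (s t : Multiset ι) : EqOn (multiD e (s + t) f) (multiD e s (multiD e t f)) U := by
  induction s using Multiset.induction with
  | empty => simp only [multiD_zero, zero_add]; exact eqOn_refl _ _
  | cons i s ih =>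
    rw [Multiset.cons_add]
    refine (multiD_cons hU hf e i _).trans ?_
    refine (dirD_congr hU ih _).trans ?_
    exact (multiD_cons hU (contDiffOn_multiD hU hf e t) e i s).symm

theorem dirD_clm (hU : IsOpen U) (hf : ContDiffOn ℝ ∞ f U) (v : E) (l : V →L[ℝ] W) :
    EqOn (dirD v (fun x => l (f x))) (fun x => l (dirD v f x)) U := by
  intro x hx
  have := (l.hasFDerivAt.comp x (differentiableAt_of_contDiffOn hf hU hx).hasFDerivAt).fderiv
  simp only [dirD]
  rw [show (fun x => l (f x)) = l ∘ f from rfl, this]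
  rfl

theorem multiD_clm (hU : IsOpen U) (hf : ContDiffOn ℝ ∞ f U) (e : ι → E) (l : V →L[ℝ] W)
    (s : Multiset ι) : EqOn (multiD e s (fun x => l (f x))) (fun x => l (multiD e s f x)) U := by
  induction s using Multiset.induction with
  | empty => simp only [multiD_zero]; exact eqOn_refl _ _
  | cons i s ih =>
    refine (multiD_cons hU (l.contDiff.comp_contDiffOn hf) e i _).trans ?_
    refine (dirD_congr hU ih _).trans ?_
    refine (dirD_clm hU (contDiffOn_multiD hU hf e s) _ l).trans ?_
    intro x hx
    simp only [multiD_cons hU hf e i s hx]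

theorem dirD_add (hU : IsOpen U) (hf : ContDiffOn ℝ ∞ f U) (hg : ContDiffOn ℝ ∞ g U) (v : E) :
    EqOn (dirD v (fun x => f x + g x)) (fun x => dirD v f x + dirD v g x) U := by
  intro x hx
  simp only [dirD]
  rw [fderiv_fun_add (differentiableAt_of_contDiffOn hf hU hx)
    (differentiableAt_of_contDiffOn hg hU hx)]
  rfl

theorem multiD_fun_add (hU : IsOpen U) (hf : ContDiffOn ℝ ∞ f U) (hg : ContDiffOn ℝ ∞ g U)
    (e : ι → E) (s : Multiset ι) :
    EqOn (multiD e s (fun x => f x + g x)) (fun x => multiD e s f x + multiD e s g x) U := by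
  induction s using Multiset.induction with
  | empty => simp only [multiD_zero]; exact eqOn_refl _ _
  | cons i s ih =>
    refine (multiD_cons hU (hf.add hg) e i _).trans ?_
    refine (dirD_congr hU ih _).trans ?_
    refine (dirD_add hU (contDiffOn_multiD hU hf e s) (contDiffOn_multiD hU hg e s) _).trans ?_
    intro x hx
    simp only [multiD_cons hU hf e i s hx, multiD_cons hU hg e i s hx]

theorem multiD_fun_smul (hU : IsOpen U) (hf : ContDiffOn ℝ ∞ f U) (c : ℝ) (e : ι → E)
    (s : Multiset ι) : EqOn (multiD e s (fun x => c • f x)) (fun x => c • multiD e s f x) U :=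
  multiD_clm hU hf e (c • ContinuousLinearMap.id ℝ V) s

theorem multiD_const_zero (e : ι → E) (s : Multiset ι) :
    multiD e s (fun _ => (0 : V)) = fun _ => 0 := by
  have := multiD_clm isOpen_univ (contDiffOn_const (c := (0 : V)) (n := ∞)) e
    (0 : V →L[ℝ] V) s
  funext x
  simpa using this (mem_univ x)

theorem multiD_fun_sum {κ : Type*} (t : Finset κ) {F : κ → E → V} (hU : IsOpen U)
    (hF : ∀ k ∈ t, ContDiffOn ℝ ∞ (F k) U) (e : ι → E) (s : Multiset ι) :
    EqOn (multiD e s (fun x => ∑ k ∈ t, F k x)) (fun x => ∑ k ∈ t, multiD e s (F k) x) U := by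
  classical
  induction t using Finset.induction_on with
  | empty => simp only [Finset.sum_empty, multiD_const_zero]; exact eqOn_refl _ _
  | insert a t ha ih =>
    have h1 : ∀ k ∈ t, ContDiffOn ℝ ∞ (F k) U := fun k hk => hF k (Finset.mem_insert_of_mem hk)
    simp only [Finset.sum_insert ha]
    refine (multiD_fun_add hU (hF a (Finset.mem_insert_self a t)) (ContDiffOn.sum h1) e s).trans ?_
    intro x hx
    simp only [ih h1 hx]

theorem multiD_comp_sub (e : ι → E) (s : Multiset ι) (f : E → V) (a x : E) :
    multiD e s (fun z => f (z - a)) x = multiD e s f (x - a) := by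
  have : ∀ l : List ι, l.foldr (fun i => dirD (e i)) (fun z => f (z - a)) =
      fun z => l.foldr (fun i => dirD (e i)) f (z - a) := by
    intro l
    induction l with
    | nil => rfl
    | cons i l ih =>
      simp only [List.foldr_cons, ih]
      funext z
      simp only [dirD]
      rw [fderiv_comp_sub]
  exact congrFun (this _) x

/-- If `a` and `b` have the same derivatives of order at most `k` at a point, so have
`f ∘ a` and `f ∘ b`. -/
theorem multiD_comp_eq {V' W' : Type*} [NormedAddCommGroup W'] [NormedSpace ℝ W']
    [NormedAddCommGroup V'] [NormedSpace ℝ V'] (e : ι → E) {x : E} {U : Set E} (hU : IsOpen U)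
    (hx : x ∈ U) (k : ℕ) {Ω : Set W'} (hΩ : IsOpen Ω) {f : W' → V'} (hf : ContDiffOn ℝ ∞ f Ω)
    {a b : E → W'} (ha : ContDiffOn ℝ ∞ a U) (hb : ContDiffOn ℝ ∞ b U) (haΩ : MapsTo a U Ω)
    (hbΩ : MapsTo b U Ω)
    (hab : ∀ s : Multiset ι, s.card ≤ k → multiD e s a x = multiD e s b x)
    (s : Multiset ι) (hs : s.card ≤ k) :
    multiD e s (fun z => f (a z)) x = multiD e s (fun z => f (b z)) x := by
  -- The space `W'` must vary: the derivative of `f ∘ a` is `F ∘ (a, ∂a)` with `F(p, q) = Df(p) q`,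
  -- so the induction hypothesis is applied to maps into `W' × W'`, with one order of
  -- differentiation less.
  induction k generalizing W' s with
  | zero =>
    have hs0 : s = 0 := by simpa using hs
    have := hab 0 (by simp)
    simp only [multiD_zero, hs0] at this ⊢
    rw [this]
  | succ k ih =>
    induction s using Multiset.induction with
    | empty =>
      have := hab 0 (by simp)
      simp only [multiD_zero] at this ⊢
      rw [this]
    | cons i s _ =>
      have hs' : s.card ≤ k := by simpa using hs
      have hcomp (a : E → W') (ha : ContDiffOn ℝ ∞ a U) (haΩ : MapsTo a U Ω) :
          multiD e (i ::ₘ s) (fun z => f (a z)) x =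
            multiD e s (fun z => fderiv ℝ f (a z) (dirD (e i) a z)) x := by
        have hfa : ContDiffOn ℝ ∞ (fun z => f (a z)) U := hf.comp ha haΩ
        rw [multiD_cons' hU hfa e i s hx]
        refine multiD_congr hU (fun z hz => ?_) e s hx
        simp only [dirD]
        have := ((differentiableAt_of_contDiffOn hf hΩ (haΩ hz)).hasFDerivAt.comp z
          (differentiableAt_of_contDiffOn ha hU hz).hasFDerivAt).fderiv
        rw [show (fun z => f (a z)) = f ∘ a from rfl, this]
        rfl
      rw [hcomp a ha haΩ, hcomp b hb hbΩ]
      have hF : ContDiffOn ℝ ∞ (fun p : W' × W' => fderiv ℝ f p.1 p.2) (Ω ×ˢ univ) := by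
        refine ContDiffOn.clm_apply ?_ contDiffOn_snd
        exact (hf.fderiv_of_isOpen hΩ (m := ∞) (by simp)).comp contDiffOn_fst (fun p hp => hp.1)
      refine ih (hΩ.prod isOpen_univ) hF (a := fun z => (a z, dirD (e i) a z))
        (b := fun z => (b z, dirD (e i) b z)) (ha.prodMk (contDiffOn_dirD hU ha _))
        (hb.prodMk (contDiffOn_dirD hU hb _)) (fun z hz => ⟨haΩ hz, mem_univ _⟩)
        (fun z hz => ⟨hbΩ hz, mem_univ _⟩) ?_ s hs'
      intro t ht
      have e1 := multiD_clm hU (ha.prodMk (contDiffOn_dirD hU ha (e i))) e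
        (ContinuousLinearMap.fst ℝ W' W') t hx
      have e2 := multiD_clm hU (ha.prodMk (contDiffOn_dirD hU ha (e i))) e
        (ContinuousLinearMap.snd ℝ W' W') t hx
      have e3 := multiD_clm hU (hb.prodMk (contDiffOn_dirD hU hb (e i))) e
        (ContinuousLinearMap.fst ℝ W' W') t hx
      have e4 := multiD_clm hU (hb.prodMk (contDiffOn_dirD hU hb (e i))) e
        (ContinuousLinearMap.snd ℝ W' W') t hx
      simp only [ContinuousLinearMap.coe_fst', ContinuousLinearMap.coe_snd'] at e1 e2 e3 e4
      refine Prod.ext ?_ ?_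
      · rw [← e1, ← e3]
        exact hab t (ht.trans (Nat.le_succ k))
      · rw [← e2, ← e4]
        have h1 := hab (i ::ₘ t) (by simpa using ht)
        rw [multiD_cons' hU ha e i t hx, multiD_cons' hU hb e i t hx] at h1
        exact h1

end DirectionalDerivatives

/-! ## Partial derivatives on `ℝⁿ` -/

section Partial

variable {d : ℕ} {V W P : Type*} [NormedAddCommGroup V] [NormedSpace ℝ V]
  [NormedAddCommGroup W] [NormedSpace ℝ W] [NormedAddCommGroup P] [NormedSpace ℝ P]

/-- The standard basis of `ℝⁿ`. -/
def bas (d : ℕ) (i : Fin (d + 1)) : Base d := EuclideanSpace.single i 1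

theorem partialD_eq (i : Fin (d + 1)) (f : Base d → V) : partialD i f = dirD (bas d i) f := rfl

theorem multiPartial_eq (s : Multiset (Fin (d + 1))) (f : Base d → V) :
    multiPartial s f = multiD (bas d) s f := rfl

theorem dirD_slice {D : Set (P × Base d)} (hD : IsOpen D) {F : P × Base d → V}
    (hF : ContDiffOn ℝ ∞ F D) (v : Base d) {p : P} {x : Base d} (hx : (p, x) ∈ D) :
    dirD v (fun z => F (p, z)) x = dirD ((0 : P), v) F (p, x) := by
  have h1 : HasFDerivAt (fun z : Base d => (p, z)) (ContinuousLinearMap.inr ℝ P (Base d)) x :=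
    hasFDerivAt_prodMk_right p x
  have := ((differentiableAt_of_contDiffOn hF hD hx).hasFDerivAt.comp x h1).fderiv
  simp only [dirD]
  rw [show (fun z => F (p, z)) = F ∘ (fun z => (p, z)) from rfl, this]
  rfl

theorem isOpen_slice {D : Set (P × Base d)} (hD : IsOpen D) (p : P) :
    IsOpen {x : Base d | (p, x) ∈ D} := hD.preimage (by fun_prop)

theorem contDiffOn_slice {D : Set (P × Base d)} {F : P × Base d → V}
    (hF : ContDiffOn ℝ ∞ F D) (p : P) :
    ContDiffOn ℝ ∞ (fun z => F (p, z)) {x : Base d | (p, x) ∈ D} :=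
  hF.comp (contDiffOn_const.prodMk contDiffOn_id) (fun _ hx => hx)

/-- Derivatives at a frozen parameter are derivatives of the joint function along the vectors `(0,
e_i)`. Joint smoothness in parameter and point, and commutation with parameter derivatives, then
need no separate argument. -/
theorem multiPartial_slice {D : Set (P × Base d)} (hD : IsOpen D) {F : P × Base d → V}
    (hF : ContDiffOn ℝ ∞ F D) (s : Multiset (Fin (d + 1))) {p : P} {x : Base d}
    (hx : (p, x) ∈ D) :
    multiPartial s (fun z => F (p, z)) x = multiD (fun i => ((0 : P), bas d i)) s F (p, x) := by
  rw [multiPartial_eq]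
  induction s using Multiset.induction generalizing x with
  | empty => simp only [multiD_zero]
  | cons i s ih =>
    rw [multiD_cons (isOpen_slice hD p) (contDiffOn_slice hF p) _ i s hx,
      dirD_congr (isOpen_slice hD p) (fun z hz => ih hz) _ hx,
      multiD_cons hD hF _ i s hx, dirD_slice hD (contDiffOn_multiD hD hF _ s) _ hx]

theorem contDiffOn_multiPartial_slice {D : Set (P × Base d)} (hD : IsOpen D) {F : P × Base d → V}
    (hF : ContDiffOn ℝ ∞ F D) (s : Multiset (Fin (d + 1))) :
    ContDiffOn ℝ ∞ (fun q : P × Base d => multiPartial s (fun z => F (q.1, z)) q.2) D :=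
  (contDiffOn_multiD hD hF (fun i => ((0 : P), bas d i)) s).congr
    fun _ hq => multiPartial_slice hD hF s hq

/-- Derivatives with respect to a parameter and with respect to the coordinates commute. -/
theorem hasDerivAt_multiPartial {D : Set (ℝ × Base d)} (hD : IsOpen D) {F : ℝ × Base d → V}
    (hF : ContDiffOn ℝ ∞ F D) (s : Multiset (Fin (d + 1))) {t : ℝ} {x : Base d}
    (hx : (t, x) ∈ D) :
    HasDerivAt (fun τ => multiPartial s (fun z => F (τ, z)) x)
      (multiPartial s (fun z => dirD ((1 : ℝ), (0 : Base d)) F (t, z)) x) t := by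
  have h2 := contDiffOn_multiD hD hF (fun i => ((0 : ℝ), bas d i)) s
  have h1 : HasDerivAt (fun τ : ℝ => (τ, x)) ((1 : ℝ), (0 : Base d)) t :=
    (hasDerivAt_id t).prodMk (hasDerivAt_const t x)
  have h3 := (differentiableAt_of_contDiffOn h2 hD hx).hasFDerivAt.comp_hasDerivAt t h1
  have h4 : (fun τ => multiPartial s (fun z => F (τ, z)) x) =ᶠ[𝓝 t]
      (multiD (fun i => ((0 : ℝ), bas d i)) s F) ∘ (fun τ : ℝ => (τ, x)) := by
    have : ∀ᶠ τ in 𝓝 t, (τ, x) ∈ D :=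
      (show ContinuousAt (fun τ : ℝ => (τ, x)) t by fun_prop).eventually (hD.mem_nhds hx)
    filter_upwards [this] with τ hτ
    exact multiPartial_slice hD hF s hτ
  refine (h3.congr_of_eventuallyEq h4).congr_deriv ?_
  rw [multiPartial_slice hD (contDiffOn_dirD hD hF _) s hx, multiD_dirD hD hF _ _ s hx]
  rfl

end Partial

/-! ## Integration by parts and the fundamental lemma -/

section Integration

open MeasureTheory

variable {d : ℕ} {V : Type*} [NormedAddCommGroup V] [NormedSpace ℝ V] {U : Set (Base d)}

/-- `η` is a test function on `U`. -/
structure IsTest (U : Set (Base d)) (η : Base d → V) : Prop where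
  contDiff : ContDiff ℝ ∞ η
  hasCompactSupport : HasCompactSupport η
  tsupport_subset : tsupport η ⊆ U

theorem contDiff_of_contDiffOn_of_tsupport {K : Set (Base d)} (hK : IsClosed K) (hKU : K ⊆ U)
    (hU : IsOpen U) {f : Base d → V} (hf : ContDiffOn ℝ ∞ f U) (h0 : ∀ x ∉ K, f x = 0) :
    ContDiff ℝ ∞ f := by
  rw [contDiff_iff_contDiffAt]
  intro x
  by_cases hx : x ∈ K
  · exact hf.contDiffAt (hU.mem_nhds (hKU hx))
  · have : f =ᶠ[𝓝 x] fun _ => 0 :=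
      Filter.eventuallyEq_of_mem (hK.isOpen_compl.mem_nhds hx) h0
    exact contDiffAt_const.congr_of_eventuallyEq this

theorem isTest_of_contDiffOn {K : Set (Base d)} (hK : IsCompact K) (hKU : K ⊆ U)
    (hU : IsOpen U) {f : Base d → V} (hf : ContDiffOn ℝ ∞ f U) (h0 : ∀ x ∉ K, f x = 0) :
    IsTest U f where
  contDiff := contDiff_of_contDiffOn_of_tsupport hK.isClosed hKU hU hf h0
  hasCompactSupport := HasCompactSupport.intro hK h0
  tsupport_subset := (closure_minimal (fun x hx => Not.imp_symm (h0 x) hx)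
    hK.isClosed).trans hKU

theorem IsTest.eq_zero {η : Base d → V} (hη : IsTest U η) {x : Base d} (hx : x ∉ U) : η x = 0 :=
  image_eq_zero_of_notMem_tsupport fun h => hx (hη.tsupport_subset h)

theorem IsTest.smul {η : Base d → V} (hη : IsTest U η) (hU : IsOpen U) {f : Base d → ℝ}
    (hf : ContDiffOn ℝ ∞ f U) : IsTest U fun x => f x • η x :=
  isTest_of_contDiffOn hη.hasCompactSupport hη.tsupport_subset hU
    (hf.smul hη.contDiff.contDiffOn)
    fun x hx => by rw [image_eq_zero_of_notMem_tsupport hx, smul_zero]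

theorem IsTest.smul_const {η : Base d → ℝ} (hη : IsTest U η) (v : V) :
    IsTest U fun x => η x • v :=
  ⟨hη.contDiff.smul contDiff_const, hη.hasCompactSupport.smul_right,
    (tsupport_smul_subset_left η _).trans hη.tsupport_subset⟩

theorem IsTest.dirD {η : Base d → V} (hη : IsTest U η) (v : Base d) : IsTest U (dirD v η) where
  contDiff := contDiffOn_univ.1 (contDiffOn_dirD isOpen_univ hη.contDiff.contDiffOn v)
  hasCompactSupport := hη.hasCompactSupport.fderiv_apply ℝ v
  tsupport_subset := (tsupport_fderiv_apply_subset ℝ v).trans hη.tsupport_subset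

theorem IsTest.multiPartial {η : Base d → V} (hη : IsTest U η) (s : Multiset (Fin (d + 1))) :
    IsTest U (multiPartial s η) := by
  rw [multiPartial_eq, multiD]
  induction s.sort (· ≤ ·) with
  | nil => exact hη
  | cons i l ih => exact ih.dirD _

theorem IsTest.clm {W : Type*} [NormedAddCommGroup W] [NormedSpace ℝ W] {η : Base d → V}
    (hη : IsTest U η) (l : V →L[ℝ] W) : IsTest U fun x => l (η x) where
  contDiff := l.contDiff.comp hη.contDiff
  hasCompactSupport := hη.hasCompactSupport.comp_left (map_zero l)
  tsupport_subset := (tsupport_comp_subset (map_zero l) η).trans hη.tsupport_subset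

theorem IsTest.integrable {η : Base d → ℝ} (hη : IsTest U η) : Integrable η :=
  hη.contDiff.continuous.integrable_of_hasCompactSupport hη.hasCompactSupport

theorem IsTest.integral_dirD {η : Base d → ℝ} (hη : IsTest U η) (v : Base d) :
    ∫ x, MetricBackground.dirD v η x = 0 := by
  -- Integration by parts against the constant function `1`.
  have := integral_mul_fderiv_eq_neg_fderiv_mul_of_integrable (μ := (volume : Measure (Base d)))
    (f := fun _ : Base d => (1 : ℝ)) (g := η) (v := v) (by simp)
    (by simp only [one_mul]; exact (hη.dirD v).integrable) (by simpa using hη.integrable)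
    (fun x _ => differentiableAt_const _) (fun x _ => hη.contDiff.differentiable (by simp) x)
  simpa [MetricBackground.dirD] using this

theorem integral_mul_dirD (hU : IsOpen U) {f η : Base d → ℝ} (hf : ContDiffOn ℝ ∞ f U)
    (hη : IsTest U η) (v : Base d) :
    ∫ x, f x * dirD v η x = - ∫ x, dirD v f x * η x := by
  have h1 := ((hη.dirD v).smul hU hf).integrable
  have h2 := (hη.smul hU (contDiffOn_dirD hU hf v)).integrable
  have h3 := (hη.smul hU hf).integral_dirD v
  simp only [smul_eq_mul] at h1 h2 h3
  rw [eq_neg_iff_add_eq_zero, ← integral_add h1 h2, ← h3]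
  refine integral_congr_ae (Eventually.of_forall fun x => ?_)
  -- The function `f` is smooth on `U` only. Outside `U` all three integrands vanish with `η`, so
  -- the product rule is needed only inside.
  by_cases hx : x ∈ U
  · simp only [dirD]
    rw [fderiv_fun_mul (differentiableAt_of_contDiffOn hf hU hx)
      (hη.contDiff.differentiable (by simp) x)]
    simp [mul_comm]
  · have e1 := (hη.dirD v).eq_zero hx
    have e2 := hη.eq_zero hx
    have e3 := ((hη.smul hU hf).dirD v).eq_zero hx
    simp only [smul_eq_mul] at e3
    simp only [e1, e2, e3, mul_zero, add_zero]

theorem integral_mul_multiPartial (hU : IsOpen U) {f η : Base d → ℝ} (hf : ContDiffOn ℝ ∞ f U)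
    (hη : IsTest U η) (s : Multiset (Fin (d + 1))) :
    ∫ x, f x * multiPartial s η x = (-1) ^ s.card * ∫ x, multiPartial s f x * η x := by
  induction s using Multiset.induction generalizing f with
  | empty => simp [multiPartial_eq, multiD_zero]
  | cons i s ih =>
    have h1 : ∀ x, multiPartial (i ::ₘ s) η x = dirD (bas d i) (multiPartial s η) x := fun x =>
      multiD_cons isOpen_univ hη.contDiff.contDiffOn (bas d) i s (mem_univ x)
    simp only [h1]
    -- The outermost derivative of `η` moves first and becomes the innermost one on `f`, which is
    -- why `multiD_cons` is used for `η` and `multiD_cons'` for `f`.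
    rw [integral_mul_dirD hU hf (hη.multiPartial s), ih (contDiffOn_dirD hU hf _),
      Multiset.card_cons, pow_succ, ← integral_const_mul, ← integral_neg, ← integral_const_mul]
    refine integral_congr_ae (Eventually.of_forall fun x => ?_)
    by_cases hx : x ∈ U
    · simp only [multiPartial_eq, multiD_cons' hU hf (bas d) i s hx]
      ring
    · simp [hη.eq_zero hx]

/-- The fundamental lemma of the calculus of variations: the integrals give vanishing almost
everywhere on `U`, and continuity improves this to everywhere. -/
theorem eqOn_zero_of_integral_mul_eq_zero (hU : IsOpen U) {f : Base d → ℝ}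
    (hf : ContinuousOn f U) (h : ∀ η : Base d → ℝ, IsTest U η → ∫ x, f x * η x = 0) :
    ∀ x ∈ U, f x = 0 := by
  have h1 := hU.ae_eq_zero_of_integral_contDiff_smul_eq_zero (μ := (volume : Measure (Base d)))
    (hf.locallyIntegrableOn hU.measurableSet)
    (fun g hg hg' hg'' => by simpa [mul_comm] using h g ⟨hg, hg', hg''⟩)
  have h2 : f =ᵐ[volume.restrict U] fun _ => 0 := by
    rw [EventuallyEq, ae_restrict_iff' hU.measurableSet]
    exact h1
  exact Measure.eqOn_open_of_ae_eq h2 hU hf continuousOn_const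

end Integration

/-! ## Fields with prescribed jets -/

section Taylor

variable {d : ℕ} {V : Type*} [NormedAddCommGroup V] [NormedSpace ℝ V]

/-- The monomial `x^s`. -/
def monom (s : Multiset (Fin (d + 1))) (x : Base d) : ℝ := (s.map fun i => x i).prod

theorem monom_cons (i : Fin (d + 1)) (s : Multiset (Fin (d + 1))) (x : Base d) :
    monom (i ::ₘ s) x = x i * monom s x := by simp [monom]

theorem contDiff_monom (s : Multiset (Fin (d + 1))) : ContDiff ℝ ∞ (monom s) := by
  induction s using Multiset.induction with
  | empty =>
    rw [show monom (0 : Multiset (Fin (d + 1))) = fun _ => 1 by ext; simp [monom]]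
    exact contDiff_const
  | cons i s ih =>
    rw [show monom (i ::ₘ s) = fun x => x i * monom s x from funext (monom_cons i s)]
    exact ContDiff.mul (by fun_prop) ih

theorem partialD_monom (i : Fin (d + 1)) (s : Multiset (Fin (d + 1))) (x : Base d) :
    partialD i (monom s) x = s.count i * monom (s.erase i) x := by
  induction s using Multiset.induction with
  | empty =>
    have : monom (0 : Multiset (Fin (d + 1))) = fun _ => 1 := by ext; simp [monom]
    simp [partialD, this]
  | cons j s ih =>
    have h1 : HasFDerivAt (fun x : Base d => x j) (EuclideanSpace.proj j : Base d →L[ℝ] ℝ) x :=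
      (EuclideanSpace.proj j : Base d →L[ℝ] ℝ).hasFDerivAt
    have h2 := ((contDiff_monom s).differentiable (by simp) x).hasFDerivAt
    have h3 : HasFDerivAt (monom (j ::ₘ s)) _ x :=
      (h1.mul h2).congr_of_eventuallyEq (Eventually.of_forall (monom_cons j s))
    rw [partialD, h3.fderiv]
    simp only [partialD] at ih
    simp only [add_apply, smul_apply, ih, smul_eq_mul,
      PiLp.proj_apply]
    rcases eq_or_ne i j with rfl | hij
    · simp only [Multiset.count_cons_self, Multiset.erase_cons_head, Nat.cast_add, Nat.cast_one]
      by_cases hi : i ∈ s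
      · have e : monom s x = x i * monom (s.erase i) x := by
          rw [← monom_cons, Multiset.cons_erase hi]
        rw [e]
        simp
        ring
      · simp [Multiset.count_eq_zero_of_notMem hi]
    · rw [Multiset.count_cons_of_ne hij, Multiset.erase_cons_tail _ (Ne.symm hij), monom_cons]
      simp [hij.symm]
      ring

/-- At the origin, monomials and derivatives are dual up to nonzero factors. Only the non-vanishing
of these factors is recorded, so `taylor` can divide by them without computing factorials. -/
theorem multiPartial_monom_zero (s t : Multiset (Fin (d + 1))) :
    multiPartial t (monom s) 0 ≠ 0 ↔ s = t := by
  induction t using Multiset.induction generalizing s with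
  | empty =>
    simp only [multiPartial_eq, multiD_zero]
    constructor
    · intro h
      by_contra hs
      obtain ⟨i, hi⟩ := Multiset.exists_mem_of_ne_zero hs
      exact h (Multiset.prod_eq_zero (Multiset.mem_map.2 ⟨i, hi, rfl⟩))
    · rintro rfl; simp [monom]
  | cons i t ih =>
    have h1 := multiD_cons' isOpen_univ (contDiff_monom s).contDiffOn (bas d) i t
      (mem_univ (0 : Base d))
    have h2 : dirD (bas d i) (monom s) = fun x => (s.count i : ℝ) • monom (s.erase i) x :=
      funext (partialD_monom i s)
    rw [multiPartial_eq, h1, h2, multiD_fun_smul isOpen_univ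
      (contDiff_monom (s.erase i)).contDiffOn _ _ _ (mem_univ _), smul_ne_zero_iff,
      ← multiPartial_eq, ih]
    constructor
    · rintro ⟨h, rfl⟩
      refine (Multiset.cons_erase ?_).symm
      by_contra hi
      exact h (by simp [Multiset.count_eq_zero_of_notMem hi])
    · rintro rfl
      simp
      positivity

/-- The polynomial map with derivatives `p` at the point `a`. -/
def taylor {R : ℕ} (a : Base d) (p : MultiIdx d R → V) (x : Base d) : V :=
  ∑ s : MultiIdx d R, ((multiPartial (s.2 : Multiset (Fin (d + 1)))
    (monom (s.2 : Multiset (Fin (d + 1)))) 0)⁻¹ *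
      monom (s.2 : Multiset (Fin (d + 1))) (x - a)) • p s

theorem MultiIdx.ext_coe {R : ℕ} {s t : MultiIdx d R}
    (h : (s.2 : Multiset (Fin (d + 1))) = (t.2 : Multiset (Fin (d + 1)))) : s = t := by
  obtain ⟨k, s⟩ := s
  obtain ⟨l, t⟩ := t
  have hk : k = l := by
    apply Fin.ext
    rw [← s.2, ← t.2]
    exact congrArg Multiset.card h
  subst hk
  congr 1
  exact Subtype.ext h

theorem contDiff_taylor {R : ℕ} (a : Base d) (p : MultiIdx d R → V) :
    ContDiff ℝ ∞ (taylor a p) := by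
  refine ContDiff.sum fun s _ => ContDiff.smul (contDiff_const.mul ?_) contDiff_const
  exact (contDiff_monom _).comp (contDiff_id.sub contDiff_const)

/-- Joint smoothness in the base point, the jet and the argument is what makes a quantity computed
on the polynomial representative a smooth function of the jet. -/
theorem contDiff_taylor_uncurry {R : ℕ} :
    ContDiff ℝ ∞ fun q : (Base d × (MultiIdx d R → V)) × Base d => taylor q.1.1 q.1.2 q.2 := by
  refine ContDiff.sum fun s _ => ContDiff.smul (contDiff_const.mul ?_) (by fun_prop)
  exact (contDiff_monom _).comp (contDiff_snd.sub (contDiff_fst.comp contDiff_fst))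

theorem multiPartial_taylor {R : ℕ} (a : Base d) (p : MultiIdx d R → V) (t : MultiIdx d R) :
    multiPartial (t.2 : Multiset (Fin (d + 1))) (taylor a p) a = p t := by
  have hm (s : MultiIdx d R) :
      ContDiffOn ℝ ∞ (fun x => monom (s.2 : Multiset (Fin (d + 1))) (x - a)) univ :=
    ((contDiff_monom _).comp (contDiff_id.sub contDiff_const)).contDiffOn
  have hk (s : MultiIdx d R) (c : ℝ) : multiD (bas d) (t.2 : Multiset (Fin (d + 1)))
      (fun x => (c * monom (s.2 : Multiset (Fin (d + 1))) (x - a)) • p s) a =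
      (c * multiPartial (t.2 : Multiset (Fin (d + 1)))
        (monom (s.2 : Multiset (Fin (d + 1)))) 0) • p s := by
    have h1 := multiD_clm isOpen_univ (hm s) (bas d)
      ((c • (1 : ℝ →L[ℝ] ℝ)).smulRight (p s)) (t.2 : Multiset (Fin (d + 1))) (mem_univ a)
    have e := multiD_comp_sub (bas d) (t.2 : Multiset (Fin (d + 1)))
      (monom (s.2 : Multiset (Fin (d + 1)))) a a
    rw [sub_self] at e
    simp only [e] at h1
    exact h1
  have h1 := multiD_fun_sum Finset.univ isOpen_univ (U := univ)
    (F := fun (s : MultiIdx d R) (x : Base d) => ((multiPartial (s.2 : Multiset (Fin (d + 1)))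
      (monom (s.2 : Multiset (Fin (d + 1)))) 0)⁻¹ *
        monom (s.2 : Multiset (Fin (d + 1))) (x - a)) • p s)
    (fun s _ => (contDiffOn_const.mul (hm s)).smul contDiffOn_const) (bas d)
    (t.2 : Multiset (Fin (d + 1))) (mem_univ a)
  refine h1.trans ?_
  simp only [hk]
  rw [Finset.sum_eq_single t]
  · have hne := (multiPartial_monom_zero (t.2 : Multiset (Fin (d + 1))) t.2).2 rfl
    rw [inv_mul_cancel₀ hne, one_smul]
  · intro s _ hst
    have hne := (multiPartial_monom_zero (s.2 : Multiset (Fin (d + 1))) t.2).not.2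
      (fun h => hst (MultiIdx.ext_coe h))
    rw [not_not] at hne
    rw [hne, mul_zero, zero_smul]
  · simp

end Taylor

/-! ## Jets of fields in coordinates -/

section Jets

open MeasureTheory

variable {d m r R : ℕ} {U : Set (Base d)} {G G' : Base d → SymArray d} {y y' : Base d → Fibre m}
  {x : Base d}

/-- The multi-index with a given underlying multiset. -/
def MultiIdx.mk (t : Multiset (Fin (d + 1))) (h : t.card ≤ R) : MultiIdx d R :=
  ⟨⟨t.card, Nat.lt_succ_of_le h⟩, ⟨t, rfl⟩⟩

theorem MultiIdx.card_le (s : MultiIdx d R) : (s.2 : Multiset (Fin (d + 1))).card ≤ R := by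
  have h : (s.2 : Multiset (Fin (d + 1))).card = s.1 := s.2.2
  rw [h]
  exact Nat.le_of_lt_succ s.1.2

theorem contDiffOn_jetCoord (hU : IsOpen U) (hG : ContDiffOn ℝ ∞ G U) (hy : ContDiffOn ℝ ∞ y U) :
    ContDiffOn ℝ ∞ (jetCoord r G y) U :=
  contDiffOn_id.prodMk ((contDiffOn_pi.2 fun _ => contDiffOn_multiD hU hG (bas d) _).prodMk
    (contDiffOn_pi.2 fun _ => contDiffOn_multiD hU hy (bas d) _))

theorem jetCoord_congr (hU : IsOpen U) (hG : EqOn G G' U) (hy : EqOn y y' U) :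
    EqOn (jetCoord r G y) (jetCoord r G' y') U := by
  intro x hx
  refine Prod.ext rfl (Prod.ext ?_ ?_) <;> funext s
  · exact multiD_congr hU hG (bas d) _ hx
  · exact multiD_congr hU hy (bas d) _ hx

theorem jetCoord_nil_metric : (jetCoord r G y x).2.1 (MultiIdx.nil d r) = G x := by
  change multiPartial 0 G x = G x
  rw [multiPartial_eq, multiD_zero]

theorem jetCoord_nil_matter : (jetCoord r G y x).2.2 (MultiIdx.nil d r) = y x := by
  change multiPartial 0 y x = y x
  rw [multiPartial_eq, multiD_zero]

theorem multiPartial_eq_of_jetCoord_eq (h : jetCoord R G y x = jetCoord R G' y' x)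
    (t : Multiset (Fin (d + 1))) (ht : t.card ≤ R) :
    multiPartial t G x = multiPartial t G' x ∧ multiPartial t y x = multiPartial t y' x :=
  ⟨congrFun (congrArg (fun q => q.2.1) h) (MultiIdx.mk t ht),
    congrFun (congrArg (fun q => q.2.2) h) (MultiIdx.mk t ht)⟩

theorem jetCoord_eq_of_multiPartial_eq
    (hG : ∀ t : Multiset (Fin (d + 1)), t.card ≤ R → multiPartial t G x = multiPartial t G' x)
    (hy : ∀ t : Multiset (Fin (d + 1)), t.card ≤ R → multiPartial t y x = multiPartial t y' x) :
    jetCoord R G y x = jetCoord R G' y' x :=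
  Prod.ext rfl (Prod.ext (funext fun s => hG _ s.card_le) (funext fun s => hy _ s.card_le))

theorem jetCoord_eq_of_le (hrR : r ≤ R) (h : jetCoord R G y x = jetCoord R G' y' x) :
    jetCoord r G y x = jetCoord r G' y' x :=
  jetCoord_eq_of_multiPartial_eq
    (fun t ht => (multiPartial_eq_of_jetCoord_eq h t (ht.trans hrR)).1)
    (fun t ht => (multiPartial_eq_of_jetCoord_eq h t (ht.trans hrR)).2)

/-- Differentiating a prolongation shifts the multi-indices of its entries; hence derivatives of
order `k` of an `r`-jet are read off from the `(r + k)`-jet. -/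
theorem multiD_jetCoord_eq (hU : IsOpen U) (hx : x ∈ U) (hG : ContDiffOn ℝ ∞ G U)
    (hy : ContDiffOn ℝ ∞ y U) (s : Multiset (Fin (d + 1))) :
    multiD (bas d) s (jetCoord r G y) x =
      (multiD (bas d) s (fun z => z) x,
        fun t => multiPartial (s + (t.2 : Multiset (Fin (d + 1)))) G x,
        fun t => multiPartial (s + (t.2 : Multiset (Fin (d + 1)))) y x) := by
  have hj := contDiffOn_jetCoord (r := r) hU hG hy
  refine Prod.ext ?_ (Prod.ext ?_ ?_)
  · exact (multiD_clm hU hj (bas d) (ContinuousLinearMap.fst ℝ _ _) s hx).symm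
  · funext t
    have := multiD_clm hU hj (bas d) (((ContinuousLinearMap.proj t).comp
      (ContinuousLinearMap.fst ℝ _ _)).comp (ContinuousLinearMap.snd ℝ _ _)) s hx
    refine this.symm.trans ?_
    exact (multiD_add hU hG (bas d) s _ hx).symm
  · funext t
    have := multiD_clm hU hj (bas d) (((ContinuousLinearMap.proj t).comp
      (ContinuousLinearMap.snd ℝ _ _)).comp (ContinuousLinearMap.snd ℝ _ _)) s hx
    refine this.symm.trans ?_
    exact (multiD_add hU hy (bas d) s _ hx).symm

theorem multiD_jetCoord_congr {k : ℕ} (hrk : r + k ≤ R) (hU : IsOpen U) (hx : x ∈ U)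
    (hG : ContDiffOn ℝ ∞ G U)
    (hy : ContDiffOn ℝ ∞ y U) (hG' : ContDiffOn ℝ ∞ G' U) (hy' : ContDiffOn ℝ ∞ y' U)
    (h : jetCoord R G y x = jetCoord R G' y' x) (s : Multiset (Fin (d + 1))) (hs : s.card ≤ k) :
    multiD (bas d) s (jetCoord r G y) x = multiD (bas d) s (jetCoord r G' y') x := by
  rw [multiD_jetCoord_eq hU hx hG hy, multiD_jetCoord_eq hU hx hG' hy']
  have (t : MultiIdx d r) : (s + (t.2 : Multiset (Fin (d + 1)))).card ≤ R := by
    rw [Multiset.card_add]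
    have := t.card_le
    omega
  refine Prod.ext rfl (Prod.ext ?_ ?_) <;> funext t
  · exact (multiPartial_eq_of_jetCoord_eq h _ (this t)).1
  · exact (multiPartial_eq_of_jetCoord_eq h _ (this t)).2

/-- The derivatives of order at most `k` of a function of the `r`-jets depend on the
`(r + k)`-jet only. -/
theorem multiPartial_comp_jetCoord_congr {V : Type*} [NormedAddCommGroup V] [NormedSpace ℝ V]
    {Ω : Set (JetCoord d m r)} (hΩ : IsOpen Ω)
    {F : JetCoord d m r → V} (hF : ContDiffOn ℝ ∞ F Ω) {k : ℕ} (hrk : r + k ≤ R)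
    (hU : IsOpen U) (hx : x ∈ U) (hG : ContDiffOn ℝ ∞ G U) (hy : ContDiffOn ℝ ∞ y U)
    (hG' : ContDiffOn ℝ ∞ G' U) (hy' : ContDiffOn ℝ ∞ y' U) (hj : jetCoord r G y x ∈ Ω)
    (h : jetCoord R G y x = jetCoord R G' y' x) (s : Multiset (Fin (d + 1))) (hs : s.card ≤ k) :
    multiPartial s (fun z => F (jetCoord r G y z)) x =
      multiPartial s (fun z => F (jetCoord r G' y' z)) x := by
  have hj' : jetCoord r G' y' x ∈ Ω := by
    rwa [← jetCoord_eq_of_le (by omega) h]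
  have c1 := contDiffOn_jetCoord (r := r) hU hG hy
  have c2 := contDiffOn_jetCoord (r := r) hU hG' hy'
  have o1 := c1.continuousOn.isOpen_inter_preimage hU hΩ
  have o2 := c2.continuousOn.isOpen_inter_preimage hU hΩ
  refine multiD_comp_eq (bas d) (o1.inter o2) ⟨⟨hx, hj⟩, hx, hj'⟩ k hΩ hF
    (c1.mono fun z hz => hz.1.1) (c2.mono fun z hz => hz.1.1) (fun z hz => hz.1.2)
    (fun z hz => hz.2.2) (fun t ht => ?_) s hs
  exact multiD_jetCoord_congr hrk hU hx hG hy hG' hy' h t ht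

/-! ### Families of fields -/

variable {P : Type*} [NormedAddCommGroup P] [NormedSpace ℝ P]

theorem contDiffOn_jetCoord_family {D : Set (P × Base d)} (hD : IsOpen D)
    {H : P × Base d → SymArray d} {w : P × Base d → Fibre m} (hH : ContDiffOn ℝ ∞ H D)
    (hw : ContDiffOn ℝ ∞ w D) :
    ContDiffOn ℝ ∞ (fun q : P × Base d =>
      jetCoord r (fun z => H (q.1, z)) (fun z => w (q.1, z)) q.2) D :=
  contDiffOn_snd.prodMk
    ((contDiffOn_pi.2 fun _ => contDiffOn_multiPartial_slice hD hH _).prodMk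
    (contDiffOn_pi.2 fun _ => contDiffOn_multiPartial_slice hD hw _))

theorem hasDerivAt_comp_jetCoord {D : Set (ℝ × Base d)} (hD : IsOpen D)
    {H : ℝ × Base d → SymArray d} {w : ℝ × Base d → Fibre m} (hH : ContDiffOn ℝ ∞ H D)
    (hw : ContDiffOn ℝ ∞ w D) {Ω : Set (JetCoord d m r)} (hΩ : IsOpen Ω)
    {F : JetCoord d m r → ℝ} (hF : ContDiffOn ℝ ∞ F Ω) {t : ℝ} (hx : (t, x) ∈ D)
    (hj : jetCoord r (fun z => H (t, z)) (fun z => w (t, z)) x ∈ Ω) :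
    HasDerivAt (fun τ => F (jetCoord r (fun z => H (τ, z)) (fun z => w (τ, z)) x))
      (fderiv ℝ F (jetCoord r (fun z => H (t, z)) (fun z => w (t, z)) x)
        (0, fun s => multiPartial (s.2 : Multiset (Fin (d + 1)))
            (fun z => dirD ((1 : ℝ), (0 : Base d)) H (t, z)) x,
          fun s => multiPartial (s.2 : Multiset (Fin (d + 1)))
            (fun z => dirD ((1 : ℝ), (0 : Base d)) w (t, z)) x)) t := by
  have h1 : HasDerivAt (fun τ => jetCoord r (fun z => H (τ, z)) (fun z => w (τ, z)) x)
      ((0 : Base d), (fun s : MultiIdx d r => multiPartial (s.2 : Multiset (Fin (d + 1)))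
            (fun z => dirD ((1 : ℝ), (0 : Base d)) H (t, z)) x),
          fun s : MultiIdx d r => multiPartial (s.2 : Multiset (Fin (d + 1)))
            (fun z => dirD ((1 : ℝ), (0 : Base d)) w (t, z)) x) t :=
    (hasDerivAt_const t x).prodMk
      ((hasDerivAt_pi.2 fun s => hasDerivAt_multiPartial hD hH _ hx).prodMk
        (hasDerivAt_pi.2 fun s => hasDerivAt_multiPartial hD hw _ hx))
  exact (differentiableAt_of_contDiffOn hF hΩ hj).hasFDerivAt.comp_hasDerivAt t h1

/-! ### Variational derivatives -/

/-- The component `g^{ij}` of a symmetric array. -/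
def symComp (i j : Fin (d + 1)) : SymArray d →L[ℝ] ℝ :=
  ((ContinuousLinearMap.proj (R := ℝ) (φ := fun _ : Fin (d + 1) => ℝ) j).comp
    (ContinuousLinearMap.proj (R := ℝ) (φ := fun _ : Fin (d + 1) => Fin (d + 1) → ℝ) i)).comp
    (SymArray d).subtypeL

@[simp] theorem symComp_apply (i j : Fin (d + 1)) (A : SymArray d) :
    symComp i j A = (A : Fin (d + 1) → Fin (d + 1) → ℝ) i j := rfl

theorem symUnit_comm (i j : Fin (d + 1)) : symUnit (d := d) i j = symUnit j i := by
  apply Subtype.ext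
  funext a b
  simp only [symUnit, add_comm]

/-- Off the diagonal, `symUnit` has two entries `1/2` and is met twice in the sum over ordered
pairs. This normalization makes `E_{ij} h^{ij}`, summed over all pairs, the differential in the
direction `h`. -/
theorem sum_smul_symUnit (A : SymArray d) : ∑ i, ∑ j, symComp i j A • symUnit i j = A := by
  apply Subtype.ext
  funext a b
  have hA : (A : Fin (d + 1) → Fin (d + 1) → ℝ) b a = (A : Fin (d + 1) → Fin (d + 1) → ℝ) a b :=
    A.2 b a
  simp only [symUnit, AddSubmonoidClass.coe_finsetSum, Submodule.coe_smul, Finset.sum_apply,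
    Pi.smul_apply, smul_eq_mul, symComp_apply, mul_div_assoc', mul_add, mul_ite, mul_one, mul_zero,
    ite_and, ← Finset.sum_div, Finset.sum_add_distrib]
  simp only [Finset.sum_ite_eq, Finset.mem_univ, if_true]
  rw [Finset.sum_comm]
  simp [hA]

theorem contDiffOn_coefficient {Ω : Set (JetCoord d m r)} (hΩ : IsOpen Ω)
    {Lag : JetCoord d m r → ℝ} (hL : ContDiffOn ℝ ∞ Lag Ω) (v : JetCoord d m r) :
    ContDiffOn ℝ ∞ (fun q => fderiv ℝ Lag q v) Ω :=
  contDiffOn_dirD hΩ hL v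

/-- Variational derivatives at a point depend on the `2r`-jet only. -/
theorem varDerivMetric_congr_of_jet (hR : 2 * r ≤ R) {Ω : Set (JetCoord d m r)} (hΩ : IsOpen Ω)
    {Lag : JetCoord d m r → ℝ} (hL : ContDiffOn ℝ ∞ Lag Ω)
    (hU : IsOpen U) (hx : x ∈ U) (hG : ContDiffOn ℝ ∞ G U) (hy : ContDiffOn ℝ ∞ y U)
    (hG' : ContDiffOn ℝ ∞ G' U) (hy' : ContDiffOn ℝ ∞ y' U) (hj : jetCoord r G y x ∈ Ω)
    (h : jetCoord R G y x = jetCoord R G' y' x) (i j : Fin (d + 1)) :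
    varDerivMetric Lag G y x i j = varDerivMetric Lag G' y' x i j := by
  refine Finset.sum_congr rfl fun s _ => ?_
  congr 1
  -- The coefficients `∂ℒ/∂g_s` are functions of the `r`-jet and are differentiated at most `r`
  -- times; this is the origin of the order `2r`.
  refine multiPartial_comp_jetCoord_congr hΩ (contDiffOn_coefficient hΩ hL _) (k := r)
    (by omega) hU hx hG hy hG' hy' hj h _ s.card_le

theorem contDiffOn_varDerivMetric {Ω : Set (JetCoord d m r)} (hΩ : IsOpen Ω)
    {Lag : JetCoord d m r → ℝ} (hL : ContDiffOn ℝ ∞ Lag Ω)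
    (hU : IsOpen U) (hG : ContDiffOn ℝ ∞ G U) (hy : ContDiffOn ℝ ∞ y U)
    (hj : MapsTo (jetCoord r G y) U Ω) (i j : Fin (d + 1)) :
    ContDiffOn ℝ ∞ (fun x => varDerivMetric Lag G y x i j) U := by
  refine ContDiffOn.sum fun s _ => contDiffOn_const.mul (contDiffOn_multiD hU ?_ (bas d) _)
  exact (contDiffOn_coefficient hΩ hL _).comp (contDiffOn_jetCoord hU hG hy) hj

theorem contDiffOn_varDerivMetric_family {D : Set (P × Base d)} (hD : IsOpen D)
    {H : P × Base d → SymArray d} {w : P × Base d → Fibre m} (hH : ContDiffOn ℝ ∞ H D)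
    (hw : ContDiffOn ℝ ∞ w D) {Ω : Set (JetCoord d m r)} (hΩ : IsOpen Ω)
    {Lag : JetCoord d m r → ℝ} (hL : ContDiffOn ℝ ∞ Lag Ω)
    (hj : ∀ q ∈ D, jetCoord r (fun z => H (q.1, z)) (fun z => w (q.1, z)) q.2 ∈ Ω)
    (i j : Fin (d + 1)) :
    ContDiffOn ℝ ∞ (fun q : P × Base d =>
      varDerivMetric Lag (fun z => H (q.1, z)) (fun z => w (q.1, z)) q.2 i j) D := by
  refine ContDiffOn.sum fun s _ => contDiffOn_const.mul ?_
  refine contDiffOn_multiPartial_slice hD (F := fun q : P × Base d => fderiv ℝ Lag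
    (jetCoord r (fun z => H (q.1, z)) (fun z => w (q.1, z)) q.2) _) ?_ _
  exact (contDiffOn_coefficient hΩ hL _).comp (contDiffOn_jetCoord_family hD hH hw) hj

/-- The first variation formula. -/
theorem integral_first_variation {Ω : Set (JetCoord d m r)} (hΩ : IsOpen Ω)
    {Lag : JetCoord d m r → ℝ} (hL : ContDiffOn ℝ ∞ Lag Ω)
    (hU : IsOpen U) (hG : ContDiffOn ℝ ∞ G U) (hy : ContDiffOn ℝ ∞ y U)
    (hj : MapsTo (jetCoord r G y) U Ω) {h : Base d → SymArray d} {k : Base d → Fibre m}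
    (hh : IsTest U h) (hk : IsTest U k) :
    ∫ x, fderiv ℝ Lag (jetCoord r G y x)
      (0, fun s => multiPartial (s.2 : Multiset (Fin (d + 1))) h x,
        fun s => multiPartial (s.2 : Multiset (Fin (d + 1))) k x) =
    ∫ x, ((∑ i, ∑ j, varDerivMetric Lag G y x i j * symComp i j (h x)) +
      ∑ σ, varDerivMatter Lag G y x σ * k x σ) := by
  set A : MultiIdx d r → Fin (d + 1) → Fin (d + 1) → Base d → ℝ := fun s i j x =>
    fderiv ℝ Lag (jetCoord r G y x) (0, Pi.single s (symUnit i j), 0) with hA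
  set B : MultiIdx d r → Fin m → Base d → ℝ := fun s σ x =>
    fderiv ℝ Lag (jetCoord r G y x) (0, 0, Pi.single s (EuclideanSpace.single σ 1)) with hB
  have cA (s i j) : ContDiffOn ℝ ∞ (A s i j) U :=
    (contDiffOn_coefficient hΩ hL _).comp (contDiffOn_jetCoord hU hG hy) hj
  have cB (s σ) : ContDiffOn ℝ ∞ (B s σ) U :=
    (contDiffOn_coefficient hΩ hL _).comp (contDiffOn_jetCoord hU hG hy) hj
  have th (i j) : IsTest U fun x => symComp i j (h x) := hh.clm _
  have tk (σ) : IsTest U fun x => k x σ :=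
    hk.clm (EuclideanSpace.proj σ : Fibre m →L[ℝ] ℝ)
  -- The variation of the jet is expanded in coordinate directions (`hv` below). The integrand
  -- becomes a sum of coefficients times derivatives of scalar test functions, to which integration
  -- by parts applies term by term.
  have e1 (x : Base d) : fderiv ℝ Lag (jetCoord r G y x)
      (0, fun s => multiPartial (s.2 : Multiset (Fin (d + 1))) h x,
        fun s => multiPartial (s.2 : Multiset (Fin (d + 1))) k x) =
      (∑ s : MultiIdx d r, ∑ i, ∑ j, A s i j x *
        multiPartial (s.2 : Multiset (Fin (d + 1))) (fun z => symComp i j (h z)) x) +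
      ∑ s : MultiIdx d r, ∑ σ, B s σ x *
        multiPartial (s.2 : Multiset (Fin (d + 1))) (fun z => k z σ) x := by
    have m1 (s : MultiIdx d r) (i j) : multiPartial (s.2 : Multiset (Fin (d + 1)))
        (fun z => symComp i j (h z)) x =
        symComp i j (multiPartial (s.2 : Multiset (Fin (d + 1))) h x) :=
      multiD_clm isOpen_univ hh.contDiff.contDiffOn (bas d) (symComp i j) _ (mem_univ x)
    have m2 (s : MultiIdx d r) (σ) : multiPartial (s.2 : Multiset (Fin (d + 1)))
        (fun z => k z σ) x = multiPartial (s.2 : Multiset (Fin (d + 1))) k x σ :=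
      multiD_clm isOpen_univ hk.contDiff.contDiffOn (bas d)
        (EuclideanSpace.proj σ : Fibre m →L[ℝ] ℝ) _ (mem_univ x)
    have hv : ((0 : Base d),
        (fun s : MultiIdx d r => multiPartial (s.2 : Multiset (Fin (d + 1))) h x),
        (fun s : MultiIdx d r => multiPartial (s.2 : Multiset (Fin (d + 1))) k x)) =
      (∑ s : MultiIdx d r, ∑ i, ∑ j,
        multiPartial (s.2 : Multiset (Fin (d + 1))) (fun z => symComp i j (h z)) x •
          ((0 : Base d), (Pi.single s (symUnit i j) : MultiIdx d r → SymArray d),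
            (0 : MultiIdx d r → Fibre m))) +
      ∑ s : MultiIdx d r, ∑ σ,
        multiPartial (s.2 : Multiset (Fin (d + 1))) (fun z => k z σ) x •
          ((0 : Base d), (0 : MultiIdx d r → SymArray d),
            (Pi.single s (EuclideanSpace.single σ 1) : MultiIdx d r → Fibre m)) := by
      refine Prod.ext ?_ (Prod.ext ?_ ?_)
      · simp [Prod.fst_sum]
      · funext s
        simp only [Prod.snd_add, Prod.fst_add, Prod.snd_sum, Prod.fst_sum, Prod.smul_snd,
          Prod.smul_fst, smul_zero, Finset.sum_const_zero, add_zero, m1, Finset.sum_apply,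
          Pi.smul_apply]
        rw [Finset.sum_eq_single s]
        · simp only [Pi.single_eq_same]
          exact (sum_smul_symUnit _).symm
        · intro t _ hts
          simp [Pi.single_eq_of_ne hts.symm]
        · simp
      · funext s
        simp only [Prod.snd_add, Prod.snd_sum, Prod.smul_snd, smul_zero, Finset.sum_const_zero,
          zero_add, m2, Finset.sum_apply, Pi.smul_apply]
        rw [Finset.sum_eq_single s]
        · simp only [Pi.single_eq_same]
          ext σ
          simp [Pi.single_apply]
        · intro t _ hts
          simp [Pi.single_eq_of_ne hts.symm]
        · simp
    rw [hv]
    simp only [map_add, map_sum, map_smul, smul_eq_mul, hA, hB]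
    congr 1
    · exact Finset.sum_congr rfl fun s _ => Finset.sum_congr rfl fun i _ =>
        Finset.sum_congr rfl fun j _ => mul_comm _ _
    · exact Finset.sum_congr rfl fun s _ => Finset.sum_congr rfl fun i _ => mul_comm _ _
  have e2 (x : Base d) : ((∑ i, ∑ j, varDerivMetric Lag G y x i j * symComp i j (h x)) +
      ∑ σ, varDerivMatter Lag G y x σ * k x σ) =
      (∑ s : MultiIdx d r, ∑ i, ∑ j, (-1) ^ (s.1 : ℕ) *
        (multiPartial (s.2 : Multiset (Fin (d + 1))) (A s i j) x * symComp i j (h x))) +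
      ∑ s : MultiIdx d r, ∑ σ, (-1) ^ (s.1 : ℕ) *
        (multiPartial (s.2 : Multiset (Fin (d + 1))) (B s σ) x * k x σ) := by
    congr 1
    · simp only [varDerivMetric, Finset.sum_mul, mul_assoc]
      rw [Finset.sum_comm]
      refine (Finset.sum_congr rfl fun j _ => Finset.sum_comm).trans ?_
      rw [Finset.sum_comm]
      exact Finset.sum_congr rfl fun s _ => Finset.sum_comm
    · simp only [varDerivMatter, Finset.sum_mul, mul_assoc]
      rw [Finset.sum_comm]
  have i1 (s i j) : Integrable fun x => A s i j x *
      multiPartial (s.2 : Multiset (Fin (d + 1))) (fun z => symComp i j (h z)) x :=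
    (((th i j).multiPartial _).smul hU (cA s i j)).integrable
  have i2 (s σ) : Integrable fun x => B s σ x *
      multiPartial (s.2 : Multiset (Fin (d + 1))) (fun z => k z σ) x :=
    (((tk σ).multiPartial _).smul hU (cB s σ)).integrable
  have i3 (s : MultiIdx d r) (i j) : Integrable fun x => (-1) ^ (s.1 : ℕ) *
      (multiPartial (s.2 : Multiset (Fin (d + 1))) (A s i j) x * symComp i j (h x)) :=
    ((th i j).smul hU (contDiffOn_multiD hU (cA s i j) (bas d) _)).integrable.const_mul _
  have i4 (s : MultiIdx d r) (σ) : Integrable fun x => (-1) ^ (s.1 : ℕ) *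
      (multiPartial (s.2 : Multiset (Fin (d + 1))) (B s σ) x * k x σ) :=
    ((tk σ).smul hU (contDiffOn_multiD hU (cB s σ) (bas d) _)).integrable.const_mul _
  simp only [e1, e2]
  rw [integral_add, integral_add, integral_finsetSum, integral_finsetSum, integral_finsetSum,
    integral_finsetSum]
  · congr 1
    · refine Finset.sum_congr rfl fun s _ => ?_
      rw [integral_finsetSum, integral_finsetSum]
      · refine Finset.sum_congr rfl fun i _ => ?_
        rw [integral_finsetSum, integral_finsetSum]
        · refine Finset.sum_congr rfl fun j _ => ?_
          rw [integral_mul_multiPartial hU (cA s i j) (th i j), integral_const_mul]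
          congr 2
          exact s.2.2
        all_goals intro j _
        exacts [i3 _ _ _, i1 _ _ _]
      all_goals intro j _
      exacts [integrable_finsetSum _ fun _ _ => i3 _ _ _, integrable_finsetSum _ fun _ _ => i1 _ _ _]
    · refine Finset.sum_congr rfl fun s _ => ?_
      rw [integral_finsetSum, integral_finsetSum]
      · refine Finset.sum_congr rfl fun σ _ => ?_
        rw [integral_mul_multiPartial hU (cB s σ) (tk σ), integral_const_mul]
        congr 2
        exact s.2.2
      all_goals intro j _
      exacts [i4 _ _, i2 _ _]
  all_goals first
    | exact integrable_finsetSum _ fun _ _ => integrable_finsetSum _ fun _ _ =>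
        integrable_finsetSum _ fun _ _ => i1 _ _ _
    | exact integrable_finsetSum _ fun _ _ => integrable_finsetSum _ fun _ _ =>
        integrable_finsetSum _ fun _ _ => i3 _ _ _
    | exact integrable_finsetSum _ fun _ _ => integrable_finsetSum _ fun _ _ => i2 _ _
    | exact integrable_finsetSum _ fun _ _ => integrable_finsetSum _ fun _ _ => i4 _ _
    | (intro s _; first
      | exact integrable_finsetSum _ fun _ _ => i2 _ _
      | exact integrable_finsetSum _ fun _ _ => i4 _ _
      | exact integrable_finsetSum _ fun _ _ => integrable_finsetSum _ fun _ _ => i1 _ _ _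
      | exact integrable_finsetSum _ fun _ _ => integrable_finsetSum _ fun _ _ => i3 _ _ _)

end Jets

/-! ## Matrix-valued functions -/

section MatrixCalculus

variable {E ι : Type*} [NormedAddCommGroup E] [NormedSpace ℝ E] [Fintype ι] [DecidableEq ι]
  {U : Set E} {x : E}

theorem dirD_fun_mul {f g : E → ℝ} (hf : DifferentiableAt ℝ f x) (hg : DifferentiableAt ℝ g x)
    (v : E) : dirD v (fun z => f z * g z) x = dirD v f x * g x + f x * dirD v g x := by
  simp only [dirD]
  rw [fderiv_fun_mul hf hg]
  simp [mul_comm]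
  ring

theorem dirD_fun_sum {κ : Type*} {t : Finset κ} {F : κ → E → ℝ}
    (hF : ∀ k ∈ t, DifferentiableAt ℝ (F k) x) (v : E) :
    dirD v (fun z => ∑ k ∈ t, F k z) x = ∑ k ∈ t, dirD v (F k) x := by
  simp only [dirD]
  rw [fderiv_fun_sum hF]
  simp

/-- The entrywise derivative of a matrix-valued function. -/
def matD {κ ν : Type*} (v : E) (M : E → Matrix κ ν ℝ) (x : E) : Matrix κ ν ℝ :=
  Matrix.of fun i j => dirD v (fun z => M z i j) x

/-- Entrywise differentiability. -/
def MatDiffAt {κ ν : Type*} (M : E → Matrix κ ν ℝ) (x : E) : Prop :=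
  ∀ i j, DifferentiableAt ℝ (fun z => M z i j) x

variable {M N : E → Matrix ι ι ℝ}

theorem MatDiffAt.mul (hM : MatDiffAt M x) (hN : MatDiffAt N x) :
    MatDiffAt (fun z => M z * N z) x := by
  intro i j
  simp only [Matrix.mul_apply]
  exact DifferentiableAt.fun_sum fun k _ => (hM i k).mul (hN k j)

theorem MatDiffAt.transpose (hM : MatDiffAt M x) : MatDiffAt (fun z => (M z).transpose) x :=
  fun i j => hM j i

theorem matD_mul (hM : MatDiffAt M x) (hN : MatDiffAt N x) (v : E) :
    matD v (fun z => M z * N z) x = matD v M x * N x + M x * matD v N x := by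
  ext i j
  simp only [matD, Matrix.of_apply, Matrix.add_apply, Matrix.mul_apply]
  have h (k : ι) : DifferentiableAt ℝ (fun z => M z i k * N z k j) x := (hM i k).mul (hN k j)
  rw [dirD_fun_sum fun k _ => h k, ← Finset.sum_add_distrib]
  exact Finset.sum_congr rfl fun k _ => dirD_fun_mul (hM i k) (hN k j) v

theorem matD_transpose (v : E) :
    matD v (fun z => (M z).transpose) x = (matD v M x).transpose := rfl

theorem matD_congr (h : M =ᶠ[𝓝 x] N) (v : E) : matD v M x = matD v N x := by
  ext i j
  simp only [matD, Matrix.of_apply, dirD]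
  rw [Filter.EventuallyEq.fderiv_eq (h.mono fun z hz => by rw [hz])]

theorem contDiffOn_det (hM : ∀ i j, ContDiffOn ℝ ∞ (fun z => M z i j) U) :
    ContDiffOn ℝ ∞ (fun z => (M z).det) U := by
  simp only [Matrix.det_apply']
  exact ContDiffOn.sum fun σ _ => contDiffOn_const.mul (contDiffOn_prod fun i _ => hM _ _)

theorem contDiffOn_inv_apply (hM : ∀ i j, ContDiffOn ℝ ∞ (fun z => M z i j) U)
    (h0 : ∀ z ∈ U, (M z).det ≠ 0) (i j : ι) : ContDiffOn ℝ ∞ (fun z => (M z)⁻¹ i j) U := by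
  have h1 : ContDiffOn ℝ ∞ (fun z => ((M z).det)⁻¹ * (M z).adjugate i j) U := by
    refine ((contDiffOn_det hM).inv h0).mul ?_
    simp only [Matrix.adjugate_apply]
    refine contDiffOn_det fun k l => ?_
    by_cases hk : k = j
    · subst hk
      simp only [Matrix.updateRow_self]
      exact contDiffOn_const
    · simp only [Matrix.updateRow_ne hk]
      exact hM k l
  refine h1.congr fun z _ => ?_
  rw [Matrix.inv_def, Matrix.smul_apply, Ring.inverse_eq_inv', smul_eq_mul]

/-- Jacobi's formula: the determinant is multilinear in the rows, so its derivative replaces one row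
at a time, and expanding along that row produces the adjugate. -/
theorem dirD_det (hM : MatDiffAt M x) (v : E) :
    dirD v (fun z => (M z).det) x = ((M x).adjugate * matD v M x).trace := by
  let D : ContinuousMultilinearMap ℝ (fun _ : ι => ι → ℝ) ℝ :=
    { (Matrix.detRowAlternating (n := ι) (R := ℝ)).toMultilinearMap with
      cont := by
        change Continuous fun A : Matrix ι ι ℝ => A.det
        exact continuous_id.matrix_det }
  let M' : E → ι → ι → ℝ := fun z => M z
  have hM' : HasFDerivAt M' (ContinuousLinearMap.pi fun i =>
      ContinuousLinearMap.pi fun j => fderiv ℝ (fun z => M z i j) x) x :=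
    hasFDerivAt_pi.2 fun i => hasFDerivAt_pi.2 fun j => (hM i j).hasFDerivAt
  have h1 := ((D.hasStrictFDerivAt (M' x)).hasFDerivAt.comp x hM').fderiv
  have h2 : dirD v (fun z => (M z).det) x = fderiv ℝ (D ∘ M') x v := rfl
  rw [h2, h1, ContinuousLinearMap.comp_apply, ContinuousMultilinearMap.linearDeriv_apply]
  rw [Matrix.trace_mul_comm, Matrix.trace]
  refine Finset.sum_congr rfl fun i _ => ?_
  change ((M x).updateRow i fun j => fderiv ℝ (fun z => M z i j) x v).det = _
  rw [← Matrix.cramer_transpose_apply, Matrix.cramer_eq_adjugate_mulVec,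
    ← Matrix.adjugate_transpose]
  simp only [Matrix.mulVec, dotProduct, Matrix.diag, Matrix.mul_apply, Matrix.transpose_apply,
    matD, Matrix.of_apply, dirD]
  exact Finset.sum_congr rfl fun j _ => mul_comm _ _

/-- Obtained by differentiating `M⁻¹ M = 1`, which holds near `x`. -/
theorem matD_inv (hM : MatDiffAt M x) (hMi : MatDiffAt (fun z => (M z)⁻¹) x)
    (h0 : ∀ᶠ z in 𝓝 x, (M z).det ≠ 0) (v : E) :
    matD v (fun z => (M z)⁻¹) x = -((M x)⁻¹ * matD v M x * (M x)⁻¹) := by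
  have h1 := matD_mul hMi hM v
  have h2 : matD v (fun z => (M z)⁻¹ * M z) x = 0 := by
    have : (fun z => (M z)⁻¹ * M z) =ᶠ[𝓝 x] fun _ => 1 := by
      filter_upwards [h0] with z hz
      exact Matrix.nonsing_inv_mul _ (isUnit_iff_ne_zero.2 hz)
    rw [matD_congr this]
    ext i j
    simp [matD, dirD]
  rw [h2] at h1
  have hx := isUnit_iff_ne_zero.2 h0.self_of_nhds
  have h3 : matD v (fun z => (M z)⁻¹) x = matD v (fun z => (M z)⁻¹) x * M x * (M x)⁻¹ := by
    rw [Matrix.mul_assoc, Matrix.mul_nonsing_inv _ hx, Matrix.mul_one]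
  rw [h3, eq_neg_of_add_eq_zero_left h1.symm, Matrix.neg_mul]

end MatrixCalculus

/-! ## Densities and the Levi-Civita divergence -/

section Metric

variable {d : ℕ} {U : Set (Base d)} {G : Base d → SymArray d} {x : Base d}

theorem invMetric_transpose (A : SymArray d) : (invMetric A).transpose = invMetric A := by
  ext i j; exact A.2 j i

theorem covMetric_transpose (A : SymArray d) : (covMetric A).transpose = covMetric A := by
  rw [covMetric, Matrix.transpose_nonsing_inv, invMetric_transpose]

theorem covMetric_comm (A : SymArray d) (i j : Fin (d + 1)) : covMetric A i j = covMetric A j i :=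
  congrFun (congrFun (covMetric_transpose A) j) i

theorem invMetric_comm (A : SymArray d) (i j : Fin (d + 1)) : invMetric A i j = invMetric A j i :=
  A.2 i j

theorem volDensity_eq (A : SymArray d) : volDensity A = (Real.sqrt |(invMetric A).det|)⁻¹ := by
  rw [volDensity, covMetric, Matrix.det_nonsing_inv, Ring.inverse_eq_inv', abs_inv, Real.sqrt_inv]

theorem volDensity_pos {A : SymArray d} (hA : (invMetric A).det ≠ 0) : 0 < volDensity A := by
  rw [volDensity_eq]
  positivity

theorem volDensity_transform {A A' : SymArray d} {J : Matrix (Fin (d + 1)) (Fin (d + 1)) ℝ}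
    (hJ : 0 < J.det) (h : invMetric A' = J * invMetric A * J.transpose) :
    volDensity A = J.det * volDensity A' := by
  rw [volDensity_eq, volDensity_eq, h, Matrix.det_mul, Matrix.det_mul, Matrix.det_transpose,
    show J.det * (invMetric A).det * J.det = J.det ^ 2 * (invMetric A).det by ring, abs_mul,
    abs_of_nonneg (sq_nonneg J.det), Real.sqrt_mul (sq_nonneg _), Real.sqrt_sq hJ.le, mul_inv]
  field_simp

theorem contDiffOn_invMetric_apply {E : Type*} [NormedAddCommGroup E] [NormedSpace ℝ E]
    {U : Set E} {G : E → SymArray d} (hG : ContDiffOn ℝ ∞ G U) (i j : Fin (d + 1)) :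
    ContDiffOn ℝ ∞ (fun z => invMetric (G z) i j) U :=
  (symComp i j).contDiff.comp_contDiffOn hG

theorem contDiffOn_volDensity {E : Type*} [NormedAddCommGroup E] [NormedSpace ℝ E]
    {U : Set E} {G : E → SymArray d} (hG : ContDiffOn ℝ ∞ G U)
    (h0 : ∀ z ∈ U, (invMetric (G z)).det ≠ 0) : ContDiffOn ℝ ∞ (fun z => volDensity (G z)) U := by
  simp only [volDensity_eq]
  have h1 := contDiffOn_det fun i j => contDiffOn_invMetric_apply hG i j
  refine ContDiffOn.inv ?_ fun z hz => by have := h0 z hz; positivity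
  refine ContDiffOn.sqrt ?_ fun z hz => abs_ne_zero.2 (h0 z hz)
  intro z hz
  exact (contDiffAt_abs (h0 z hz)).comp_contDiffWithinAt z (h1 z hz)

theorem isOpen_nondegenerate : IsOpen {A : SymArray d | (invMetric A).det ≠ 0} := by
  refine isOpen_ne_fun (Continuous.matrix_det (continuous_matrix fun i j => ?_)) continuous_const
  exact (symComp i j).continuous

/-- The logarithmic derivative of the density. -/
theorem dirD_volDensity (hU : IsOpen U) (hG : ContDiffOn ℝ ∞ G U)
    (h0 : ∀ z ∈ U, (invMetric (G z)).det ≠ 0) (hx : x ∈ U) (v : Base d) :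
    dirD v (fun z => volDensity (G z)) x =
      -(volDensity (G x) / 2) * (covMetric (G x) * matD v (fun z => invMetric (G z)) x).trace := by
  have hM : MatDiffAt (fun z => invMetric (G z)) x := fun i j =>
    differentiableAt_of_contDiffOn (contDiffOn_invMetric_apply hG i j) hU hx
  have hv := differentiableAt_of_contDiffOn (contDiffOn_volDensity hG h0) hU hx
  have hdet := differentiableAt_of_contDiffOn
    (contDiffOn_det fun i j => contDiffOn_invMetric_apply hG i j) hU hx
  have hx0 := h0 x hx
  -- The product of the squared density with `det (g^{ij})` is locally the constant `±1`, the sign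
  -- of the determinant. Differentiating this identity avoids differentiating the root and the
  -- absolute value.
  obtain ⟨ε, hε, hsq⟩ : ∃ ε : ℝ, ε ≠ 0 ∧ (fun z => volDensity (G z) * volDensity (G z) *
      (invMetric (G z)).det) =ᶠ[𝓝 x] fun _ => ε := by
    have hc : ContinuousAt (fun z => (invMetric (G z)).det) x := hdet.continuousAt
    have key (z) (hz : (invMetric (G z)).det ≠ 0) : volDensity (G z) * volDensity (G z) =
        |(invMetric (G z)).det|⁻¹ := by
      rw [volDensity_eq, ← mul_inv, Real.mul_self_sqrt (abs_nonneg _)]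
    rcases lt_or_gt_of_ne hx0 with hneg | hpos
    · refine ⟨-1, by norm_num, ?_⟩
      filter_upwards [hc.eventually (gt_mem_nhds hneg)] with z hz
      rw [key z hz.ne, abs_of_neg hz]
      field_simp [hz.ne]
    · refine ⟨1, by norm_num, ?_⟩
      filter_upwards [hc.eventually (lt_mem_nhds hpos)] with z hz
      rw [key z hz.ne', abs_of_pos hz]
      field_simp [hz.ne']
  have h1 : dirD v (fun z => volDensity (G z) * volDensity (G z) * (invMetric (G z)).det) x = 0 := by
    simp only [dirD]
    rw [hsq.fderiv_eq]
    simp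
  have hvv : DifferentiableAt ℝ (fun z => volDensity (G z) * volDensity (G z)) x := hv.mul hv
  rw [dirD_fun_mul hvv hdet, dirD_fun_mul hv hv, dirD_det hM] at h1
  have h2 : (invMetric (G x)).adjugate = (invMetric (G x)).det • covMetric (G x) := by
    rw [covMetric, Matrix.inv_def, Ring.inverse_eq_inv', smul_smul, mul_inv_cancel₀ hx0, one_smul]
  rw [h2, Matrix.smul_mul, Matrix.trace_smul, smul_eq_mul] at h1
  have hpos := volDensity_pos hx0
  have h3 : volDensity (G x) * (invMetric (G x)).det * (2 * dirD v (fun z => volDensity (G z)) x +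
      volDensity (G x) * (covMetric (G x) * matD v (fun z => invMetric (G z)) x).trace) = 0 := by
    linear_combination h1
  have h4 := (mul_eq_zero.1 h3).resolve_left (mul_ne_zero hpos.ne' hx0)
  linear_combination h4 / 2

theorem sum_mul_antisymm {ι : Type*} [Fintype ι] (S : ι → ι → ℝ) (hS : ∀ i j, S i j = S j i)
    (A : ι → ι → ℝ) : ∑ j, ∑ l, S j l * (A j l - A l j) = 0 := by
  simp only [mul_sub, Finset.sum_sub_distrib, sub_eq_zero]
  rw [Finset.sum_comm]
  exact Finset.sum_congr rfl fun i _ => Finset.sum_congr rfl fun j _ => by rw [hS]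

/-- The divergence of a tensor `T = 𝒮 / √|det g|` with `𝒮^j_i = 2 E_{ik} g^{kj}`. -/
theorem covDivergence_eq (hU : IsOpen U) (hG : ContDiffOn ℝ ∞ G U)
    (h0 : ∀ z ∈ U, (invMetric (G z)).det ≠ 0) (hx : x ∈ U)
    {S T : Base d → Matrix (Fin (d + 1)) (Fin (d + 1)) ℝ}
    (hS : ∀ i j, ContDiffOn ℝ ∞ (fun z => S z i j) U)
    (hT : ∀ z ∈ U, ∀ j i, T z j i = (volDensity (G z))⁻¹ * S z j i)
    {E : Matrix (Fin (d + 1)) (Fin (d + 1)) ℝ} (hE : E.transpose = E)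
    (hSE : S x = (2 : ℝ) • (invMetric (G x) * E)) (i : Fin (d + 1)) :
    volDensity (G x) * covDivergence G T x i =
      ∑ j, dirD (bas d j) (fun z => S z j i) x +
        ∑ j, ∑ k, E j k * dirD (bas d i) (fun z => invMetric (G z) j k) x := by
  have hM : MatDiffAt (fun z => invMetric (G z)) x := fun i j =>
    differentiableAt_of_contDiffOn (contDiffOn_invMetric_apply hG i j) hU hx
  have hMi : MatDiffAt (fun z => (invMetric (G z))⁻¹) x := fun i j =>
    differentiableAt_of_contDiffOn
      (contDiffOn_inv_apply (fun i j => contDiffOn_invMetric_apply hG i j) h0 i j) hU hx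
  have hpos := volDensity_pos (h0 x hx)
  have hvol := contDiffOn_volDensity hG h0
  have hinv := fun v => matD_inv hM hMi (by filter_upwards [hU.mem_nhds hx] using h0) v
  set V := volDensity (G x) with hV
  set g := covMetric (G x) with hg
  set H := invMetric (G x) with hH
  have hgH : g * H = 1 := Matrix.nonsing_inv_mul _ (isUnit_iff_ne_zero.2 (h0 x hx))
  have hHg : H * g = 1 := Matrix.mul_nonsing_inv _ (isUnit_iff_ne_zero.2 (h0 x hx))
  set dg : Fin (d + 1) → Matrix (Fin (d + 1)) (Fin (d + 1)) ℝ :=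
    fun k => matD (bas d k) (fun z => covMetric (G z)) x with hdg
  set dH : Fin (d + 1) → Matrix (Fin (d + 1)) (Fin (d + 1)) ℝ :=
    fun k => matD (bas d k) (fun z => invMetric (G z)) x with hdH
  have hdgH (k) : dg k = -(g * dH k * g) := hinv (bas d k)
  have hdgs (k a b) : dg k a b = dg k b a := by
    simp only [hdg, matD, Matrix.of_apply, covMetric_comm _ a b]
  have hHs (a b) : H a b = H b a := invMetric_comm _ a b
  have hchr (k i j) : christoffel G x k i j =
      ∑ l, H k l / 2 * (dg i l j + dg j l i - dg l i j) := rfl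
  -- In the contracted Christoffel symbol two terms are antisymmetric in the indices contracted with
  -- the symmetric `g^{jl}` and cancel; the remainder is the logarithmic derivative of the density.
  have hθ (k) : ∑ j, christoffel G x j j k = -(g * dH k).trace / 2 := by
    simp only [hchr]
    have e1 : ∑ j, ∑ l, H j l / 2 * (dg j l k + dg k l j - dg l j k) =
        ∑ j, ∑ l, H j l / 2 * (dg j l k - dg l j k) + (∑ j, ∑ l, H j l * dg k l j) / 2 := by
      simp only [Finset.sum_div, ← Finset.sum_add_distrib]
      exact Finset.sum_congr rfl fun j _ => Finset.sum_congr rfl fun l _ => by ring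
    rw [e1, sum_mul_antisymm (fun j l => H j l / 2) (fun j l => by rw [hHs]) (fun j l => dg j l k),
      zero_add]
    have e2 : ∑ j, ∑ l, H j l * dg k l j = (H * dg k).trace := by
      simp only [Matrix.trace, Matrix.diag, Matrix.mul_apply]
    rw [e2, hdgH, Matrix.mul_neg, Matrix.trace_neg, ← Matrix.mul_assoc, ← Matrix.mul_assoc, hHg,
      Matrix.one_mul, Matrix.trace_mul_comm]
  have hvi : DifferentiableAt ℝ (fun z => (volDensity (G z))⁻¹) x := differentiableAt_of_contDiffOn
    (hvol.inv fun z hz => (volDensity_pos (h0 z hz)).ne') hU hx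
  have hdT (j) : partialD j (fun z => T z j i) x =
      V⁻¹ * dirD (bas d j) (fun z => S z j i) x + (g * dH j).trace / 2 * (V⁻¹ * S x j i) := by
    rw [partialD_eq, dirD_congr hU (fun z hz => hT z hz j i) _ hx,
      dirD_fun_mul hvi (differentiableAt_of_contDiffOn (hS j i) hU hx)]
    have e1 : dirD (bas d j) (fun z => (volDensity (G z))⁻¹) x = (g * dH j).trace / 2 * V⁻¹ := by
      have h1 := dirD_volDensity hU hG h0 hx (bas d j)
      simp only [dirD] at h1 ⊢
      have h2 := ((hasDerivAt_inv hpos.ne').comp_hasFDerivAt x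
        (differentiableAt_of_contDiffOn hvol hU hx).hasFDerivAt).fderiv
      change fderiv ℝ (Inv.inv ∘ fun z => volDensity (G z)) x (bas d j) = _
      rw [h2]
      simp only [smul_apply, smul_eq_mul, h1]
      field_simp
      simp only [hdH, hg, hV]
    rw [e1]; ring
  -- With its index raised, the tensor is proportional to the symmetric matrix `g⁻¹ E g⁻¹`. Hence
  -- only `∂_i g_{jl}` survives in the Christoffel symbol, and `∂g = -g (∂g⁻¹) g` turns it into the
  -- pairing of `E` with `∂_i g^{jk}`.
  have hsecond : ∑ j, ∑ k, christoffel G x k j i * T x j k = - V⁻¹ * ∑ j, ∑ k, E j k * dH i j k := by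
    set B : Matrix (Fin (d + 1)) (Fin (d + 1)) ℝ := H * E * H with hB
    have hBs (a b) : B a b = B b a := by
      have : B.transpose = B := by
        rw [hB, Matrix.transpose_mul, Matrix.transpose_mul, hE, hH, invMetric_transpose,
          Matrix.mul_assoc]
      exact congrFun (congrFun this b) a
    have e0 (j l) : ∑ k, T x j k * H k l = 2 * V⁻¹ * B j l := by
      simp only [hT x hx, hSE, Matrix.smul_apply, smul_eq_mul, hB, Matrix.mul_apply (M := H * E)]
      rw [Finset.mul_sum]
      exact Finset.sum_congr rfl fun k _ => by ring
    have e1 : ∑ j, ∑ k, christoffel G x k j i * T x j k =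
        ∑ j, ∑ l, (∑ k, T x j k * H k l) / 2 * (dg j l i + dg i l j - dg l j i) := by
      refine Finset.sum_congr rfl fun j _ => ?_
      simp only [hchr, Finset.sum_div, Finset.sum_mul]
      rw [Finset.sum_comm]
      exact Finset.sum_congr rfl fun l _ => Finset.sum_congr rfl fun k _ => by ring
    have e2 : ∑ j, ∑ l, (∑ k, T x j k * H k l) / 2 * (dg j l i + dg i l j - dg l j i) =
        V⁻¹ * ∑ j, ∑ l, B j l * (dg j l i - dg l j i) + V⁻¹ * ∑ j, ∑ l, B j l * dg i l j := by
      simp only [e0, Finset.mul_sum, ← Finset.sum_add_distrib]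
      exact Finset.sum_congr rfl fun j _ => Finset.sum_congr rfl fun l _ => by ring
    have e3 : ∑ j, ∑ l, B j l * dg i l j = (B * dg i).trace := by
      simp only [Matrix.trace, Matrix.diag, Matrix.mul_apply]
    have e4 : ∑ j, ∑ k, E j k * dH i j k = (E * dH i).trace := by
      simp only [Matrix.trace, Matrix.diag, Matrix.mul_apply]
      refine Finset.sum_congr rfl fun j _ => Finset.sum_congr rfl fun k _ => ?_
      congr 1
      simp only [hdH, matD, Matrix.of_apply, invMetric_comm _ j k]
    rw [e1, e2, sum_mul_antisymm _ hBs (fun j l => dg j l i), e3, e4, hdgH, hB, Matrix.mul_neg,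
      Matrix.trace_neg]
    have e5 : H * E * H * (g * dH i * g) = H * (E * dH i * g) := by
      calc H * E * H * (g * dH i * g) = H * (E * (H * g) * dH i * g) := by
            simp only [Matrix.mul_assoc]
        _ = _ := by rw [hHg, Matrix.mul_one]
    rw [e5, Matrix.trace_mul_comm, Matrix.mul_assoc, hgH, Matrix.mul_one]
    ring
  have hfirst : ∑ j, ∑ k, christoffel G x j j k * T x k i =
      ∑ k, -(g * dH k).trace / 2 * (V⁻¹ * S x k i) := by
    rw [Finset.sum_comm]
    refine Finset.sum_congr rfl fun k _ => ?_
    rw [← Finset.sum_mul, hθ, hT x hx]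
  have htot : covDivergence G T x i =
      ∑ j, partialD j (fun z => T z j i) x + (∑ j, ∑ k, christoffel G x j j k * T x k i -
        ∑ j, ∑ k, christoffel G x k j i * T x j k) := by
    simp only [covDivergence, Finset.sum_add_distrib, Finset.sum_sub_distrib]
  rw [htot, hfirst, hsecond]
  simp only [hdT, Finset.sum_add_distrib]
  -- The contracted Christoffel term cancels the derivative of the factor `1/√|det g|` in `T`.
  have hc : ∑ k, -(g * dH k).trace / 2 * (V⁻¹ * S x k i) =
      - ∑ j, (g * dH j).trace / 2 * (V⁻¹ * S x j i) := by
    rw [← Finset.sum_neg_distrib]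
    exact Finset.sum_congr rfl fun k _ => by ring
  rw [hc, ← Finset.mul_sum]
  have hd : ∀ j k, dirD (bas d i) (fun z => invMetric (G z) j k) x = dH i j k := fun _ _ => rfl
  simp only [hd]
  field_simp
  ring

end Metric

/-! ## Charts of the spacetime manifold -/

section Charts

variable {d : ℕ} {X : Type*} [TopologicalSpace X] [ChartedSpace (Base d) X]
  [IsManifold 𝓘(ℝ, Base d) ∞ X] {e e' : OpenPartialHomeomorph X (Base d)} {x : X}

/-- The Jacobian matrix of a map of `ℝⁿ`. -/
def jac (φ : Base d → Base d) (u : Base d) : Matrix (Fin (d + 1)) (Fin (d + 1)) ℝ :=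
  Matrix.of fun i j => fderiv ℝ φ u (bas d j) i

theorem sum_smul_bas (v : Base d) : ∑ i, v i • bas d i = v := by
  have := (EuclideanSpace.basisFun (Fin (d + 1)) ℝ).sum_repr v
  simpa [bas] using this

theorem bas_apply (i j : Fin (d + 1)) : bas d i j = if j = i then 1 else 0 := by
  simp [bas]

theorem jac_mulVec (φ : Base d → Base d) (u v : Base d) (i : Fin (d + 1)) :
    fderiv ℝ φ u v i = ∑ j, jac φ u i j * v j := by
  conv_lhs => rw [← sum_smul_bas v]
  simp only [map_sum, map_smul, jac, Matrix.of_apply]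
  simp [mul_comm]

theorem det_jac (φ : Base d → Base d) (u : Base d) : (jac φ u).det = (fderiv ℝ φ u).det := by
  have h : LinearMap.toMatrix (EuclideanSpace.basisFun (Fin (d + 1)) ℝ).toBasis
      (EuclideanSpace.basisFun (Fin (d + 1)) ℝ).toBasis
      (fderiv ℝ φ u : Base d →ₗ[ℝ] Base d) = jac φ u := by
    ext i j
    simp [LinearMap.toMatrix_apply, jac, bas]
  rw [← h, LinearMap.det_toMatrix]

/-- The derivative of a chart, as a map to `ℝⁿ`. -/
def chartD (e : OpenPartialHomeomorph X (Base d)) (x : X) :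
    TangentSpace 𝓘(ℝ, Base d) x →L[ℝ] Base d :=
  mfderiv 𝓘(ℝ, Base d) 𝓘(ℝ, Base d) e x

/-- The derivative of the inverse of a chart, as a map from `ℝⁿ`. -/
def chartDinv (e : OpenPartialHomeomorph X (Base d)) (x : X) :
    Base d →L[ℝ] TangentSpace 𝓘(ℝ, Base d) x :=
  mfderiv 𝓘(ℝ, Base d) 𝓘(ℝ, Base d) e.symm (e x)

theorem coframe_apply (v : TangentSpace 𝓘(ℝ, Base d) x) (i : Fin (d + 1)) :
    coframe e x i v = chartD e x v i := rfl

theorem mdifferentiableAt_chart (he : e ∈ IsManifold.maximalAtlas 𝓘(ℝ, Base d) ∞ X)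
    (hx : x ∈ e.source) : MDifferentiableAt 𝓘(ℝ, Base d) 𝓘(ℝ, Base d) e x :=
  (contMDiffAt_of_mem_maximalAtlas he hx).mdifferentiableAt (by simp)

theorem mdifferentiableAt_chart_symm (he : e ∈ IsManifold.maximalAtlas 𝓘(ℝ, Base d) ∞ X)
    {u : Base d} (hu : u ∈ e.target) :
    MDifferentiableAt 𝓘(ℝ, Base d) 𝓘(ℝ, Base d) e.symm u :=
  (contMDiffAt_symm_of_mem_maximalAtlas he hu).mdifferentiableAt (by simp)

theorem chartD_chartDinv_eq_fderiv (he : e ∈ IsManifold.maximalAtlas 𝓘(ℝ, Base d) ∞ X)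
    (he' : e' ∈ IsManifold.maximalAtlas 𝓘(ℝ, Base d) ∞ X) (hx : x ∈ e.source)
    (hx' : x ∈ e'.source) (v : Base d) :
    chartD e' x (chartDinv e x v) = fderiv ℝ (e' ∘ e.symm) (e x) v := by
  have h := mfderiv_comp_of_eq (x := e x) (mdifferentiableAt_chart he' hx')
    (mdifferentiableAt_chart_symm he (e.map_source hx)) (e.left_inv hx)
  rw [mfderiv_eq_fderiv] at h
  rw [h]
  -- The chain rule mentions the point `e.symm (e x)` where `x` is wanted. Tangent spaces at
  -- different points are the same model space by definition, so vectors can be compared after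
  -- substituting equal points.
  have key : ∀ z, z = x → ∀ w : Base d, (show Base d from mfderiv 𝓘(ℝ, Base d) 𝓘(ℝ, Base d) e' x w) =
      mfderiv 𝓘(ℝ, Base d) 𝓘(ℝ, Base d) e' z w := by
    rintro _ rfl _; rfl
  exact key _ (e.left_inv hx) _

theorem chartD_chartDinv (he : e ∈ IsManifold.maximalAtlas 𝓘(ℝ, Base d) ∞ X) (hx : x ∈ e.source)
    (v : Base d) : chartD e x (chartDinv e x v) = v := by
  rw [chartD_chartDinv_eq_fderiv he he hx hx]
  have : (e ∘ e.symm) =ᶠ[𝓝 (e x)] id :=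
    Filter.eventuallyEq_of_mem (e.open_target.mem_nhds (e.map_source hx))
      fun u hu => e.right_inv hu
  rw [this.fderiv_eq, fderiv_id]
  rfl

theorem chartDinv_chartD (he : e ∈ IsManifold.maximalAtlas 𝓘(ℝ, Base d) ∞ X) (hx : x ∈ e.source)
    (v : TangentSpace 𝓘(ℝ, Base d) x) : chartDinv e x (chartD e x v) = v := by
  -- Read as endomorphisms of the finite-dimensional model, a right inverse is also a left inverse.
  have h : (show Base d →ₗ[ℝ] Base d from (chartD e x).toLinearMap) *
      (show Base d →ₗ[ℝ] Base d from (chartDinv e x).toLinearMap) = 1 :=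
    LinearMap.ext fun v => chartD_chartDinv he hx v
  have h' := mul_eq_one_comm.1 h
  exact LinearMap.congr_fun h' v

theorem contDiffOn_transition (he : e ∈ IsManifold.maximalAtlas 𝓘(ℝ, Base d) ∞ X)
    (he' : e' ∈ IsManifold.maximalAtlas 𝓘(ℝ, Base d) ∞ X) :
    ContDiffOn ℝ ∞ (e' ∘ e.symm) (e.target ∩ e.symm ⁻¹' e'.source) := by
  rw [← contMDiffOn_iff_contDiffOn]
  exact (contMDiffOn_of_mem_maximalAtlas he').comp
    ((contMDiffOn_symm_of_mem_maximalAtlas he).mono inter_subset_left) fun u hu => hu.2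

theorem isOpen_transition : IsOpen (e.target ∩ e.symm ⁻¹' e'.source) :=
  e.symm.isOpen_inter_preimage e'.open_source

theorem contDiffOn_jac {φ : Base d → Base d} {U : Set (Base d)} (hU : IsOpen U)
    (hφ : ContDiffOn ℝ ∞ φ U) (i j : Fin (d + 1)) : ContDiffOn ℝ ∞ (fun u => jac φ u i j) U :=
  (EuclideanSpace.proj i : Base d →L[ℝ] ℝ).contDiff.comp_contDiffOn (contDiffOn_dirD hU hφ _)

theorem fderiv_transition_comp {e₁ e₂ e₃ : OpenPartialHomeomorph X (Base d)}
    (h₁ : e₁ ∈ IsManifold.maximalAtlas 𝓘(ℝ, Base d) ∞ X)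
    (h₂ : e₂ ∈ IsManifold.maximalAtlas 𝓘(ℝ, Base d) ∞ X)
    (h₃ : e₃ ∈ IsManifold.maximalAtlas 𝓘(ℝ, Base d) ∞ X)
    (hx₁ : x ∈ e₁.source) (hx₂ : x ∈ e₂.source) (hx₃ : x ∈ e₃.source) :
    fderiv ℝ (e₃ ∘ e₁.symm) (e₁ x) =
      (fderiv ℝ (e₃ ∘ e₂.symm) (e₂ x)).comp (fderiv ℝ (e₂ ∘ e₁.symm) (e₁ x)) := by
  ext1 v
  rw [ContinuousLinearMap.comp_apply, ← chartD_chartDinv_eq_fderiv h₁ h₃ hx₁ hx₃,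
    ← chartD_chartDinv_eq_fderiv h₁ h₂ hx₁ hx₂, ← chartD_chartDinv_eq_fderiv h₂ h₃ hx₂ hx₃,
    chartDinv_chartD h₂ hx₂]

theorem det_comp_clm (A B : Base d →L[ℝ] Base d) : (A.comp B).det = A.det * B.det :=
  LinearMap.det_comp (A : Base d →ₗ[ℝ] Base d) B

/-- The transition between positively oriented charts has a positive Jacobian. -/
theorem OrientedAtlas.IsPositive.det_pos {o : OrientedAtlas d X} (h : o.IsPositive e)
    (h' : o.IsPositive e') (hx : x ∈ e.source) (hx' : x ∈ e'.source) :
    0 < (fderiv ℝ (e' ∘ e.symm) (e x)).det := by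
  obtain ⟨a, ha, hxa⟩ := o.covers x
  have ham := o.smooth ha
  have h1 := h.2 a ha x ⟨hx, hxa⟩
  have h2 := h'.2 a ha x ⟨hx', hxa⟩
  have h3 := fderiv_transition_comp h.1 h'.1 ham hx hx' hxa
  rw [h3, det_comp_clm] at h1
  exact (pos_iff_pos_of_mul_pos h1).1 h2

/-! ### Metrics -/

theorem dual_expansion (he : e ∈ IsManifold.maximalAtlas 𝓘(ℝ, Base d) ∞ X) (hx : x ∈ e.source)
    (α : TangentSpace 𝓘(ℝ, Base d) x →L[ℝ] ℝ) :
    α = ∑ i, α (chartDinv e x (bas d i)) • coframe e x i := by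
  ext v
  conv_lhs => rw [← chartDinv_chartD he hx v, ← sum_smul_bas (chartD e x v)]
  simp only [map_sum, map_smul, sum_apply, smul_apply,
    coframe_apply, smul_eq_mul, mul_comm]

theorem coframe_chartDinv (he : e ∈ IsManifold.maximalAtlas 𝓘(ℝ, Base d) ∞ X)
    (he' : e' ∈ IsManifold.maximalAtlas 𝓘(ℝ, Base d) ∞ X) (hx : x ∈ e.source)
    (hx' : x ∈ e'.source) (i j : Fin (d + 1)) :
    coframe e' x i (chartDinv e x (bas d j)) = jac (e' ∘ e.symm) (e x) i j := by
  rw [coframe_apply, chartD_chartDinv_eq_fderiv he he' hx hx']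
  rfl

/-- The matrix of a metric with respect to a chart. -/
def gram (e : OpenPartialHomeomorph X (Base d)) (g : MetricAt d x) :
    Matrix (Fin (d + 1)) (Fin (d + 1)) ℝ :=
  Matrix.of fun i j => g.1 (coframe e x i) (coframe e x j)

theorem metric_apply (he : e ∈ IsManifold.maximalAtlas 𝓘(ℝ, Base d) ∞ X) (hx : x ∈ e.source)
    (g : MetricAt d x) (α β : TangentSpace 𝓘(ℝ, Base d) x →L[ℝ] ℝ) :
    g.1 α β = ∑ i, ∑ j, α (chartDinv e x (bas d i)) * gram e g i j *
      β (chartDinv e x (bas d j)) := by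
  conv_lhs => rw [dual_expansion he hx α, dual_expansion he hx β]
  simp only [map_sum, map_smul, LinearMap.sum_apply, LinearMap.smul_apply, smul_eq_mul, gram,
    Matrix.of_apply]
  simp only [Finset.mul_sum]
  rw [Finset.sum_comm]
  exact Finset.sum_congr rfl fun i _ => Finset.sum_congr rfl fun j _ => by ring

theorem gram_transform (he : e ∈ IsManifold.maximalAtlas 𝓘(ℝ, Base d) ∞ X)
    (he' : e' ∈ IsManifold.maximalAtlas 𝓘(ℝ, Base d) ∞ X) (hx : x ∈ e.source)
    (hx' : x ∈ e'.source) (g : MetricAt d x) :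
    gram e' g = jac (e' ∘ e.symm) (e x) * gram e g * (jac (e' ∘ e.symm) (e x)).transpose := by
  ext i j
  rw [gram, Matrix.of_apply, metric_apply he hx]
  simp only [coframe_chartDinv he he' hx hx', Matrix.mul_apply, Matrix.transpose_apply,
    Finset.sum_mul]
  rw [Finset.sum_comm]

/-- A vector in the kernel of the Gram matrix gives a covector orthogonal to all covectors, which
nondegeneracy excludes. -/
theorem gram_det_ne_zero (he : e ∈ IsManifold.maximalAtlas 𝓘(ℝ, Base d) ∞ X) (hx : x ∈ e.source)
    (g : MetricAt d x) : (gram e g).det ≠ 0 := by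
  intro h0
  obtain ⟨w, hw, hMw⟩ := Matrix.exists_mulVec_eq_zero_iff.2 h0
  set α : TangentSpace 𝓘(ℝ, Base d) x →L[ℝ] ℝ := ∑ j, w j • coframe e x j with hα
  have hαj (j) : α (chartDinv e x (bas d j)) = w j := by
    simp only [hα, sum_apply, smul_apply, coframe_apply, chartD_chartDinv he hx, bas_apply,
      smul_eq_mul, mul_ite, mul_one, mul_zero, Finset.sum_ite_eq',
      Finset.mem_univ, if_true]
  have hα0 : α = 0 := by
    refine g.2.2.2 α fun β => ?_
    rw [metric_apply he hx]
    refine Finset.sum_eq_zero fun i _ => ?_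
    have h1 := congrFun hMw i
    simp only [Matrix.mulVec, dotProduct, Pi.zero_apply] at h1
    simp only [hαj, mul_assoc, ← Finset.mul_sum, h1, mul_zero]
  refine hw (funext fun j => ?_)
  rw [← hαj j, hα0]
  simp

/-- The metric with given components in a frame. -/
theorem exists_metric (A : Base d →L[ℝ] TangentSpace 𝓘(ℝ, Base d) x)
    (B : TangentSpace 𝓘(ℝ, Base d) x →L[ℝ] Base d) (hAB : ∀ v, A (B v) = v)
    (hBA : ∀ v, B (A v) = v) (M : SymArray d) (hM : (invMetric M).det ≠ 0) :
    ∃ g : MetricAt d x, ∀ α β : TangentSpace 𝓘(ℝ, Base d) x →L[ℝ] ℝ,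
      g.1 α β = ∑ i, ∑ j, α (A (bas d i)) * invMetric M i j * β (A (bas d j)) := by
  let b : LinearMap.BilinForm ℝ (TangentSpace 𝓘(ℝ, Base d) x →L[ℝ] ℝ) :=
    LinearMap.mk₂ ℝ
      (fun α β => ∑ i, ∑ j, α (A (bas d i)) * invMetric M i j * β (A (bas d j)))
      (fun α α' β => by
        simp only [add_apply, add_mul, Finset.sum_add_distrib])
      (fun c α β => by
        simp only [smul_apply, smul_eq_mul, Finset.mul_sum, mul_assoc])
      (fun α β β' => by
        simp only [add_apply, mul_add, Finset.sum_add_distrib])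
      (fun c α β => by
        simp only [smul_apply, smul_eq_mul, Finset.mul_sum]
        exact Finset.sum_congr rfl fun i _ => Finset.sum_congr rfl fun j _ => by ring)
  have hb (α β) : b α β = ∑ i, ∑ j, α (A (bas d i)) * invMetric M i j * β (A (bas d j)) := rfl
  have hsymm (α β) : b α β = b β α := by
    rw [hb, hb, Finset.sum_comm]
    exact Finset.sum_congr rfl fun i _ => Finset.sum_congr rfl fun j _ => by
      rw [invMetric_comm]; ring
  have hsep (α) (h : ∀ β, b α β = 0) : α = 0 := by
    have h1 (j) : ∑ i, α (A (bas d i)) * invMetric M i j = 0 := by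
      have := h ((EuclideanSpace.proj j : Base d →L[ℝ] ℝ).comp B)
      rw [hb] at this
      simpa [hBA, bas_apply] using this
    have h2 : (fun i => α (A (bas d i))) = 0 := by
      refine Matrix.eq_zero_of_vecMul_eq_zero hM (funext fun j => ?_)
      simpa [Matrix.vecMul, dotProduct] using h1 j
    ext v
    rw [← hAB v, ← sum_smul_bas (B v)]
    simp only [map_sum, map_smul]
    simp [fun i => congrFun h2 i]
  refine ⟨⟨b, ⟨hsymm⟩, hsep, fun α h => hsep α fun β => by rw [hsymm]; exact h β⟩, hb⟩

theorem contDiffOn_sym {E : Type*} [NormedAddCommGroup E] [NormedSpace ℝ E] {U : Set E}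
    {G : E → SymArray d} (h : ∀ i j, ContDiffOn ℝ ∞ (fun z => invMetric (G z) i j) U) :
    ContDiffOn ℝ ∞ G U := by
  have : G = fun z => ∑ i, ∑ j, symComp i j (G z) • symUnit i j :=
    funext fun z => (sum_smul_symUnit (G z)).symm
  rw [this]
  exact ContDiffOn.sum fun i _ => ContDiffOn.sum fun j _ => (h i j).smul contDiffOn_const

theorem metricComp_apply (g : ∀ x : X, MetricAt d x) (hx : x ∈ e.source) :
    invMetric (metricComp g e (e x)) = gram e (g x) := by
  ext i j
  simp only [metricComp, gram, invMetric, Matrix.of_apply]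
  rw [e.left_inv hx]

/-- Fields of metrics are total functions on `X`; this supplies the irrelevant values where no
components are prescribed. -/
theorem exists_default_metric (x : X) : Nonempty (MetricAt d x) := by
  obtain ⟨g, -⟩ := exists_metric (x := x) (ContinuousLinearMap.id ℝ (Base d))
    (ContinuousLinearMap.id ℝ (Base d)) (fun _ => rfl) (fun _ => rfl)
    ⟨fun i j => if i = j then 1 else 0, fun i j => by simp only [eq_comm]⟩ (by
      have : invMetric (d := d) ⟨fun i j => if i = j then 1 else 0,
          fun i j => by simp only [eq_comm]⟩ = 1 := by
        ext i j; simp [invMetric, Matrix.one_apply]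
      rw [this]; simp)
  exact ⟨g⟩

/-- A field of metrics with given components in a chart. -/
theorem exists_metric_field (he : e ∈ IsManifold.maximalAtlas 𝓘(ℝ, Base d) ∞ X)
    (G : Base d → SymArray d) : ∃ g : ∀ x : X, MetricAt d x, ∀ x ∈ e.source,
      (invMetric (G (e x))).det ≠ 0 → gram e (g x) = invMetric (G (e x)) := by
  classical
  have (x : X) : ∃ g : MetricAt d x, x ∈ e.source →
      (invMetric (G (e x))).det ≠ 0 → gram e g = invMetric (G (e x)) := by
    by_cases h : x ∈ e.source ∧ (invMetric (G (e x))).det ≠ 0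
    · obtain ⟨g, hg⟩ := exists_metric (chartDinv e x) (chartD e x)
        (chartDinv_chartD he h.1) (chartD_chartDinv he h.1) (G (e x)) h.2
      refine ⟨g, fun _ _ => ?_⟩
      ext i j
      simp [gram, hg, coframe_apply, chartD_chartDinv he h.1, bas_apply]
    · exact ⟨(exists_default_metric x).some, fun h1 h2 => absurd ⟨h1, h2⟩ h⟩
  choose g hg using this
  exact ⟨g, hg⟩

/-- `LocalField` demands smooth components in every chart of the maximal atlas. The transformation
law reduces this to the single chart in which a metric is constructed. -/
theorem contDiffOn_metricComp {g : ∀ x : X, MetricAt d x} {V : Set (Base d)}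
    (he : e ∈ IsManifold.maximalAtlas 𝓘(ℝ, Base d) ∞ X)
    (he' : e' ∈ IsManifold.maximalAtlas 𝓘(ℝ, Base d) ∞ X)
    (hg : ContDiffOn ℝ ∞ (metricComp g e) V) :
    ContDiffOn ℝ ∞ (metricComp g e') (e'.target ∩ e'.symm ⁻¹' (e.source ∩ e ⁻¹' V)) := by
  have hsub : e'.target ∩ e'.symm ⁻¹' (e.source ∩ e ⁻¹' V) ⊆ e'.target ∩ e'.symm ⁻¹' e.source :=
    fun u hu => ⟨hu.1, hu.2.1⟩
  have htr := (contDiffOn_transition he' he).mono hsub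
  have hφ := contDiffOn_transition he he'
  refine contDiffOn_sym fun i j => ?_
  have h1 (k l) : ContDiffOn ℝ ∞ (fun u => jac (e' ∘ e.symm) ((e ∘ e'.symm) u) k l)
      (e'.target ∩ e'.symm ⁻¹' (e.source ∩ e ⁻¹' V)) := by
    refine (contDiffOn_jac isOpen_transition hφ k l).comp htr fun u hu => ?_
    refine ⟨e.map_source hu.2.1, ?_⟩
    simp only [mem_preimage, Function.comp_apply, e.left_inv hu.2.1]
    exact e'.map_target hu.1
  have h2 (k l) : ContDiffOn ℝ ∞ (fun u => invMetric (metricComp g e ((e ∘ e'.symm) u)) k l)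
      (e'.target ∩ e'.symm ⁻¹' (e.source ∩ e ⁻¹' V)) :=
    (contDiffOn_invMetric_apply hg k l).comp htr fun u hu => hu.2.2
  have h3 : ContDiffOn ℝ ∞ (fun u => ∑ l, (∑ k, jac (e' ∘ e.symm) ((e ∘ e'.symm) u) i k *
      invMetric (metricComp g e ((e ∘ e'.symm) u)) k l) * jac (e' ∘ e.symm) ((e ∘ e'.symm) u) j l)
      (e'.target ∩ e'.symm ⁻¹' (e.source ∩ e ⁻¹' V)) :=
    ContDiffOn.sum fun l _ => (ContDiffOn.sum fun k _ => (h1 i k).mul (h2 k l)).mul (h1 j l)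
  refine h3.congr fun u hu => ?_
  have hx' : e'.symm u ∈ e'.source := e'.map_target hu.1
  have e1 : metricComp g e' u = metricComp g e' (e' (e'.symm u)) := by rw [e'.right_inv hu.1]
  rw [e1, metricComp_apply g hx', gram_transform he he' hu.2.1 hx', ← metricComp_apply g hu.2.1]
  simp only [Matrix.mul_apply, Matrix.transpose_apply, Function.comp_apply]

/-! ### Vector fields and functions -/

theorem vectorComp_apply (ξ : VectorFieldX d X) (hx : x ∈ e.source) (i : Fin (d + 1)) :
    vectorComp ξ e (e x) i = chartD e x (ξ x) i := by
  simp only [vectorComp]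
  rw [e.left_inv hx]
  rfl

theorem vectorComp_transform (he : e ∈ IsManifold.maximalAtlas 𝓘(ℝ, Base d) ∞ X)
    (he' : e' ∈ IsManifold.maximalAtlas 𝓘(ℝ, Base d) ∞ X) (hx : x ∈ e.source)
    (hx' : x ∈ e'.source) (ξ : VectorFieldX d X) (i : Fin (d + 1)) :
    vectorComp ξ e' (e' x) i = ∑ j, jac (e' ∘ e.symm) (e x) i j * vectorComp ξ e (e x) j := by
  simp only [vectorComp_apply ξ hx, vectorComp_apply ξ hx']
  rw [← jac_mulVec, ← chartD_chartDinv_eq_fderiv he he' hx hx', chartDinv_chartD he hx]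

theorem isInvertible_mfderiv_chart_symm (he : e ∈ IsManifold.maximalAtlas 𝓘(ℝ, Base d) ∞ X)
    {u : Base d} (hu : u ∈ e.target) :
    (mfderiv 𝓘(ℝ, Base d) 𝓘(ℝ, Base d) e.symm u).IsInvertible ∧
      (mfderiv 𝓘(ℝ, Base d) 𝓘(ℝ, Base d) e.symm u).inverse = chartD e (e.symm u) := by
  have hx := e.map_target hu
  have h1 := chartD_chartDinv he hx
  have h2 := chartDinv_chartD he hx
  have key : ∀ z, z = u → ∀ w : Base d, (show Base d from mfderiv 𝓘(ℝ, Base d) 𝓘(ℝ, Base d) e.symm u w) =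
      mfderiv 𝓘(ℝ, Base d) 𝓘(ℝ, Base d) e.symm z w := by
    rintro _ rfl _; rfl
  have h3 : (mfderiv 𝓘(ℝ, Base d) 𝓘(ℝ, Base d) e.symm u).comp (chartD e (e.symm u)) =
      ContinuousLinearMap.id ℝ _ := ContinuousLinearMap.ext fun v =>
      (key _ (e.right_inv hu) _).trans (h2 v)
  have h4 : (chartD e (e.symm u)).comp (mfderiv 𝓘(ℝ, Base d) 𝓘(ℝ, Base d) e.symm u) =
      ContinuousLinearMap.id ℝ _ := ContinuousLinearMap.ext fun v =>
      (congrArg (fun w : Base d => (chartD e (e.symm u) w : Base d))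
        (key _ (e.right_inv hu) v)).trans (h1 v)
  exact ⟨ContinuousLinearMap.IsInvertible.of_inverse h3 h4, ContinuousLinearMap.inverse_eq h3 h4⟩

theorem isInvertible_mfderiv_chart (he : e ∈ IsManifold.maximalAtlas 𝓘(ℝ, Base d) ∞ X)
    (hx : x ∈ e.source) :
    (mfderiv 𝓘(ℝ, Base d) 𝓘(ℝ, Base d) e x).IsInvertible ∧
      (mfderiv 𝓘(ℝ, Base d) 𝓘(ℝ, Base d) e x).inverse = chartDinv e x := by
  have h3 : (mfderiv 𝓘(ℝ, Base d) 𝓘(ℝ, Base d) e x).comp (chartDinv e x) =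
      ContinuousLinearMap.id ℝ _ := ContinuousLinearMap.ext (chartD_chartDinv he hx)
  have h4 : (chartDinv e x).comp (mfderiv 𝓘(ℝ, Base d) 𝓘(ℝ, Base d) e x) =
      ContinuousLinearMap.id ℝ _ := ContinuousLinearMap.ext (chartDinv_chartD he hx)
  exact ⟨ContinuousLinearMap.IsInvertible.of_inverse h3 h4, ContinuousLinearMap.inverse_eq h3 h4⟩

/-- On the target of the chart, the components are those of the pullback of the vector field by the
inverse chart, and such pullbacks are smooth. -/
theorem contDiffOn_vectorComp (he : e ∈ IsManifold.maximalAtlas 𝓘(ℝ, Base d) ∞ X)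
    (ξ : VectorFieldX d X) (i : Fin (d + 1)) :
    ContDiffOn ℝ ∞ (fun u => vectorComp ξ e u i) e.target := by
  have h1 : ContDiffOn ℝ ∞
      (VectorField.mpullback 𝓘(ℝ, Base d) 𝓘(ℝ, Base d) e.symm fun x => ξ x) e.target := by
    rw [← contMDiffOn_vectorSpace_iff_contDiffOn]
    intro u hu
    exact (ContMDiffAt.mpullback_vectorField_preimage (n := ∞) (ξ.contMDiff (e.symm u))
      (contMDiffAt_symm_of_mem_maximalAtlas he hu)
      (isInvertible_mfderiv_chart_symm he hu).1 (by simp)).contMDiffWithinAt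
  refine ((EuclideanSpace.proj i : Base d →L[ℝ] ℝ).contDiff.comp_contDiffOn h1).congr fun u hu => ?_
  change _ = (show Base d from
    (mfderiv 𝓘(ℝ, Base d) 𝓘(ℝ, Base d) e.symm u).inverse (ξ (e.symm u))) i
  rw [(isInvertible_mfderiv_chart_symm he hu).2]
  rfl

variable [T2Space X]

/-- The Hausdorff property enters here: a compact part of a chart domain is closed in `X`, so
objects supported there extend smoothly by zero, and maps by the identity. -/
theorem isClosed_symm_image {K : Set (Base d)} (hK : IsCompact K) (hKe : K ⊆ e.target) :
    IsClosed (e.symm '' K) :=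
  (hK.image_of_continuousOn (e.continuousOn_symm.mono hKe)).isClosed

/-- The vector field with given components, compactly supported in a chart. -/
theorem exists_vectorField (he : e ∈ IsManifold.maximalAtlas 𝓘(ℝ, Base d) ∞ X)
    {η : Base d → Base d} (hη : IsTest e.target η) :
    ∃ ξ : VectorFieldX d X, (∀ x ∈ e.source, ξ x = chartDinv e x (η (e x))) ∧
      (∀ x ∉ e.symm '' tsupport η, ξ x = 0) := by
  classical
  let f : ∀ x : X, TangentSpace 𝓘(ℝ, Base d) x := fun x =>
    if x ∈ e.source then chartDinv e x (η (e x)) else 0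
  have h0 : ∀ x ∉ e.symm '' tsupport η, f x = 0 := by
    intro x hx
    by_cases hxs : x ∈ e.source
    · have : η (e x) = 0 := image_eq_zero_of_notMem_tsupport fun h => hx ⟨e x, h, e.left_inv hxs⟩
      simp [f, this]
    · simp [f, hxs]
  have hsm : ContMDiff 𝓘(ℝ, Base d) (𝓘(ℝ, Base d).prod 𝓘(ℝ, Base d)) ∞
      fun x => (⟨x, f x⟩ : TangentBundle 𝓘(ℝ, Base d) X) := by
    intro x
    by_cases hx : x ∈ e.symm '' tsupport η
    · have hxs : x ∈ e.source := by
        obtain ⟨u, hu, rfl⟩ := hx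
        exact e.map_target (hη.tsupport_subset hu)
      have h1 : ContMDiffAt 𝓘(ℝ, Base d) (𝓘(ℝ, Base d).prod 𝓘(ℝ, Base d)) ∞
          (fun u => (⟨u, η u⟩ : TangentBundle 𝓘(ℝ, Base d) (Base d))) (e x) :=
        contMDiffAt_vectorSpace_iff_contDiffAt.2 hη.contDiff.contDiffAt
      have h2 := ContMDiffAt.mpullback_vectorField_preimage (n := ∞) h1
        (contMDiffAt_of_mem_maximalAtlas he hxs) (isInvertible_mfderiv_chart he hxs).1 (by simp)
      refine h2.congr_of_eventuallyEq ?_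
      filter_upwards [e.open_source.mem_nhds hxs] with z hz
      refine congrArg (fun v => (⟨z, v⟩ : TangentBundle 𝓘(ℝ, Base d) X)) ?_
      change f z = (mfderiv 𝓘(ℝ, Base d) 𝓘(ℝ, Base d) e z).inverse (η (e z))
      rw [(isInvertible_mfderiv_chart he hz).2]
      exact if_pos hz
    · have h1 := Bundle.contMDiff_zeroSection ℝ (TangentSpace 𝓘(ℝ, Base d) : X → Type _) (n := ∞)
        (IB := 𝓘(ℝ, Base d)) (F := Base d) x
      refine h1.congr_of_eventuallyEq ?_
      filter_upwards [(isClosed_symm_image hη.hasCompactSupport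
        hη.tsupport_subset).isOpen_compl.mem_nhds hx] with z hz
      simp only [h0 z hz]
      rfl
  exact ⟨⟨f, hsm⟩, fun x hx => if_pos hx, h0⟩

theorem exists_function (he : e ∈ IsManifold.maximalAtlas 𝓘(ℝ, Base d) ∞ X)
    {η : Base d → ℝ} (hη : IsTest e.target η) :
    ∃ f : C^∞⟮𝓘(ℝ, Base d), X; 𝓘(ℝ, ℝ), ℝ⟯, ∀ x ∈ e.source, f x = η (e x) := by
  classical
  let f : X → ℝ := fun x => if x ∈ e.source then η (e x) else 0
  have h0 : ∀ x ∉ e.symm '' tsupport η, f x = 0 := by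
    intro x hx
    by_cases hxs : x ∈ e.source
    · have : η (e x) = 0 := image_eq_zero_of_notMem_tsupport fun h => hx ⟨e x, h, e.left_inv hxs⟩
      simp [f, this]
    · simp [f, hxs]
  have hsm : ContMDiff 𝓘(ℝ, Base d) 𝓘(ℝ, ℝ) ∞ f := by
    intro x
    by_cases hx : x ∈ e.symm '' tsupport η
    · have hxs : x ∈ e.source := by
        obtain ⟨u, hu, rfl⟩ := hx
        exact e.map_target (hη.tsupport_subset hu)
      refine ((hη.contDiff.contMDiff (e x)).comp x
        (contMDiffAt_of_mem_maximalAtlas he hxs)).congr_of_eventuallyEq ?_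
      filter_upwards [e.open_source.mem_nhds hxs] with z hz
      simp only [f, if_pos hz, Function.comp_apply]
    · refine (contMDiffAt_const (c := (0 : ℝ))).congr_of_eventuallyEq ?_
      filter_upwards [(isClosed_symm_image hη.hasCompactSupport
        hη.tsupport_subset).isOpen_compl.mem_nhds hx] with z hz
      exact h0 z hz
  exact ⟨⟨f, hsm⟩, fun x hx => if_pos hx⟩

theorem exists_smul (f : C^∞⟮𝓘(ℝ, Base d), X; 𝓘(ℝ, ℝ), ℝ⟯) (ξ : VectorFieldX d X) :
    ∃ η : VectorFieldX d X, ∀ x, η x = f x • ξ x :=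
  ⟨⟨fun x => f x • ξ x, f.contMDiff.smul_section ξ.contMDiff⟩, fun _ => rfl⟩

end Charts

/-! ## Fields in fibered charts -/

section Fields

variable {d m r R : ℕ}
variable {X : Type*} [TopologicalSpace X] [ChartedSpace (Base d) X] [IsManifold 𝓘(ℝ, Base d) ∞ X]
variable {Y : Type*} [TopologicalSpace Y] [ChartedSpace (Base d × Fibre m) Y]
  [IsManifold 𝓘(ℝ, Base d × Fibre m) ∞ Y]
variable {o : OrientedAtlas d X} {π : Y → X} (c c' : FiberedChart (m := m) o π)
  (γ : LocalField (d := d) (m := m) π) {u : Base d}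

theorem isOpen_jetTarget : IsOpen (c.jetTarget r) := by
  have h1 : IsOpen {q : JetCoord d m r | (q.1, q.2.2 (MultiIdx.nil d r)) ∈ c.total.target} :=
    c.total.open_target.preimage (by fun_prop)
  have h2 : IsOpen {q : JetCoord d m r | (invMetric (q.2.1 (MultiIdx.nil d r))).det ≠ 0} :=
    isOpen_nondegenerate.preimage (f := fun q : JetCoord d m r => q.2.1 (MultiIdx.nil d r))
      (by fun_prop)
  exact h1.inter h2

variable {c c'}

theorem FiberedChart.base_mem (c : FiberedChart (m := m) o π) :
    c.base ∈ IsManifold.maximalAtlas 𝓘(ℝ, Base d) ∞ X := c.base_positive.1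

theorem FiberedChart.proj_mem (c : FiberedChart (m := m) o π) {y : Y} (hy : y ∈ c.total.source) :
    π y ∈ c.base.source := by
  rw [← c.image_source]; exact mem_image_of_mem π hy

theorem FiberedChart.mem_target_of_total (c : FiberedChart (m := m) o π) {v : Base d}
    {w : Fibre m} (h : (v, w) ∈ c.total.target) :
    v ∈ c.base.target ∧ π (c.total.symm (v, w)) = c.base.symm v := by
  have h1 := c.fst_total _ (c.total.map_target h)
  rw [c.total.right_inv h] at h1
  have h2 := c.proj_mem (c.total.map_target h)
  change v = _ at h1
  constructor
  · rw [h1]; exact c.base.map_source h2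
  · conv_rhs => rw [h1]
    exact (c.base.left_inv h2).symm

theorem isOpen_fieldDomain : IsOpen (c.fieldDomain γ) := by
  have h1 := γ.matter_smooth.continuousOn.isOpen_inter_preimage γ.isOpen_dom c.total.open_source
  exact c.base.symm.isOpen_inter_preimage h1

variable {γ}

theorem total_matter (hu : u ∈ c.fieldDomain γ) :
    c.total (γ.matter (c.base.symm u)) = (u, c.matterRep γ u) := by
  refine Prod.ext ?_ rfl
  rw [c.fst_total _ hu.2.2, γ.isSection _ hu.2.1]
  exact c.base.right_inv hu.1

theorem total_mem_target (hu : u ∈ c.fieldDomain γ) : (u, c.matterRep γ u) ∈ c.total.target := by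
  rw [← total_matter hu]; exact c.total.map_source hu.2.2

theorem contDiffOn_metricRep : ContDiffOn ℝ ∞ (c.metricRep γ) (c.fieldDomain γ) :=
  (γ.metric_smooth _ c.base_mem).mono fun _ hu => ⟨hu.1, hu.2.1⟩

theorem contDiffOn_matterRep : ContDiffOn ℝ ∞ (c.matterRep γ) (c.fieldDomain γ) := by
  have h1 : ContMDiffOn 𝓘(ℝ, Base d) 𝓘(ℝ, Base d × Fibre m) ∞
      (c.total ∘ γ.matter ∘ c.base.symm) (c.fieldDomain γ) :=
    (contMDiffOn_of_mem_maximalAtlas c.total_smooth).comp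
      ((γ.matter_smooth.comp ((contMDiffOn_symm_of_mem_maximalAtlas c.base_mem).mono
        fun u hu => hu.1) fun u hu => hu.2.1)) fun u hu => hu.2.2
  rw [contMDiffOn_iff_contDiffOn] at h1
  exact contDiff_snd.comp_contDiffOn h1

theorem metricRep_eq_gram {x : X} (hx : x ∈ c.base.source) :
    invMetric (c.metricRep γ (c.base x)) = gram c.base (γ.metric x) :=
  metricComp_apply γ.metric hx

theorem metricRep_det_ne_zero (hu : u ∈ c.base.target) :
    (invMetric (c.metricRep γ u)).det ≠ 0 := by
  have := gram_det_ne_zero c.base_mem (c.base.map_target hu) (γ.metric (c.base.symm u))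
  rwa [← metricRep_eq_gram (c.base.map_target hu), c.base.right_inv hu] at this

theorem jet_mem (hu : u ∈ c.fieldDomain γ) : c.jet R γ u ∈ c.jetTarget R := by
  refine ⟨?_, ?_⟩
  · rw [FiberedChart.jet, jetCoord_nil_matter]
    exact total_mem_target hu
  · rw [FiberedChart.jet, jetCoord_nil_metric]
    exact metricRep_det_ne_zero hu.1

theorem contDiffOn_jet : ContDiffOn ℝ ∞ (c.jet R γ) (c.fieldDomain γ) :=
  contDiffOn_jetCoord (isOpen_fieldDomain γ) contDiffOn_metricRep contDiffOn_matterRep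

/-- Every smooth coordinate expression is the expression of a local field. -/
theorem exists_localField (c : FiberedChart (m := m) o π) {V : Set (Base d)} (hV : IsOpen V)
    {G : Base d → SymArray d} {y : Base d → Fibre m} (hG : ContDiffOn ℝ ∞ G V)
    (hy : ContDiffOn ℝ ∞ y V) (h0 : ∀ v ∈ V, (invMetric (G v)).det ≠ 0)
    (hm : ∀ v ∈ V, (v, y v) ∈ c.total.target) :
    ∃ γ : LocalField (d := d) (m := m) π, c.fieldDomain γ = V ∧ EqOn (c.metricRep γ) G V ∧
      EqOn (c.matterRep γ) y V ∧ γ.dom = c.base.source ∩ c.base ⁻¹' V ∧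
      ∀ v ∈ V, γ.matter (c.base.symm v) = c.total.symm (v, y v) := by
  obtain ⟨g, hg⟩ := exists_metric_field c.base_mem G
  have hVt : ∀ v ∈ V, v ∈ c.base.target := fun v hv => (c.mem_target_of_total (hm v hv)).1
  have hgG : EqOn (metricComp g c.base) G V := by
    intro v hv
    have h1 := metricComp_apply g (c.base.map_target (hVt v hv))
    rw [hg _ (c.base.map_target (hVt v hv)) (by rw [c.base.right_inv (hVt v hv)]; exact h0 v hv),
      c.base.right_inv (hVt v hv)] at h1
    exact Subtype.ext h1
  let γ : LocalField (d := d) (m := m) π :=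
    { dom := c.base.source ∩ c.base ⁻¹' V
      isOpen_dom := c.base.isOpen_inter_preimage hV
      metric := g
      matter := fun x => c.total.symm (c.base x, y (c.base x))
      isSection := fun x hx => by
        rw [(c.mem_target_of_total (hm _ hx.2)).2, c.base.left_inv hx.1]
      metric_smooth := fun e he => contDiffOn_metricComp c.base_mem he (hG.congr hgG)
      matter_smooth := by
        have h1 : ContMDiffOn 𝓘(ℝ, Base d) 𝓘(ℝ, Base d × Fibre m) ∞ (fun v => (v, y v)) V :=
          contMDiffOn_iff_contDiffOn.2 (contDiffOn_id.prodMk hy)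
        exact ((contMDiffOn_symm_of_mem_maximalAtlas c.total_smooth).comp h1 hm).comp
          ((contMDiffOn_of_mem_maximalAtlas c.base_mem).mono inter_subset_left)
          fun x hx => hx.2 }
  have hmat : ∀ v ∈ V, γ.matter (c.base.symm v) = c.total.symm (v, y v) := fun v hv => by
    change c.total.symm (c.base (c.base.symm v), y (c.base (c.base.symm v))) = _
    rw [c.base.right_inv (hVt v hv)]
  refine ⟨γ, ?_, hgG, ?_, rfl, hmat⟩
  · ext v
    constructor
    · rintro ⟨h1, ⟨-, h2⟩, -⟩
      rwa [mem_preimage, c.base.right_inv h1] at h2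
    · intro hv
      refine ⟨hVt v hv, ⟨c.base.map_target (hVt v hv), ?_⟩, ?_⟩
      · rwa [mem_preimage, c.base.right_inv (hVt v hv)]
      · rw [hmat v hv]; exact c.total.map_target (hm v hv)
  · intro v hv
    simp only [FiberedChart.matterRep, hmat v hv, c.total.right_inv (hm v hv)]

/-! ### Change of fibered charts -/

/-- The points of the domain of a field in the chart `c` at which it takes values in `c'`. -/
def overlap (c c' : FiberedChart (m := m) o π) (γ : LocalField (d := d) (m := m) π) :
    Set (Base d) := {u | u ∈ c.fieldDomain γ ∧ γ.matter (c.base.symm u) ∈ c'.total.source}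

/-- The change of base coordinates. -/
def FiberedChart.change (c c' : FiberedChart (m := m) o π) : Base d → Base d :=
  c'.base ∘ c.base.symm

theorem isOpen_overlap : IsOpen (overlap c c' γ) := by
  have h1 := γ.matter_smooth.continuousOn.isOpen_inter_preimage γ.isOpen_dom
    (c.total.open_source.inter c'.total.open_source)
  have h2 := c.base.symm.isOpen_inter_preimage h1
  convert h2 using 1
  ext u
  simp only [overlap, FiberedChart.fieldDomain, mem_ofPred_eq, mem_inter_iff, mem_preimage]
  tauto

theorem overlap_subset : overlap c c' γ ⊆ c.fieldDomain γ := fun _ hu => hu.1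

theorem mem_source_of_overlap (hu : u ∈ overlap c c' γ) : c.base.symm u ∈ c'.base.source := by
  have := c'.proj_mem hu.2
  rwa [γ.isSection _ hu.1.2.1] at this

theorem symm_change (hu : u ∈ overlap c c' γ) :
    c'.base.symm (c.change c' u) = c.base.symm u :=
  c'.base.left_inv (mem_source_of_overlap hu)

theorem change_change (hu : u ∈ overlap c c' γ) : c'.change c (c.change c' u) = u := by
  rw [FiberedChart.change, Function.comp_apply, symm_change hu, c.base.right_inv hu.1.1]

theorem change_mem (hu : u ∈ overlap c c' γ) : c.change c' u ∈ overlap c' c γ := by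
  refine ⟨⟨c'.base.map_source (mem_source_of_overlap hu), ?_, ?_⟩, ?_⟩
  · rw [symm_change hu]; exact hu.1.2.1
  · rw [symm_change hu]; exact hu.2
  · rw [symm_change hu]; exact hu.1.2.2

theorem overlap_subset_transition :
    overlap c c' γ ⊆ c.base.target ∩ c.base.symm ⁻¹' c'.base.source :=
  fun _ hu => ⟨hu.1.1, mem_source_of_overlap hu⟩

theorem contDiffOn_change : ContDiffOn ℝ ∞ (c.change c') (overlap c c' γ) :=
  (contDiffOn_transition c.base_mem c'.base_mem).mono overlap_subset_transition

theorem change_image : c.change c' '' overlap c c' γ = overlap c' c γ := by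
  refine Subset.antisymm ?_ fun v hv => ⟨c'.change c v, change_mem hv, change_change hv⟩
  rintro _ ⟨u, hu, rfl⟩
  exact change_mem hu

theorem change_injOn : InjOn (c.change c') (overlap c c' γ) := fun u hu v hv h => by
  rw [← change_change hu, h, change_change hv]

theorem det_jac_change_pos (hu : u ∈ overlap c c' γ) : 0 < (jac (c.change c') u).det := by
  have := c.base_positive.det_pos c'.base_positive (c.base.map_target hu.1.1)
    (mem_source_of_overlap hu)
  rw [c.base.right_inv hu.1.1] at this
  rw [det_jac]
  exact this

theorem metricRep_change (hu : u ∈ overlap c c' γ) :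
    invMetric (c'.metricRep γ (c.change c' u)) =
      jac (c.change c') u * invMetric (c.metricRep γ u) * (jac (c.change c') u).transpose := by
  have h1 := gram_transform c.base_mem c'.base_mem (c.base.map_target hu.1.1)
    (mem_source_of_overlap hu) (γ.metric (c.base.symm u))
  rw [← metricRep_eq_gram (c.base.map_target hu.1.1),
    ← metricRep_eq_gram (mem_source_of_overlap hu), c.base.right_inv hu.1.1] at h1
  exact h1

theorem vectorComp_change (hu : u ∈ overlap c c' γ) (ξ : VectorFieldX d X) (i : Fin (d + 1)) :
    vectorComp ξ c'.base (c.change c' u) i =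
      ∑ j, jac (c.change c') u i j * vectorComp ξ c.base u j := by
  have h1 := vectorComp_transform c.base_mem c'.base_mem (c.base.map_target hu.1.1)
    (mem_source_of_overlap hu) ξ i
  rw [c.base.right_inv hu.1.1] at h1
  exact h1

/-- Compatibility conditions for the coordinate expressions, over the overlap of two charts. -/
theorem compat_iff {P : Base d → Base d → Prop} :
    (∀ x ∈ γ.dom, γ.matter x ∈ c.total.source → γ.matter x ∈ c'.total.source →
      P (c.base x) (c'.base x)) ↔ ∀ u ∈ overlap c c' γ, P u (c.change c' u) := by
  constructor
  · intro h u hu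
    have := h _ hu.1.2.1 hu.1.2.2 hu.2
    rwa [c.base.right_inv hu.1.1] at this
  · intro h x hx h1 h2
    have hs : x ∈ c.base.source := by
      have := c.proj_mem h1
      rwa [γ.isSection x hx] at this
    have hu : c.base x ∈ overlap c c' γ := by
      refine ⟨⟨c.base.map_source hs, ?_, ?_⟩, ?_⟩ <;> rw [c.base.left_inv hs] <;> assumption
    have := h _ hu
    rwa [FiberedChart.change, Function.comp_apply, c.base.left_inv hs] at this

/-! ### The Lagrangian -/

variable (L : JetFunction (m := m) o π r)

theorem contDiffOn_lagrangian : ContDiffOn ℝ ∞ (L.lagrangian c) (c.jetTarget r) := by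
  refine (L.smooth c).mul (contDiffOn_volDensity (G := fun q : JetCoord d m r =>
    q.2.1 (MultiIdx.nil d r)) ?_ fun q hq => hq.2)
  exact ContDiff.contDiffOn (by fun_prop)

/-- The function `L` does not change, and the Jacobian comes from the volume density; positivity of
the determinant allows the absolute value to be dropped. -/
theorem lagrangian_change (hu : u ∈ overlap c c' γ) :
    L.lagrangian c (c.jet r γ u) =
      (jac (c.change c') u).det * L.lagrangian c' (c'.jet r γ (c.change c' u)) := by
  have h1 := (compat_iff (P := fun u v => L.expr c (c.jet r γ u) = L.expr c' (c'.jet r γ v))).1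
    (L.compat c c' γ) u hu
  have h2 := volDensity_transform (det_jac_change_pos hu) (metricRep_change hu)
  simp only [JetFunction.lagrangian, h1]
  simp only [FiberedChart.jet, jetCoord_nil_metric, h2]
  ring

end Fields

/-! ## Covariance of the variational derivative -/

section Pairing

variable {d : ℕ}

/-- The pairing `E_{ij} h^{ij}`. -/
def pairing (E : Matrix (Fin (d + 1)) (Fin (d + 1)) ℝ) (h : SymArray d) : ℝ :=
  ∑ i, ∑ j, E i j * invMetric h i j

theorem pairing_eq_trace (E : Matrix (Fin (d + 1)) (Fin (d + 1)) ℝ) (h : SymArray d) :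
    pairing E h = (E * invMetric h).trace := by
  simp only [pairing, Matrix.trace, Matrix.diag, Matrix.mul_apply]
  exact Finset.sum_congr rfl fun i _ => Finset.sum_congr rfl fun j _ => by rw [invMetric_comm]

/-- Cyclicity of the trace. It moves the Jacobian from the variation of the metric to the matrix
paired with it. -/
theorem pairing_push {E J : Matrix (Fin (d + 1)) (Fin (d + 1)) ℝ} {h h' : SymArray d}
    (hh : invMetric h' = J * invMetric h * J.transpose) :
    pairing E h' = pairing (J.transpose * E * J) h := by
  rw [pairing_eq_trace, pairing_eq_trace, hh, Matrix.trace_mul_comm, Matrix.mul_assoc,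
    Matrix.mul_assoc, Matrix.trace_mul_comm J, Matrix.mul_assoc (invMetric h),
    Matrix.trace_mul_comm (invMetric h)]

theorem pairing_symUnit {E : Matrix (Fin (d + 1)) (Fin (d + 1)) ℝ} (hE : E.transpose = E)
    (i j : Fin (d + 1)) : pairing E (symUnit i j) = E i j := by
  have hs : E j i = E i j := congrFun (congrFun hE i) j
  have h1 (a b : Fin (d + 1)) : invMetric (symUnit i j) a b =
      ((if a = i then if b = j then 1 else 0 else 0) +
        (if a = j then if b = i then 1 else 0 else 0)) / 2 := by
    simp only [← ite_and]; rfl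
  simp only [pairing, h1, mul_div_assoc', mul_add, mul_ite, mul_one, mul_zero, ← Finset.sum_div,
    Finset.sum_add_distrib, Finset.sum_ite_irrel, Finset.sum_const_zero, Finset.sum_ite_eq',
    Finset.mem_univ, if_true]
  rw [hs]; ring

theorem pairing_smul (E : Matrix (Fin (d + 1)) (Fin (d + 1)) ℝ) (a : ℝ) (h : SymArray d) :
    pairing E (a • h) = a * pairing E h := by
  simp only [pairing, Finset.mul_sum]
  exact Finset.sum_congr rfl fun i _ => Finset.sum_congr rfl fun j _ => by
    change E i j * (a * invMetric h i j) = _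
    ring

/-- The push-forward of a symmetric array by a matrix. -/
def pushSym (J : Matrix (Fin (d + 1)) (Fin (d + 1)) ℝ) (h : SymArray d) : SymArray d :=
  ⟨fun i j => (J * invMetric h * J.transpose) i j, fun i j => by
    have : (J * invMetric h * J.transpose).transpose = J * invMetric h * J.transpose := by
      rw [Matrix.transpose_mul, Matrix.transpose_mul, Matrix.transpose_transpose,
        invMetric_transpose, Matrix.mul_assoc]
    exact congrFun (congrFun this j) i⟩

theorem invMetric_pushSym (J : Matrix (Fin (d + 1)) (Fin (d + 1)) ℝ) (h : SymArray d) :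
    invMetric (pushSym J h) = J * invMetric h * J.transpose := rfl

theorem pushSym_zero (J : Matrix (Fin (d + 1)) (Fin (d + 1)) ℝ) : pushSym J 0 = 0 := by
  have h0 : invMetric (0 : SymArray d) = 0 := rfl
  have h1 : invMetric (pushSym J 0) = invMetric 0 := by
    rw [invMetric_pushSym, h0, Matrix.mul_zero, Matrix.zero_mul]
  exact Subtype.ext h1

theorem contDiffOn_pushSym {E : Type*} [NormedAddCommGroup E] [NormedSpace ℝ E] {U : Set E}
    {J : E → Matrix (Fin (d + 1)) (Fin (d + 1)) ℝ} {h : E → SymArray d}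
    (hJ : ∀ i j, ContDiffOn ℝ ∞ (fun z => J z i j) U) (hh : ContDiffOn ℝ ∞ h U) :
    ContDiffOn ℝ ∞ (fun z => pushSym (J z) (h z)) U := by
  refine contDiffOn_sym fun i j => ?_
  simp only [invMetric_pushSym, Matrix.mul_apply, Matrix.transpose_apply]
  exact ContDiffOn.sum fun l _ => (ContDiffOn.sum fun k _ =>
    (hJ i k).mul (contDiffOn_invMetric_apply hh k l)).mul (hJ j l)

end Pairing

/-! ### The first variation in two charts, and the transformation law of the Euler-Lagrange matrix.
-/

section Covariance

open MeasureTheory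

variable {d m r R : ℕ}
variable {X : Type*} [TopologicalSpace X] [ChartedSpace (Base d) X] [IsManifold 𝓘(ℝ, Base d) ∞ X]
variable {Y : Type*} [TopologicalSpace Y] [ChartedSpace (Base d × Fibre m) Y]
  [IsManifold 𝓘(ℝ, Base d × Fibre m) ∞ Y]
variable {o : OrientedAtlas d X} {π : Y → X} {c c' : FiberedChart (m := m) o π}
  {γ : LocalField (d := d) (m := m) π} {u : Base d} (L : JetFunction (m := m) o π r)

/-- The matrix `δℒ/δg^{ij}` along a field. -/
def eulerMatrix (L : JetFunction (m := m) o π r) (c : FiberedChart (m := m) o π)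
    (γ : LocalField (d := d) (m := m) π) (u : Base d) : Matrix (Fin (d + 1)) (Fin (d + 1)) ℝ :=
  Matrix.of fun i j => varDerivMetric (L.lagrangian c) (c.metricRep γ) (c.matterRep γ) u i j

theorem varDerivMetric_comm (Lag : JetCoord d m r → ℝ) (G : Base d → SymArray d)
    (y : Base d → Fibre m) (x : Base d) (i j : Fin (d + 1)) :
    varDerivMetric Lag G y x i j = varDerivMetric Lag G y x j i := by
  simp only [varDerivMetric, symUnit_comm i j]

theorem eulerMatrix_transpose : (eulerMatrix L c γ u).transpose = eulerMatrix L c γ u := by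
  ext i j
  exact varDerivMetric_comm _ _ _ _ _ _

theorem contDiffOn_eulerMatrix (i j : Fin (d + 1)) :
    ContDiffOn ℝ ∞ (fun u => eulerMatrix L c γ u i j) (c.fieldDomain γ) :=
  contDiffOn_varDerivMetric (isOpen_jetTarget c) (contDiffOn_lagrangian L)
    (isOpen_fieldDomain γ) contDiffOn_metricRep contDiffOn_matterRep (fun _ hu => jet_mem hu) i j

/-- The fields `g + t h`, near `t = 0`. -/
def variationDomain (G h : Base d → SymArray d) (O : Set (Base d)) : Set (ℝ × Base d) :=
  {q | q.2 ∈ O ∧ (invMetric (G q.2 + q.1 • h q.2)).det ≠ 0}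

variable {h h' : Base d → SymArray d} {O : Set (Base d)}

theorem contDiffOn_variation {G : Base d → SymArray d} (hG : ContDiffOn ℝ ∞ G O)
    (hh : ContDiffOn ℝ ∞ h O) :
    ContDiffOn ℝ ∞ (fun q : ℝ × Base d => G q.2 + q.1 • h q.2) (univ ×ˢ O) :=
  (hG.comp contDiffOn_snd fun _ hq => hq.2).add
    (contDiffOn_fst.smul (hh.comp contDiffOn_snd fun _ hq => hq.2))

theorem isOpen_variationDomain {G : Base d → SymArray d} (hO : IsOpen O)
    (hG : ContDiffOn ℝ ∞ G O) (hh : ContDiffOn ℝ ∞ h O) : IsOpen (variationDomain G h O) := by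
  have := (contDiffOn_variation hG hh).continuousOn.isOpen_inter_preimage (isOpen_univ.prod hO)
    isOpen_nondegenerate
  have e : variationDomain G h O = univ ×ˢ O ∩ (fun q : ℝ × Base d => G q.2 + q.1 • h q.2) ⁻¹'
      {A : SymArray d | (invMetric A).det ≠ 0} := by
    ext q
    exact ⟨fun h => ⟨⟨mem_univ _, h.1⟩, h.2⟩, fun h => ⟨h.1.2, h.2⟩⟩
  rwa [e]

/-- Identifies the first variation with a derivative along the curve of fields `g + t h`, so that
naturality of the Lagrangian can be differentiated. The array `g + t h` is a metric only where it
stays nondegenerate, whence the open set `variationDomain`. -/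
theorem hasDerivAt_variation (hO : IsOpen O) (hOc : O ⊆ c.fieldDomain γ)
    (hh : ContDiffOn ℝ ∞ h O) (hu : u ∈ O) :
    HasDerivAt (fun t : ℝ => L.lagrangian c
        (jetCoord r (fun z => c.metricRep γ z + t • h z) (c.matterRep γ) u))
      (fderiv ℝ (L.lagrangian c) (c.jet r γ u)
        (0, fun s => multiPartial (s.2 : Multiset (Fin (d + 1))) h u,
          fun s => multiPartial (s.2 : Multiset (Fin (d + 1))) (fun _ => (0 : Fibre m)) u)) 0 := by
  have hG := contDiffOn_metricRep.mono hOc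
  have hD := isOpen_variationDomain hO hG hh
  have hsub : variationDomain (c.metricRep γ) h O ⊆ univ ×ˢ O := fun q hq => ⟨mem_univ _, hq.1⟩
  have hH := (contDiffOn_variation hG hh).mono hsub
  have hw : ContDiffOn ℝ ∞ (fun q : ℝ × Base d => c.matterRep γ q.2)
      (variationDomain (c.metricRep γ) h O) :=
    (contDiffOn_matterRep.mono hOc).comp contDiffOn_snd fun q hq => hq.1
  have hmem : ∀ z ∈ O, ((0 : ℝ), z) ∈ variationDomain (c.metricRep γ) h O := fun z hz =>
    ⟨hz, by simpa using metricRep_det_ne_zero (hOc hz).1⟩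
  have h00 : jetCoord r (fun z => c.metricRep γ z + (0 : ℝ) • h z) (c.matterRep γ) u =
      c.jet r γ u := by simp [FiberedChart.jet]
  have h1 := hasDerivAt_comp_jetCoord hD hH hw (isOpen_jetTarget c) (contDiffOn_lagrangian L)
    (hmem u hu) (by simp only [h00]; exact jet_mem (hOc hu))
  simp only [h00] at h1
  have e1 : ∀ z ∈ O, dirD ((1 : ℝ), (0 : Base d))
      (fun q : ℝ × Base d => c.metricRep γ q.2 + q.1 • h q.2) ((0 : ℝ), z) = h z := by
    intro z hz
    have h2 := (differentiableAt_of_contDiffOn hH hD (hmem z hz)).hasFDerivAt.comp_hasDerivAt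
      (0 : ℝ) ((hasDerivAt_id (0 : ℝ)).prodMk (hasDerivAt_const (0 : ℝ) z))
    have h3 : HasDerivAt (fun t : ℝ => c.metricRep γ z + t • h z) ((1 : ℝ) • h z) 0 :=
      ((hasDerivAt_id (0 : ℝ)).smul_const (h z)).const_add _
    rw [one_smul] at h3
    exact h2.unique h3
  have e2 : ∀ z ∈ O, dirD ((1 : ℝ), (0 : Base d))
      (fun q : ℝ × Base d => c.matterRep γ q.2) ((0 : ℝ), z) = 0 := by
    intro z hz
    have h2 := (differentiableAt_of_contDiffOn hw hD (hmem z hz)).hasFDerivAt.comp_hasDerivAt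
      (0 : ℝ) ((hasDerivAt_id (0 : ℝ)).prodMk (hasDerivAt_const (0 : ℝ) z))
    exact h2.unique (hasDerivAt_const (0 : ℝ) (c.matterRep γ z))
  refine h1.congr_deriv ?_
  congr 1
  refine Prod.ext rfl (Prod.ext ?_ ?_) <;> funext s
  · exact multiD_congr hO e1 (bas d) _ hu
  · exact multiD_congr hO e2 (bas d) _ hu

/-- Naturality of the first variation under a change of chart. -/
theorem variation_change (hh : ContDiffOn ℝ ∞ h (overlap c c' γ))
    (hh' : ContDiffOn ℝ ∞ h' (overlap c' c γ))
    (hpush : ∀ v ∈ overlap c c' γ, invMetric (h' (c.change c' v)) =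
      jac (c.change c') v * invMetric (h v) * (jac (c.change c') v).transpose)
    (hu : u ∈ overlap c c' γ) :
    fderiv ℝ (L.lagrangian c) (c.jet r γ u)
        (0, fun s => multiPartial (s.2 : Multiset (Fin (d + 1))) h u,
          fun s => multiPartial (s.2 : Multiset (Fin (d + 1))) (fun _ => (0 : Fibre m)) u) =
      (jac (c.change c') u).det * fderiv ℝ (L.lagrangian c') (c'.jet r γ (c.change c' u))
        (0, fun s => multiPartial (s.2 : Multiset (Fin (d + 1))) h' (c.change c' u),
          fun s => multiPartial (s.2 : Multiset (Fin (d + 1))) (fun _ => (0 : Fibre m))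
            (c.change c' u)) := by
  -- Both sides are derivatives at `t = 0` of the Lagrangian along `g + t h`, read in the two
  -- charts. It suffices that the curves agree for small `t`; there each varied field is realized as
  -- a local field `γ'`, to which `lagrangian_change` applies.
  have d1 := hasDerivAt_variation L isOpen_overlap overlap_subset hh hu
  have d2 := (hasDerivAt_variation L isOpen_overlap overlap_subset hh' (change_mem hu)).const_mul
    (jac (c.change c') u).det
  refine d1.unique (d2.congr_of_eventuallyEq ?_)
  have hG := (contDiffOn_metricRep (c := c) (γ := γ)).mono (overlap_subset (c' := c'))
  have hD := isOpen_variationDomain isOpen_overlap hG hh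
  have hev : ∀ᶠ t : ℝ in 𝓝 0, (t, u) ∈ variationDomain (c.metricRep γ) h (overlap c c' γ) := by
    refine (show ContinuousAt (fun t : ℝ => (t, u)) 0 by fun_prop).eventually (hD.mem_nhds ?_)
    exact ⟨hu, by simpa using metricRep_det_ne_zero (overlap_subset hu).1⟩
  filter_upwards [hev] with t ht
  set V : Set (Base d) := {z | (t, z) ∈ variationDomain (c.metricRep γ) h (overlap c c' γ)} with hV
  have hVo : IsOpen V := isOpen_slice hD t
  have hVs : V ⊆ overlap c c' γ := fun z hz => hz.1
  obtain ⟨γ', hdom, hmet, hmat, hdom', hval⟩ := exists_localField c hVo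
    (G := fun z => c.metricRep γ z + t • h z) (y := c.matterRep γ)
    ((hG.mono hVs).add ((hh.mono hVs).const_smul t))
    (contDiffOn_matterRep.mono (hVs.trans overlap_subset)) (fun z hz => hz.2)
    (fun z hz => total_mem_target (overlap_subset (hVs hz)))
  have hval' : ∀ z ∈ V, γ'.matter (c.base.symm z) = γ.matter (c.base.symm z) := by
    intro z hz
    have hz' := overlap_subset (hVs hz)
    rw [hval z hz, ← total_matter hz', c.total.left_inv hz'.2.2]
  have hu' : u ∈ overlap c c' γ' :=
    ⟨by rw [hdom]; exact ht, by rw [hval' u ht]; exact hu.2⟩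
  have h1 := lagrangian_change L hu'
  have j1 : c.jet r γ' u = jetCoord r (fun z => c.metricRep γ z + t • h z) (c.matterRep γ) u :=
    jetCoord_congr hVo hmet hmat ht
  have j2 : c'.jet r γ' (c.change c' u) =
      jetCoord r (fun z => c'.metricRep γ z + t • h' z) (c'.matterRep γ) (c.change c' u) := by
    have hov : ∀ v ∈ overlap c' c γ', c'.change c v ∈ V ∧ c'.change c v ∈ overlap c c' γ' ∧
        v ∈ overlap c' c γ := by
      intro v hv
      have h2 := change_mem hv
      have h3 : c'.change c v ∈ V := by rw [← hdom]; exact overlap_subset h2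
      refine ⟨h3, h2, ?_⟩
      have h4 := change_mem (hVs h3)
      rwa [change_change hv] at h4
    refine jetCoord_congr (isOpen_overlap (c := c') (c' := c) (γ := γ')) (fun v hv => ?_)
      (fun v hv => ?_) (change_mem hu')
    · obtain ⟨h2, h3, h4⟩ := hov v hv
      have e1 := metricRep_change h3
      have e2 := metricRep_change (hVs h2)
      have e3 := hpush _ (hVs h2)
      rw [change_change hv] at e1 e2 e3
      refine Subtype.ext (e1.trans ?_)
      rw [hmet h2]
      change _ = invMetric (c'.metricRep γ v) + t • invMetric (h' v)
      rw [e2, e3]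
      change _ * (invMetric (c.metricRep γ (c'.change c v)) + t • invMetric (h (c'.change c v))) * _
        = _
      simp only [Matrix.mul_add, Matrix.add_mul, Matrix.mul_smul, Matrix.smul_mul]
    · obtain ⟨h2, h3, h4⟩ := hov v hv
      have e1 := symm_change hv
      have e2 := hval' _ h2
      rw [e1] at e2
      simp only [FiberedChart.matterRep, e2]
  rw [j1, j2] at h1
  exact h1

theorem integral_change {F F' : Base d → ℝ} (hF : ∀ v ∉ overlap c c' γ, F v = 0)
    (hF' : ∀ v ∉ overlap c' c γ, F' v = 0)
    (h : ∀ v ∈ overlap c c' γ, F v = (jac (c.change c') v).det * F' (c.change c' v)) :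
    ∫ v, F v = ∫ v, F' v := by
  have hm : MeasurableSet (overlap c c' γ) := isOpen_overlap.measurableSet
  have himg : c.change c' '' overlap c c' γ = overlap c' c γ := change_image
  rw [← setIntegral_eq_integral_of_forall_compl_eq_zero hF,
    ← setIntegral_eq_integral_of_forall_compl_eq_zero hF', ← himg,
    integral_image_eq_integral_abs_det_fderiv_smul volume hm
      (f' := fun v => fderiv ℝ (c.change c') v) (fun v hv => ?_) change_injOn]
  · refine setIntegral_congr_fun hm fun v hv => ?_
    rw [h v hv, ← det_jac, abs_of_pos (det_jac_change_pos hv), smul_eq_mul]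
  · exact (differentiableAt_of_contDiffOn contDiffOn_change isOpen_overlap
      hv).hasFDerivAt.hasFDerivWithinAt

/-- The variational derivative with respect to the metric is a tensor density. -/
theorem eulerMatrix_change (hu : u ∈ overlap c c' γ) :
    eulerMatrix L c γ u = (jac (c.change c') u).det • ((jac (c.change c') u).transpose *
      eulerMatrix L c' γ (c.change c' u) * jac (c.change c') u) := by
  have hjac (i j) : ContDiffOn ℝ ∞ (fun v => jac (c.change c') v i j) (overlap c c' γ) :=
    contDiffOn_jac isOpen_overlap contDiffOn_change i j
  have hmaps : MapsTo (c.change c') (overlap c c' γ) (overlap c' c γ) := fun v hv => change_mem hv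
  have hmaps' : MapsTo (c'.change c) (overlap c' c γ) (overlap c c' γ) := fun v hv => change_mem hv
  -- The expected value of the matrix in the chart `c`. The integrals of `eulerMatrix L c γ` and of
  -- `E₂` against arbitrary test variations are shown to agree.
  set E₂ : Base d → Matrix (Fin (d + 1)) (Fin (d + 1)) ℝ := fun v =>
    (jac (c.change c') v).det • ((jac (c.change c') v).transpose *
      eulerMatrix L c' γ (c.change c' v) * jac (c.change c') v) with hE₂
  have hE₂t (v) : (E₂ v).transpose = E₂ v := by
    simp only [hE₂, Matrix.transpose_smul, Matrix.transpose_mul, Matrix.transpose_transpose,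
      eulerMatrix_transpose, Matrix.mul_assoc]
  have hE₂c (i j) : ContDiffOn ℝ ∞ (fun v => E₂ v i j) (overlap c c' γ) := by
    simp only [hE₂, Matrix.smul_apply, smul_eq_mul, Matrix.mul_apply, Matrix.transpose_apply]
    refine (contDiffOn_det hjac).mul (ContDiffOn.sum fun l _ => (ContDiffOn.sum fun k _ =>
      (hjac k i).mul ?_).mul (hjac l j))
    exact ((contDiffOn_eulerMatrix L k l).mono overlap_subset).comp contDiffOn_change hmaps
  ext i j
  rw [← sub_eq_zero]
  refine eqOn_zero_of_integral_mul_eq_zero isOpen_overlap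
    (f := fun v => eulerMatrix L c γ v i j - E₂ v i j)
    (((contDiffOn_eulerMatrix L i j).mono overlap_subset).continuousOn.sub (hE₂c i j).continuousOn)
    (fun η hη => ?_) u hu
  classical
  set h : Base d → SymArray d := fun v => η v • symUnit i j with hh
  -- The test variation read in the second chart, extended by zero. Its support lies in the image of
  -- the compact support of `h`, so it is again a test function.
  set h' : Base d → SymArray d := fun v => if v ∈ overlap c' c γ then
    pushSym (jac (c.change c') (c'.change c v)) (h (c'.change c v)) else 0 with hh'
  have th : IsTest (overlap c c' γ) h := hη.smul_const _
  have hpush : ∀ v ∈ overlap c c' γ, invMetric (h' (c.change c' v)) =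
      jac (c.change c') v * invMetric (h v) * (jac (c.change c') v).transpose := by
    intro v hv
    simp only [hh', if_pos (change_mem hv), change_change hv, invMetric_pushSym]
  have th' : IsTest (overlap c' c γ) h' := by
    refine isTest_of_contDiffOn (K := c.change c' '' tsupport h) ?_ ?_ isOpen_overlap ?_ ?_
    · exact th.hasCompactSupport.isCompact.image_of_continuousOn
        (contDiffOn_change.continuousOn.mono th.tsupport_subset)
    · rintro _ ⟨v, hv, rfl⟩
      exact change_mem (th.tsupport_subset hv)
    · have : ContDiffOn ℝ ∞ (fun v => pushSym (jac (c.change c') (c'.change c v))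
          (h (c'.change c v))) (overlap c' c γ) :=
        contDiffOn_pushSym (fun i j => (hjac i j).comp contDiffOn_change hmaps')
          (th.contDiff.contDiffOn.comp contDiffOn_change hmaps')
      exact this.congr fun v hv => if_pos hv
    · intro v hv
      by_cases hvo : v ∈ overlap c' c γ
      · have : h (c'.change c v) = 0 := image_eq_zero_of_notMem_tsupport fun hs =>
          hv ⟨_, hs, change_change hvo⟩
        simp only [hh', if_pos hvo, this, pushSym_zero]
      · exact if_neg hvo
  have t0 (O : Set (Base d)) : IsTest O (fun _ : Base d => (0 : Fibre m)) :=
    ⟨contDiff_const, HasCompactSupport.zero, by simp [tsupport]⟩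
  have z1 (c : FiberedChart (m := m) o π) {O : Set (Base d)} {k : Base d → SymArray d}
      (hk : IsTest O k) : ∀ v ∉ O, fderiv ℝ (L.lagrangian c) (c.jet r γ v)
        (0, fun s => multiPartial (s.2 : Multiset (Fin (d + 1))) k v,
          fun s => multiPartial (s.2 : Multiset (Fin (d + 1))) (fun _ => (0 : Fibre m)) v) = 0 := by
    intro v hv
    have : ((0 : Base d), (fun s : MultiIdx d r =>
        multiPartial (s.2 : Multiset (Fin (d + 1))) k v), (fun s : MultiIdx d r =>
          multiPartial (s.2 : Multiset (Fin (d + 1))) (fun _ => (0 : Fibre m)) v)) = 0 := by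
      refine Prod.ext rfl (Prod.ext ?_ ?_) <;> funext s
      · exact (hk.multiPartial _).eq_zero hv
      · exact ((t0 O).multiPartial _).eq_zero hv
    rw [this, map_zero]
  -- The integrated first variations agree in the two charts. The first variation formula rewrites
  -- each as a pairing with an Euler-Lagrange matrix, and a second change of variables pulls the
  -- pairing in `c'` back to one with `E₂`.
  have i1 := integral_change (z1 c th) (z1 c' th')
    (fun v hv => variation_change L th.contDiff.contDiffOn th'.contDiff.contDiffOn hpush hv)
  have f1 := integral_first_variation (isOpen_jetTarget c) (contDiffOn_lagrangian L)
    (isOpen_overlap (c := c) (c' := c') (γ := γ)) (contDiffOn_metricRep.mono overlap_subset)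
    (contDiffOn_matterRep.mono overlap_subset) (fun v hv => jet_mem (overlap_subset hv)) th (t0 _)
  have f2 := integral_first_variation (isOpen_jetTarget c') (contDiffOn_lagrangian L)
    (isOpen_overlap (c := c') (c' := c) (γ := γ)) (contDiffOn_metricRep.mono overlap_subset)
    (contDiffOn_matterRep.mono overlap_subset) (fun v hv => jet_mem (overlap_subset hv)) th' (t0 _)
  have p1 (c : FiberedChart (m := m) o π) (k : Base d → SymArray d) (v : Base d) :
      ((∑ i, ∑ j, varDerivMetric (L.lagrangian c) (c.metricRep γ) (c.matterRep γ) v i j *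
        symComp i j (k v)) + ∑ σ, varDerivMatter (L.lagrangian c) (c.metricRep γ)
          (c.matterRep γ) v σ * (0 : Fibre m) σ) = pairing (eulerMatrix L c γ v) (k v) := by
    simp only [PiLp.zero_apply, mul_zero, Finset.sum_const_zero, add_zero]
    rfl
  simp only [p1] at f1 f2
  simp only [FiberedChart.jet] at i1
  rw [f1, f2] at i1
  have i2 : ∫ v, pairing (E₂ v) (h v) = ∫ v, pairing (eulerMatrix L c' γ v) (h' v) := by
    refine integral_change (c := c) (c' := c') (γ := γ) (fun v hv => ?_) (fun v hv => ?_)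
      fun v hv => ?_
    · rw [th.eq_zero hv, ← zero_smul ℝ (0 : SymArray d), pairing_smul, zero_mul]
    · rw [th'.eq_zero hv, ← zero_smul ℝ (0 : SymArray d), pairing_smul, zero_mul]
    · rw [pairing_push (hpush v hv)]
      simp only [hE₂, pairing, Matrix.smul_apply, smul_eq_mul, Finset.mul_sum, mul_assoc]
  rw [← i2] at i1
  simp only [hh, pairing_smul, pairing_symUnit (eulerMatrix_transpose L),
    pairing_symUnit (hE₂t _)] at i1
  have g1 : Integrable fun v => η v * eulerMatrix L c γ v i j := by
    have := (hη.smul isOpen_overlap ((contDiffOn_eulerMatrix L i j).mono overlap_subset)).integrable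
    simpa [mul_comm] using this
  have g2 : Integrable fun v => η v * E₂ v i j := by
    have := (hη.smul isOpen_overlap (hE₂c i j)).integrable
    simpa only [smul_eq_mul, mul_comm] using this
  rw [← sub_eq_zero, ← integral_sub g1 g2] at i1
  rw [← i1]
  exact integral_congr_ae (Eventually.of_forall fun v => by ring)

end Covariance

/-! ω Forms of degree `n` and `n - 1` on `ℝⁿ` -/

section Forms

variable {d : ℕ} {u : Base d}

theorem omegaZero_apply (v : Fin (d + 1) → Base d) :
    omegaZero d v = (EuclideanSpace.basisFun (Fin (d + 1)) ℝ).toBasis.det v := rfl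

theorem omegaZero_bas : omegaZero d (bas d) = 1 := by
  have h := (EuclideanSpace.basisFun (Fin (d + 1)) ℝ).toBasis.det_self
  rw [omegaZero_apply, ← h]
  congr 1
  funext i
  simp [bas]

theorem topForm_eq (α : Base d [⋀^Fin (d + 1)]→L[ℝ] ℝ) : α = α (bas d) • omegaZero d := by
  have h := (α.toAlternatingMap).eq_smul_basis_det
    (EuclideanSpace.basisFun (Fin (d + 1)) ℝ).toBasis
  have hb : (⇑(EuclideanSpace.basisFun (Fin (d + 1)) ℝ).toBasis) = bas d := by
    funext i
    simp [bas]
  ext v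
  have := congrArg (fun f => f v) h
  simpa [hb, omegaZero_apply] using this

theorem topForm_ext {α α' : Base d [⋀^Fin (d + 1)]→L[ℝ] ℝ} (h : α (bas d) = α' (bas d)) :
    α = α' := by
  rw [topForm_eq α, topForm_eq α', h]

theorem omegaZero_comp (A : Base d →L[ℝ] Base d) :
    (omegaZero d).compContinuousLinearMap A = A.det • omegaZero d := by
  ext v
  exact (EuclideanSpace.basisFun (Fin (d + 1)) ℝ).toBasis.det_comp (A : Base d →ₗ[ℝ] Base d) v

/-- The form `V^j ω_j`. -/
def vecForm (V : Fin (d + 1) → ℝ) : Base d [⋀^Fin d]→L[ℝ] ℝ := ∑ j, V j • omega j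

theorem sum_omegaZero_vecCons (V : Fin (d + 1) → ℝ) (w : Fin d → Base d) :
    vecForm V w = omegaZero d (Matrix.vecCons (∑ j, V j • bas d j) w) := by
  have h1 : omegaZero d (Matrix.vecCons (∑ j, V j • bas d j) w) =
      (omegaZero d).curryLeft (∑ j, V j • bas d j) w := rfl
  rw [h1, map_sum]
  simp only [vecForm, ContinuousAlternatingMap.sum_apply, map_smul]
  rfl

/-- Since `V^j ω_j = i_V ω₀`, pulling back `i_{AV} ω₀` by `A` gives `det A` times `i_V ω₀`; the
hypothesis says that `AV` is `det A` times `V'`, and the common factor cancels. -/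
theorem vecForm_comp {A : Base d →L[ℝ] Base d} {V V' : Fin (d + 1) → ℝ}
    (h : ∑ j, (A.det * V' j) • bas d j = A (∑ j, V j • bas d j)) (hA : A.det ≠ 0) :
    (vecForm V').compContinuousLinearMap A = vecForm V := by
  ext w
  have h1 : ((vecForm V').compContinuousLinearMap A) w = vecForm V' (A ∘ w) := rfl
  have h2 : vecForm (fun j => A.det * V' j) (A ∘ w) = A.det * vecForm V' (A ∘ w) := by
    simp only [vecForm, ContinuousAlternatingMap.sum_apply, ContinuousAlternatingMap.smul_apply,
      smul_eq_mul, Finset.mul_sum, mul_assoc]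
  have h3 : Matrix.vecCons (A (∑ j, V j • bas d j)) (A ∘ w) =
      A ∘ Matrix.vecCons (∑ j, V j • bas d j) w := by
    funext i
    refine Fin.cases rfl (fun i => rfl) i
  have h4 := congrArg (fun f => f (Matrix.vecCons (∑ j, V j • bas d j) w)) (omegaZero_comp A)
  simp only [ContinuousAlternatingMap.compContinuousLinearMap_apply,
    ContinuousAlternatingMap.smul_apply, smul_eq_mul] at h4
  rw [sum_omegaZero_vecCons, h, h3, h4] at h2
  rw [h1, sum_omegaZero_vecCons V]
  exact (mul_left_cancel₀ hA h2).symm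

/-- The sign moves `e_j` from the first slot of `ω₀` to the slot `i`. For `i ≠ j` the vector `e_j`
then occurs twice. -/
theorem omega_removeNth (i j : Fin (d + 1)) :
    omega j (i.removeNth (bas d)) = if i = j then (-1) ^ (i : ℕ) else 0 := by
  have h1 := (omegaZero d).toAlternatingMap.map_insertNth i (bas d j) (i.removeNth (bas d))
  have h2 : omega j (i.removeNth (bas d)) =
      (-1) ^ (i : ℕ) * omegaZero d (Fin.insertNth i (bas d j) (i.removeNth (bas d))) := by
    have h3 : omegaZero d (Fin.insertNth i (bas d j) (i.removeNth (bas d))) =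
      ((-1 : ℤ) ^ (i : ℕ)) • omega j (i.removeNth (bas d)) := h1
    rw [h3]
    change _ = (-1 : ℝ) ^ (i : ℕ) * (((-1 : ℤ) ^ (i : ℕ)) • omega j (i.removeNth (bas d)))
    rw [zsmul_eq_mul, ← mul_assoc]
    push_cast
    rw [← mul_pow]
    simp
  rw [h2]
  split_ifs with hij
  · subst hij
    rw [Fin.insertNth_self_removeNth, omegaZero_bas, mul_one]
  · have h4 : omegaZero d (Fin.insertNth i (bas d j) (i.removeNth (bas d))) = 0 := by
      obtain ⟨k, hk⟩ := Fin.exists_succAbove_eq (Ne.symm hij)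
      refine (omegaZero d).map_eq_zero_of_eq _ (i := i) (j := j) ?_ hij
      rw [Fin.insertNth_apply_same, ← hk, Fin.insertNth_apply_succAbove, Fin.removeNth]
    rw [h4, mul_zero]

/-- The identity `d(V^j ω_j) = (div V) ω₀`: the signs of the exterior derivative cancel those of
`omega_removeNth`. -/
theorem extDeriv_vecForm {V : Base d → Fin (d + 1) → ℝ}
    (hV : ∀ j, DifferentiableAt ℝ (fun z => V z j) u) :
    extDeriv (fun z => vecForm (V z)) u =
      (∑ j, dirD (bas d j) (fun z => V z j) u) • omegaZero d := by
  have hd : DifferentiableAt ℝ (fun z => vecForm (V z)) u :=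
    DifferentiableAt.fun_sum fun j _ => (hV j).smul_const _
  refine topForm_ext ?_
  rw [extDeriv_apply hd, ContinuousAlternatingMap.smul_apply, omegaZero_bas, smul_eq_mul, mul_one]
  refine Finset.sum_congr rfl fun i _ => ?_
  have h1 : (fun z => vecForm (V z) (i.removeNth (bas d))) =
      fun z => (-1) ^ (i : ℕ) * V z i := by
    funext z
    simp only [vecForm, ContinuousAlternatingMap.sum_apply, ContinuousAlternatingMap.smul_apply,
      omega_removeNth, smul_eq_mul, mul_ite, mul_zero, Finset.sum_ite_eq, Finset.mem_univ, if_true]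
    exact mul_comm _ _
  rw [h1, fderiv_const_mul (hV i)]
  rw [smul_apply, smul_eq_mul, zsmul_eq_mul]
  push_cast
  rw [← mul_assoc, ← mul_pow]
  simp [dirD]

/-- At a zero of `f` only `df ∧ α` remains of `d(fα)`. This isolates the value of `𝒯` in the
uniqueness argument. -/
theorem extDeriv_smul_of_eq_zero {f : Base d → ℝ} {α : Base d → Base d [⋀^Fin d]→L[ℝ] ℝ}
    (hf : DifferentiableAt ℝ f u) (hα : DifferentiableAt ℝ α u) (h0 : f u = 0)
    (v : Fin (d + 1) → Base d) :
    extDeriv (fun z => f z • α z) u v =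
      ∑ i : Fin (d + 1), (-1) ^ (i : ℕ) * (fderiv ℝ f u (v i) * α u (i.removeNth v)) := by
  have h1 : fderiv ℝ (fun z => f z • α z) u = (fderiv ℝ f u).smulRight (α u) := by
    rw [fderiv_fun_smul hf hα, h0, zero_smul, zero_add]
  rw [extDeriv, h1, ContinuousAlternatingMap.alternatizeUncurryFin_apply]
  refine Finset.sum_congr rfl fun i _ => ?_
  simp

/-- A form `α` of degree `n - 1` such that `β ∧ α = 0` for all covectors `β` vanishes. -/
theorem form_eq_zero {α : Base d [⋀^Fin d]→L[ℝ] ℝ}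
    (h : ∀ (a : Fin (d + 1)) (v : Fin (d + 1) → Base d),
      ∑ i : Fin (d + 1), (-1) ^ (i : ℕ) * (v i a * α (i.removeNth v)) = 0) : α = 0 := by
  have h0 : α.toAlternatingMap = 0 := by
    refine Module.Basis.ext_alternating (EuclideanSpace.basisFun (Fin (d + 1)) ℝ).toBasis
      fun σ hσ => ?_
    -- The `d` slots cannot exhaust the `d + 1` basis vectors. Testing with a missing covector
    -- `dx^a` and with `e_a` put in front leaves only the term in which `e_a` is removed.
    obtain ⟨a, ha⟩ : ∃ a, a ∉ range σ := by
      by_contra! hc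
      have := Fintype.card_le_of_surjective σ hc
      simp at this
    have h1 := h a (Matrix.vecCons (bas d a) fun k => bas d (σ k))
    rw [Fin.sum_univ_succ] at h1
    have h2 : ∀ k : Fin d, bas d (σ k) a = 0 := fun k => by
      rw [bas_apply, if_neg fun hh => ha ⟨k, hh.symm⟩]
    have h3 : bas d a a = 1 := by rw [bas_apply, if_pos rfl]
    have h4 : Fin.removeNth 0 (Matrix.vecCons (bas d a) fun k => bas d (σ k)) =
      fun k => bas d (σ k) := rfl
    simp only [Matrix.cons_val_zero, Matrix.cons_val_succ, h2, zero_mul, mul_zero,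
      Finset.sum_const_zero, add_zero, h3, one_mul, h4, Fin.val_zero, pow_zero] at h1
    simpa [bas] using h1
  ext v
  exact congrArg (fun f => f v) h0

end Forms

/-! ## The energy-momentum density and its balance, as functions of jets -/

section Stress

variable {d m r R : ℕ} {U : Set (Base d)} {G G' : Base d → SymArray d} {y y' : Base d → Fibre m}
  {x : Base d} {Ω : Set (JetCoord d m r)} {Lag : JetCoord d m r → ℝ}

theorem multiPartial_singleton {V : Type*} [NormedAddCommGroup V] [NormedSpace ℝ V]
    (i : Fin (d + 1)) (f : Base d → V) : multiPartial {i} f = dirD (bas d i) f := by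
  simp [multiPartial, partialD_eq]

theorem contDiffOn_dirD_slice {V P : Type*} [NormedAddCommGroup V] [NormedSpace ℝ V]
    [NormedAddCommGroup P] [NormedSpace ℝ P] {D : Set (P × Base d)} (hD : IsOpen D)
    {F : P × Base d → V} (hF : ContDiffOn ℝ ∞ F D) (v : Base d) :
    ContDiffOn ℝ ∞ (fun q : P × Base d => dirD v (fun z => F (q.1, z)) q.2) D :=
  (contDiffOn_dirD hD hF ((0 : P), v)).congr fun _ hq => dirD_slice hD hF v hq

/-- The matrix `δℒ/δg^{ij}` along the field `(G, y)`. -/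
def eulerM (Lag : JetCoord d m r → ℝ) (G : Base d → SymArray d) (y : Base d → Fibre m)
    (x : Base d) : Matrix (Fin (d + 1)) (Fin (d + 1)) ℝ :=
  Matrix.of fun i j => varDerivMetric Lag G y x i j

/-- The energy-momentum density `2 g^{jh} δℒ/δg^{hi}` along the field `(G, y)`. -/
def stressM (Lag : JetCoord d m r → ℝ) (G : Base d → SymArray d) (y : Base d → Fibre m)
    (x : Base d) : Matrix (Fin (d + 1)) (Fin (d + 1)) ℝ :=
  (2 : ℝ) • (invMetric (G x) * eulerM Lag G y x)

/-- The coefficients of the form `ℬ(ξ)`, up to the sign, along the field `(G, y)`. -/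
def balance (Lag : JetCoord d m r → ℝ) (G : Base d → SymArray d) (y : Base d → Fibre m)
    (x : Base d) (i : Fin (d + 1)) : ℝ :=
  ∑ j, dirD (bas d j) (fun z => stressM Lag G y z j i) x +
    ∑ j, ∑ k, eulerM Lag G y x j k * dirD (bas d i) (fun z => invMetric (G z) j k) x

theorem stressM_apply (j i : Fin (d + 1)) : stressM Lag G y x j i =
    2 * ∑ k, invMetric (G x) j k * eulerM Lag G y x k i := rfl

variable (hΩ : IsOpen Ω) (hL : ContDiffOn ℝ ∞ Lag Ω)

include hΩ hL

section Family

variable {P : Type*} [NormedAddCommGroup P] [NormedSpace ℝ P] {D : Set (P × Base d)}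
  {H : P × Base d → SymArray d} {w : P × Base d → Fibre m}

theorem contDiffOn_stressM_family (hD : IsOpen D) (hH : ContDiffOn ℝ ∞ H D)
    (hw : ContDiffOn ℝ ∞ w D)
    (hj : ∀ q ∈ D, jetCoord r (fun z => H (q.1, z)) (fun z => w (q.1, z)) q.2 ∈ Ω)
    (j i : Fin (d + 1)) : ContDiffOn ℝ ∞ (fun q : P × Base d =>
      stressM Lag (fun z => H (q.1, z)) (fun z => w (q.1, z)) q.2 j i) D := by
  simp only [stressM_apply]
  exact contDiffOn_const.mul (ContDiffOn.sum fun k _ => (contDiffOn_invMetric_apply hH j k).mul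
    (contDiffOn_varDerivMetric_family hD hH hw hΩ hL hj k i))

theorem contDiffOn_balance_family (hD : IsOpen D) (hH : ContDiffOn ℝ ∞ H D)
    (hw : ContDiffOn ℝ ∞ w D)
    (hj : ∀ q ∈ D, jetCoord r (fun z => H (q.1, z)) (fun z => w (q.1, z)) q.2 ∈ Ω)
    (i : Fin (d + 1)) : ContDiffOn ℝ ∞ (fun q : P × Base d =>
      balance Lag (fun z => H (q.1, z)) (fun z => w (q.1, z)) q.2 i) D := by
  refine (ContDiffOn.sum fun j _ => ?_).add (ContDiffOn.sum fun j _ => ContDiffOn.sum fun k _ =>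
    (contDiffOn_varDerivMetric_family hD hH hw hΩ hL hj j k).mul ?_)
  · exact contDiffOn_dirD_slice hD (F := fun q : P × Base d =>
      stressM Lag (fun z => H (q.1, z)) (fun z => w (q.1, z)) q.2 j i)
      (contDiffOn_stressM_family hΩ hL hD hH hw hj j i) _
  · exact contDiffOn_dirD_slice hD (F := fun q : P × Base d => invMetric (H q) j k)
      (contDiffOn_invMetric_apply hH j k) _

end Family

theorem contDiffOn_stressM (hU : IsOpen U) (hG : ContDiffOn ℝ ∞ G U) (hy : ContDiffOn ℝ ∞ y U)
    (hj : MapsTo (jetCoord r G y) U Ω) (j i : Fin (d + 1)) :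
    ContDiffOn ℝ ∞ (fun z => stressM Lag G y z j i) U := by
  simp only [stressM_apply]
  exact contDiffOn_const.mul (ContDiffOn.sum fun k _ => (contDiffOn_invMetric_apply hG j k).mul
    (contDiffOn_varDerivMetric hΩ hL hU hG hy hj k i))

theorem eulerM_congr_of_jet (hR : 2 * r ≤ R) (hU : IsOpen U) (hx : x ∈ U)
    (hG : ContDiffOn ℝ ∞ G U) (hy : ContDiffOn ℝ ∞ y U) (hG' : ContDiffOn ℝ ∞ G' U)
    (hy' : ContDiffOn ℝ ∞ y' U) (hj : jetCoord r G y x ∈ Ω)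
    (h : jetCoord R G y x = jetCoord R G' y' x) : eulerM Lag G y x = eulerM Lag G' y' x := by
  ext i j
  exact varDerivMetric_congr_of_jet hR hΩ hL hU hx hG hy hG' hy' hj h i j

theorem stressM_congr_of_jet (hR : 2 * r ≤ R) (hU : IsOpen U) (hx : x ∈ U)
    (hG : ContDiffOn ℝ ∞ G U) (hy : ContDiffOn ℝ ∞ y U) (hG' : ContDiffOn ℝ ∞ G' U)
    (hy' : ContDiffOn ℝ ∞ y' U) (hj : jetCoord r G y x ∈ Ω)
    (h : jetCoord R G y x = jetCoord R G' y' x) : stressM Lag G y x = stressM Lag G' y' x := by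
  have h0 : G x = G' x := by
    simpa only [multiPartial_eq, multiD_zero] using
      (multiPartial_eq_of_jetCoord_eq h 0 (Nat.zero_le _)).1
  rw [stressM, stressM, h0, eulerM_congr_of_jet hΩ hL hR hU hx hG hy hG' hy' hj h]

/-! ### Passage from quantities along fields to functions of the jet, by polynomial representatives.
-/

omit hΩ hL

/-- The polynomial metric with a given jet. -/
def taylorMetric (p : JetCoord d m R) : Base d → SymArray d := taylor p.1 p.2.1

/-- The polynomial matter field with a given jet. -/
def taylorMatter (p : JetCoord d m R) : Base d → Fibre m := taylor p.1 p.2.2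

theorem jetCoord_taylor (p : JetCoord d m R) :
    jetCoord R (taylorMetric p) (taylorMatter p) p.1 = p :=
  Prod.ext rfl (Prod.ext (funext fun _ => multiPartial_taylor _ _ _)
    (funext fun _ => multiPartial_taylor _ _ _))

theorem contDiff_taylorMetric (p : JetCoord d m R) : ContDiff ℝ ∞ (taylorMetric p) :=
  contDiff_taylor _ _

theorem contDiff_taylorMatter (p : JetCoord d m R) : ContDiff ℝ ∞ (taylorMatter p) :=
  contDiff_taylor _ _

theorem contDiff_taylorMetric_uncurry :
    ContDiff ℝ ∞ fun q : JetCoord d m R × Base d => taylorMetric q.1 q.2 :=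
  contDiff_taylor_uncurry.comp (f := fun q : JetCoord d m R × Base d =>
    ((q.1.1, q.1.2.1), q.2)) (by fun_prop)

theorem contDiff_taylorMatter_uncurry :
    ContDiff ℝ ∞ fun q : JetCoord d m R × Base d => taylorMatter q.1 q.2 :=
  contDiff_taylor_uncurry.comp (f := fun q : JetCoord d m R × Base d =>
    ((q.1.1, q.1.2.2), q.2)) (by fun_prop)

/-- The pairs of a jet and a point at which its polynomial representative takes values in `Ω`. -/
def taylorDomain (R : ℕ) (Ω : Set (JetCoord d m r)) : Set (JetCoord d m R × Base d) :=
  {q | jetCoord r (taylorMetric q.1) (taylorMatter q.1) q.2 ∈ Ω}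

include hΩ in
theorem isOpen_taylorDomain : IsOpen (taylorDomain R Ω) :=
  hΩ.preimage (contDiffOn_univ.1 (contDiffOn_jetCoord_family (P := JetCoord d m R) isOpen_univ
    (H := fun q => taylorMetric q.1 q.2) (w := fun q => taylorMatter q.1 q.2)
    contDiff_taylorMetric_uncurry.contDiffOn contDiff_taylorMatter_uncurry.contDiffOn)).continuous

/-- The energy-momentum density as a function of the jet. -/
def jetStress (Lag : JetCoord d m r → ℝ) (p : JetCoord d m R) :
    Matrix (Fin (d + 1)) (Fin (d + 1)) ℝ := stressM Lag (taylorMetric p) (taylorMatter p) p.1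

/-- The coefficients of `ℬ(ξ)`, up to the sign, as functions of the jet. -/
def jetBalance (Lag : JetCoord d m r → ℝ) (p : JetCoord d m R) (i : Fin (d + 1)) : ℝ :=
  balance Lag (taylorMetric p) (taylorMatter p) p.1 i

include hΩ hL

theorem contDiffOn_jetStress (j i : Fin (d + 1)) :
    ContDiffOn ℝ ∞ (fun p : JetCoord d m R => jetStress Lag p j i)
      {p | (p, p.1) ∈ taylorDomain R Ω} :=
  (contDiffOn_stressM_family hΩ hL (isOpen_taylorDomain hΩ)
    contDiff_taylorMetric_uncurry.contDiffOn contDiff_taylorMatter_uncurry.contDiffOn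
    (fun _ hq => hq) j i).comp (f := fun p : JetCoord d m R => (p, p.1))
    (contDiff_id.prodMk contDiff_fst).contDiffOn fun _ hp => hp

theorem contDiffOn_jetBalance (i : Fin (d + 1)) :
    ContDiffOn ℝ ∞ (fun p : JetCoord d m R => jetBalance Lag p i)
      {p | (p, p.1) ∈ taylorDomain R Ω} :=
  (contDiffOn_balance_family hΩ hL (isOpen_taylorDomain hΩ)
    contDiff_taylorMetric_uncurry.contDiffOn contDiff_taylorMatter_uncurry.contDiffOn
    (fun _ hq => hq) i).comp (f := fun p : JetCoord d m R => (p, p.1))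
    (contDiff_id.prodMk contDiff_fst).contDiffOn fun _ hp => hp

omit hΩ hL in
theorem jetCoord_taylor_jetCoord :
    jetCoord R (taylorMetric (jetCoord R G y x)) (taylorMatter (jetCoord R G y x)) x =
      jetCoord R G y x :=
  jetCoord_taylor _

/-- The density at a point depends on the `2r`-jet only, so the field may be replaced there by its
polynomial representative. -/
theorem jetStress_jetCoord (hR : 2 * r ≤ R) (hU : IsOpen U) (hx : x ∈ U)
    (hG : ContDiffOn ℝ ∞ G U) (hy : ContDiffOn ℝ ∞ y U) (hj : jetCoord r G y x ∈ Ω) :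
    jetStress Lag (jetCoord R G y x) = stressM Lag G y x :=
  (stressM_congr_of_jet hΩ hL hR hU hx hG hy (contDiff_taylorMetric _).contDiffOn
    (contDiff_taylorMatter _).contDiffOn hj jetCoord_taylor_jetCoord.symm).symm

/-- The balance contains one derivative of the energy-momentum density. Once the density is written
as `jetStress` composed with the `2r`-jet prolongation, the chain rule lemma with one further
derivative gives dependence on the `(2r + 1)`-jet. -/
theorem balance_congr_of_jet (hR : 2 * r + 1 ≤ R) (hU : IsOpen U) (hx : x ∈ U)
    (hG : ContDiffOn ℝ ∞ G U) (hy : ContDiffOn ℝ ∞ y U) (hG' : ContDiffOn ℝ ∞ G' U)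
    (hy' : ContDiffOn ℝ ∞ y' U) (hj : MapsTo (jetCoord r G y) U Ω)
    (hj' : MapsTo (jetCoord r G' y') U Ω)
    (h : jetCoord R G y x = jetCoord R G' y' x) (i : Fin (d + 1)) :
    balance Lag G y x i = balance Lag G' y' x i := by
  have h1 (a b) : dirD (bas d a) (fun z => stressM Lag G y z b i) x =
      dirD (bas d a) (fun z => stressM Lag G' y' z b i) x := by
    set Ω' : Set (JetCoord d m (2 * r)) := {p | (p, p.1) ∈ taylorDomain (2 * r) Ω} with hΩ'
    have ho : IsOpen Ω' := (isOpen_taylorDomain hΩ).preimage (by fun_prop)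
    have hmem : jetCoord (2 * r) G y x ∈ Ω' := by
      change jetCoord r _ _ x ∈ Ω
      rw [jetCoord_eq_of_le (by omega : r ≤ 2 * r) jetCoord_taylor_jetCoord]
      exact hj hx
    have h2 := multiPartial_comp_jetCoord_congr ho
      (contDiffOn_jetStress (R := 2 * r) hΩ hL b i) (k := 1) hR hU hx hG hy hG' hy' hmem h {a}
      (by simp)
    rw [multiPartial_singleton, multiPartial_singleton] at h2
    have e1 : EqOn (fun z => jetStress Lag (jetCoord (2 * r) G y z) b i)
        (fun z => stressM Lag G y z b i) U := fun z hz => by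
      simp only [jetStress_jetCoord hΩ hL le_rfl hU hz hG hy (hj hz)]
    have e2 : EqOn (fun z => jetStress Lag (jetCoord (2 * r) G' y' z) b i)
        (fun z => stressM Lag G' y' z b i) U := fun z hz => by
      simp only [jetStress_jetCoord hΩ hL le_rfl hU hz hG' hy' (hj' hz)]
    rw [dirD_congr hU e1 _ hx, dirD_congr hU e2 _ hx] at h2
    exact h2
  have h2 (a b) : dirD (bas d i) (fun z => invMetric (G z) a b) x =
      dirD (bas d i) (fun z => invMetric (G' z) a b) x := by
    have h3 := (multiPartial_eq_of_jetCoord_eq h {i} (by simp; omega)).1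
    rw [multiPartial_singleton, multiPartial_singleton] at h3
    have e1 := dirD_clm hU hG (bas d i) (symComp a b) hx
    have e2 := dirD_clm hU hG' (bas d i) (symComp a b) hx
    exact e1.trans ((congrArg (symComp a b) h3).trans e2.symm)
  simp only [balance, h1, h2, eulerM_congr_of_jet hΩ hL (by omega : 2 * r ≤ R) hU hx hG hy hG' hy'
    (hj hx) h]

theorem jetBalance_jetCoord (hR : 2 * r + 1 ≤ R) (hU : IsOpen U) (hx : x ∈ U)
    (hG : ContDiffOn ℝ ∞ G U) (hy : ContDiffOn ℝ ∞ y U) (hj : MapsTo (jetCoord r G y) U Ω)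
    (i : Fin (d + 1)) :
    jetBalance Lag (jetCoord R G y x) i = balance Lag G y x i := by
  set p := jetCoord R G y x with hp
  -- The polynomial representative takes its `r`-jets in `Ω` only near `x`, and `balance` involves
  -- derivatives; the comparison is made on a smaller neighbourhood.
  have hV : IsOpen (U ∩ {z | (p, z) ∈ taylorDomain R Ω}) :=
    hU.inter (isOpen_slice (isOpen_taylorDomain hΩ) p)
  have hjet : jetCoord R (taylorMetric p) (taylorMatter p) x = jetCoord R G y x :=
    jetCoord_taylor_jetCoord
  have hxV : x ∈ U ∩ {z | (p, z) ∈ taylorDomain R Ω} := by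
    refine ⟨hx, ?_⟩
    change jetCoord r _ _ x ∈ Ω
    rw [jetCoord_eq_of_le (by omega : r ≤ R) hjet]
    exact hj hx
  exact balance_congr_of_jet hΩ hL hR hV hxV (contDiff_taylorMetric _).contDiffOn
    (contDiff_taylorMatter _).contDiffOn (hG.mono inter_subset_left) (hy.mono inter_subset_left)
    (fun z hz => hz.2) (fun z hz => hj hz.1) hjet i

end Stress

/-! ## The infinitesimal variation of the metric -/

section Lie

variable {d : ℕ} {O : Set (Base d)} {u : Base d} {φ : Base d → Base d}
  {G G' : Base d → SymArray d} {ξ ξ' : Base d → Fin (d + 1) → ℝ}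

theorem dirD_comp {V : Type*} [NormedAddCommGroup V] [NormedSpace ℝ V] {f : Base d → V}
    (hf : DifferentiableAt ℝ f (φ u)) (hφ : DifferentiableAt ℝ φ u) (v : Base d) :
    dirD v (fun z => f (φ z)) u = dirD (fderiv ℝ φ u v) f (φ u) := by
  have := (hf.hasFDerivAt.comp u hφ.hasFDerivAt).fderiv
  exact congrArg (fun l => l v) this

theorem dirD_sum_smul {V κ : Type*} [NormedAddCommGroup V] [NormedSpace ℝ V] [Fintype κ]
    (f : Base d → V) (a : κ → ℝ) (e : κ → Base d) (x : Base d) :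
    dirD (∑ k, a k • e k) f x = ∑ k, a k • dirD (e k) f x := by
  simp only [dirD, map_sum, map_smul]

theorem fderiv_bas (φ : Base d → Base d) (u : Base d) (h : Fin (d + 1)) :
    fderiv ℝ φ u (bas d h) = ∑ k, jac φ u k h • bas d k :=
  (sum_smul_bas _).symm

/-- The matrix `ξ^j_{,h}`. -/
def derivMatrix (ξ : Base d → Fin (d + 1) → ℝ) (u : Base d) :
    Matrix (Fin (d + 1)) (Fin (d + 1)) ℝ :=
  Matrix.of fun j h => dirD (bas d h) (fun z => ξ z j) u

/-- The matrix `ξ^j_{,h} g^{hk} + ξ^k_{,h} g^{jh} - g^{jk}_{,i} ξ^i`. -/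
def lieMatrix (G : Base d → SymArray d) (ξ : Base d → Fin (d + 1) → ℝ) (u : Base d) :
    Matrix (Fin (d + 1)) (Fin (d + 1)) ℝ :=
  derivMatrix ξ u * invMetric (G u) + (derivMatrix ξ u * invMetric (G u)).transpose -
    matD (∑ i, ξ u i • bas d i) (fun z => invMetric (G z)) u

theorem lieMatrix_apply (j k : Fin (d + 1)) : lieMatrix G ξ u j k =
    ∑ h, (dirD (bas d h) (fun z => ξ z j) u * invMetric (G u) h k +
      dirD (bas d h) (fun z => ξ z k) u * invMetric (G u) j h) -
    ∑ i, dirD (bas d i) (fun z => invMetric (G z) j k) u * ξ u i := by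
  have h1 : matD (∑ i, ξ u i • bas d i) (fun z => invMetric (G z)) u j k =
      ∑ i, dirD (bas d i) (fun z => invMetric (G z) j k) u * ξ u i := by
    change dirD _ _ u = _
    rw [dirD_sum_smul]
    exact Finset.sum_congr rfl fun i _ => mul_comm _ _
  rw [lieMatrix, Matrix.sub_apply, h1, Finset.sum_add_distrib, Matrix.add_apply,
    Matrix.transpose_apply, Matrix.mul_apply, Matrix.mul_apply]
  have h2 : ∑ h, derivMatrix ξ u k h * invMetric (G u) h j =
      ∑ h, dirD (bas d h) (fun z => ξ z k) u * invMetric (G u) j h :=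
    Finset.sum_congr rfl fun h _ => by rw [invMetric_comm]; rfl
  rw [h2]
  rfl

theorem dirD_jac_comm (hO : IsOpen O) (hu : u ∈ O) (hφ : ContDiffOn ℝ ∞ φ O)
    (i j h : Fin (d + 1)) :
    dirD (bas d h) (fun z => jac φ z i j) u = dirD (bas d j) (fun z => jac φ z i h) u := by
  have e (a b : Fin (d + 1)) : dirD (bas d a) (fun z => jac φ z i b) u =
      dirD (bas d a) (dirD (bas d b) φ) u i :=
    dirD_clm hO (contDiffOn_dirD hO hφ (bas d b)) (bas d a)
      (EuclideanSpace.proj i : Base d →L[ℝ] ℝ) hu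
  rw [e, e, dirD_comm hO hφ _ _ hu]

/-- Differentiation of `ξ' ∘ φ = J ξ`. By symmetry of the second derivatives of `φ`, the
inhomogeneous term is the derivative of `J` along `ξ`. -/
theorem derivMatrix_change (hO : IsOpen O) (hu : u ∈ O) (hφ : ContDiffOn ℝ ∞ φ O)
    (hξ : ∀ i, DifferentiableAt ℝ (fun z => ξ z i) u)
    (hξ' : ∀ i, DifferentiableAt ℝ (fun z => ξ' z i) (φ u))
    (h : ∀ v ∈ O, ∀ i, ξ' (φ v) i = ∑ j, jac φ v i j * ξ v j) :
    derivMatrix ξ' (φ u) * jac φ u =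
      matD (∑ i, ξ u i • bas d i) (jac φ) u + jac φ u * derivMatrix ξ u := by
  ext i k
  have h1 : (derivMatrix ξ' (φ u) * jac φ u) i k = dirD (bas d k) (fun z => ξ' (φ z) i) u := by
    rw [dirD_comp (f := fun z => ξ' z i) (hξ' i) (differentiableAt_of_contDiffOn hφ hO hu),
      fderiv_bas, dirD_sum_smul, Matrix.mul_apply]
    exact Finset.sum_congr rfl fun a _ => mul_comm _ _
  have h2 : dirD (bas d k) (fun z => ξ' (φ z) i) u =
      dirD (bas d k) (fun z => ∑ j, jac φ z i j * ξ z j) u :=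
    dirD_congr hO (fun v hv => h v hv i) _ hu
  have hJ (j) : DifferentiableAt ℝ (fun z => jac φ z i j) u :=
    differentiableAt_of_contDiffOn (contDiffOn_jac hO hφ i j) hO hu
  rw [h1, h2, dirD_fun_sum (F := fun j z => jac φ z i j * ξ z j) (fun j _ => (hJ j).mul (hξ j)), Matrix.add_apply, Matrix.mul_apply]
  have h3 : matD (∑ i, ξ u i • bas d i) (jac φ) u i k =
      ∑ j, ξ u j * dirD (bas d j) (fun z => jac φ z i k) u := by
    change dirD _ _ u = _
    rw [dirD_sum_smul]; rfl
  rw [h3, ← Finset.sum_add_distrib]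
  refine Finset.sum_congr rfl fun j _ => ?_
  rw [dirD_fun_mul (hJ j) (hξ j), dirD_jac_comm hO hu hφ i j k]
  simp only [derivMatrix, Matrix.of_apply]
  ring

/-- The infinitesimal variation of the metric is a tensor. -/
theorem lieMatrix_change (hO : IsOpen O) (hu : u ∈ O) (hφ : ContDiffOn ℝ ∞ φ O)
    (hξ : ∀ i, DifferentiableAt ℝ (fun z => ξ z i) u)
    (hξ' : ∀ i, DifferentiableAt ℝ (fun z => ξ' z i) (φ u))
    (h : ∀ v ∈ O, ∀ i, ξ' (φ v) i = ∑ j, jac φ v i j * ξ v j)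
    (hG : MatDiffAt (fun z => invMetric (G z)) u)
    (hG' : MatDiffAt (fun z => invMetric (G' z)) (φ u))
    (hGG : ∀ v ∈ O, invMetric (G' (φ v)) = jac φ v * invMetric (G v) * (jac φ v).transpose) :
    lieMatrix G' ξ' (φ u) = jac φ u * lieMatrix G ξ u * (jac φ u).transpose := by
  have hJ : MatDiffAt (jac φ) u := fun i j =>
    differentiableAt_of_contDiffOn (contDiffOn_jac hO hφ i j) hO hu
  have hX := derivMatrix_change hO hu hφ hξ hξ' h
  set w : Base d := ∑ i, ξ u i • bas d i with hw
  have hw' : fderiv ℝ φ u w = ∑ i, ξ' (φ u) i • bas d i := by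
    rw [← sum_smul_bas (fderiv ℝ φ u w)]
    refine Finset.sum_congr rfl fun i _ => ?_
    rw [jac_mulVec, h u hu i, hw]
    congr 2
    funext j
    simp only [WithLp.ofLp_sum, WithLp.ofLp_smul, Finset.sum_apply, Pi.smul_apply, bas_apply,
      smul_eq_mul, mul_ite, mul_one, mul_zero, Finset.sum_ite_eq, Finset.mem_univ, if_true]
  have hM : matD (∑ i, ξ' (φ u) i • bas d i) (fun z => invMetric (G' z)) (φ u) =
      matD w (fun z => jac φ z * invMetric (G z) * (jac φ z).transpose) u := by
    rw [← hw', ← matD_congr (M := fun z => invMetric (G' (φ z)))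
      (Filter.eventuallyEq_of_mem (hO.mem_nhds hu) hGG)]
    ext i j
    exact (dirD_comp (f := fun z => invMetric (G' z) i j) (hG' i j)
      (differentiableAt_of_contDiffOn hφ hO hu) w).symm
  have e1 : derivMatrix ξ' (φ u) * invMetric (G' (φ u)) =
      (matD w (jac φ) u + jac φ u * derivMatrix ξ u) * invMetric (G u) *
        (jac φ u).transpose := by
    rw [hGG u hu, ← hX]
    simp only [Matrix.mul_assoc]
  -- The derivatives of `J` along `ξ` coming from the derivative of `ξ'` cancel those coming from
  -- the derivative of `J g⁻¹ Jᵀ`; only the tensorial terms are left.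
  rw [lieMatrix, e1, hM, matD_mul (hJ.mul hG) hJ.transpose, matD_mul hJ hG, matD_transpose,
    lieMatrix, ← hw]
  simp only [Matrix.transpose_mul, Matrix.transpose_add, Matrix.transpose_transpose,
    invMetric_transpose, Matrix.add_mul, Matrix.mul_add, Matrix.mul_sub, Matrix.sub_mul,
    Matrix.mul_assoc]
  abel

theorem sum_mul_eq_trace {E Q : Matrix (Fin (d + 1)) (Fin (d + 1)) ℝ} (hE : E.transpose = E) :
    ∑ j, ∑ k, E j k * Q j k = (E * Q).trace := by
  rw [Finset.sum_comm]
  refine Finset.sum_congr rfl fun k _ => ?_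
  rw [Matrix.diag, Matrix.mul_apply]
  exact Finset.sum_congr rfl fun j _ => by rw [← congrFun (congrFun hE j) k, Matrix.transpose_apply]

end Lie

/-! ## The splitting -/

section Splitting

variable {d m r : ℕ} {U : Set (Base d)} {G : Base d → SymArray d} {y : Base d → Fibre m}
  {x : Base d} {Ω : Set (JetCoord d m r)} {Lag : JetCoord d m r → ℝ}
  {ξ : Base d → Fin (d + 1) → ℝ}

/-- Symmetry of `E` merges the two terms with derivatives of `ξ` into `S^j_i ξ^i_{,j}`, where `S` is
`stressM`. The Leibniz rule makes this a divergence minus a term linear in the values of `ξ`; the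
latter joins `-E_{jk} g^{jk}_{,i} ξ^i` to form the balance. -/
theorem splitting (hΩ : IsOpen Ω) (hL : ContDiffOn ℝ ∞ Lag Ω) (hU : IsOpen U) (hx : x ∈ U)
    (hG : ContDiffOn ℝ ∞ G U) (hy : ContDiffOn ℝ ∞ y U) (hj : MapsTo (jetCoord r G y) U Ω)
    (hξ : ∀ i, DifferentiableAt ℝ (fun z => ξ z i) x) :
    ∑ j, ∑ k, eulerM Lag G y x j k * lieMatrix G ξ x j k =
      -(∑ i, ξ x i * balance Lag G y x i) +
        ∑ j, dirD (bas d j) (fun z => ∑ i, stressM Lag G y z j i * ξ z i) x := by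
  set E := eulerM Lag G y x with hE
  have hEs (j k) : E j k = E k j := varDerivMetric_comm _ _ _ _ _ _
  set X : Fin (d + 1) → Fin (d + 1) → ℝ := fun j h => dirD (bas d h) (fun z => ξ z j) x with hX
  set D : Fin (d + 1) → Fin (d + 1) → Fin (d + 1) → ℝ := fun i j k =>
    dirD (bas d i) (fun z => invMetric (G z) j k) x with hD
  have hS (j i) : DifferentiableAt ℝ (fun z => stressM Lag G y z j i) x :=
    differentiableAt_of_contDiffOn (contDiffOn_stressM hΩ hL hU hG hy hj j i) hU hx
  have h1 (j) : dirD (bas d j) (fun z => ∑ i, stressM Lag G y z j i * ξ z i) x =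
      ∑ i, (dirD (bas d j) (fun z => stressM Lag G y z j i) x * ξ x i +
        stressM Lag G y x j i * X i j) := by
    rw [dirD_fun_sum (F := fun i z => stressM Lag G y z j i * ξ z i)
      fun i _ => (hS j i).mul (hξ i)]
    exact Finset.sum_congr rfl fun i _ => dirD_fun_mul (hS j i) (hξ i) _
  have h2 : ∑ i, ξ x i * balance Lag G y x i =
      ∑ j, ∑ i, dirD (bas d j) (fun z => stressM Lag G y z j i) x * ξ x i +
        ∑ i, ∑ j, ∑ k, E j k * (D i j k * ξ x i) := by
    rw [Finset.sum_comm, ← Finset.sum_add_distrib]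
    refine Finset.sum_congr rfl fun i _ => ?_
    simp only [balance, mul_add, Finset.mul_sum]
    congr 1
    · exact Finset.sum_congr rfl fun j _ => mul_comm _ _
    · exact Finset.sum_congr rfl fun j _ => Finset.sum_congr rfl fun k _ => by
        simp only [hD, hE]; ring
  have h3 : ∑ j, ∑ i, stressM Lag G y x j i * X i j =
      ∑ j, ∑ k, E j k * ∑ h, (X j h * invMetric (G x) h k + X k h * invMetric (G x) j h) := by
    have a1 : ∑ j, ∑ k, E j k * ∑ h, X j h * invMetric (G x) h k =
        ∑ h, ∑ j, ∑ k, invMetric (G x) h k * E k j * X j h := by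
      simp only [Finset.mul_sum]
      rw [Finset.sum_comm (γ := Fin (d + 1))]
      calc ∑ k, ∑ j, ∑ h, E j k * (X j h * invMetric (G x) h k)
          = ∑ k, ∑ h, ∑ j, E j k * (X j h * invMetric (G x) h k) :=
            Finset.sum_congr rfl fun k _ => Finset.sum_comm
        _ = ∑ h, ∑ k, ∑ j, E j k * (X j h * invMetric (G x) h k) := Finset.sum_comm
        _ = ∑ h, ∑ j, ∑ k, E j k * (X j h * invMetric (G x) h k) :=
            Finset.sum_congr rfl fun h _ => Finset.sum_comm
        _ = _ := Finset.sum_congr rfl fun h _ => Finset.sum_congr rfl fun j _ =>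
            Finset.sum_congr rfl fun k _ => by rw [hEs j k]; ring
    have a2 : ∑ j, ∑ k, E j k * ∑ h, X k h * invMetric (G x) j h =
        ∑ j, ∑ k, E j k * ∑ h, X j h * invMetric (G x) h k := by
      rw [Finset.sum_comm]
      refine Finset.sum_congr rfl fun k _ => Finset.sum_congr rfl fun j _ => ?_
      rw [hEs j k]
      congr 1
      exact Finset.sum_congr rfl fun h _ => by rw [invMetric_comm]
    simp only [Finset.sum_add_distrib, mul_add]
    rw [a2, a1, ← two_mul, Finset.mul_sum]
    refine Finset.sum_congr rfl fun h _ => ?_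
    rw [Finset.mul_sum]
    refine Finset.sum_congr rfl fun j _ => ?_
    rw [stressM_apply, mul_assoc, Finset.sum_mul]
  have h4 : ∑ j, ∑ k, E j k * ∑ i, D i j k * ξ x i =
      ∑ i, ∑ j, ∑ k, E j k * (D i j k * ξ x i) := by
    simp only [Finset.mul_sum]
    calc ∑ j, ∑ k, ∑ i, E j k * (D i j k * ξ x i)
        = ∑ j, ∑ i, ∑ k, E j k * (D i j k * ξ x i) :=
          Finset.sum_congr rfl fun j _ => Finset.sum_comm
      _ = _ := Finset.sum_comm
  simp only [h1, Finset.sum_add_distrib, h3, h2, ← h4, lieMatrix_apply, mul_sub,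
    Finset.sum_sub_distrib]
  simp only [hX, hD, mul_add, Finset.sum_add_distrib]
  ring

end Splitting

/-! ## Existence of the energy-momentum tensor -/

section Tensor

variable {d m r R : ℕ}
variable {X : Type*} [TopologicalSpace X] [ChartedSpace (Base d) X] [IsManifold 𝓘(ℝ, Base d) ∞ X]
variable {Y : Type*} [TopologicalSpace Y] [ChartedSpace (Base d × Fibre m) Y]
  [IsManifold 𝓘(ℝ, Base d × Fibre m) ∞ Y]
variable {o : OrientedAtlas d X} {π : Y → X} {c c' : FiberedChart (m := m) o π}
  {γ : LocalField (d := d) (m := m) π} {u : Base d} {L : JetFunction (m := m) o π r}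
  {ξ : VectorFieldX d X}

theorem multiPartial_zero {V : Type*} [NormedAddCommGroup V] [NormedSpace ℝ V] (f : Base d → V) :
    multiPartial 0 f = f := by
  rw [multiPartial_eq, multiD_zero]

theorem taylorMetric_self (p : JetCoord d m R) :
    taylorMetric p p.1 = p.2.1 (MultiIdx.nil d R) := by
  have h := multiPartial_taylor p.1 p.2.1 (MultiIdx.nil d R)
  rwa [show ((MultiIdx.nil d R).2 : Multiset (Fin (d + 1))) = 0 from rfl, multiPartial_zero] at h

theorem taylorMatter_self (p : JetCoord d m R) :
    taylorMatter p p.1 = p.2.2 (MultiIdx.nil d R) := by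
  have h := multiPartial_taylor p.1 p.2.2 (MultiIdx.nil d R)
  rwa [show ((MultiIdx.nil d R).2 : Multiset (Fin (d + 1))) = 0 from rfl, multiPartial_zero] at h

theorem jetTarget_subset :
    c.jetTarget R ⊆ {p | (p, p.1) ∈ taylorDomain R (c.jetTarget r)} := by
  intro p hp
  change (p.1, (jetCoord r _ _ p.1).2.2 (MultiIdx.nil d r)) ∈ _ ∧
    (invMetric ((jetCoord r _ _ p.1).2.1 (MultiIdx.nil d r))).det ≠ 0
  rw [jetCoord_nil_metric, jetCoord_nil_matter, taylorMetric_self, taylorMatter_self]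
  exact hp

theorem base_mem_target {p : JetCoord d m R} (hp : p ∈ c.jetTarget R) : p.1 ∈ c.base.target :=
  (c.mem_target_of_total hp.1).1

theorem contDiffOn_vectorComp_jet (i : Fin (d + 1)) :
    ContDiffOn ℝ ∞ (fun p : JetCoord d m R => vectorComp ξ c.base p.1 i) (c.jetTarget R) :=
  (contDiffOn_vectorComp c.base_mem ξ i).comp contDiffOn_fst fun _ hp => base_mem_target hp

theorem mapsTo_jet : MapsTo (jetCoord R (c.metricRep γ) (c.matterRep γ)) (c.fieldDomain γ)
    (c.jetTarget R) := fun _ hu => jet_mem hu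

open Classical in
/-- The coordinate expression of the energy-momentum tensor. -/
def stressForm (L : JetFunction (m := m) o π r) (ξ : VectorFieldX d X)
    (c : FiberedChart (m := m) o π) (p : JetCoord d m R) : Base d [⋀^Fin d]→L[ℝ] ℝ :=
  if p ∈ c.jetTarget R then
    vecForm fun j => ∑ i, jetStress (L.lagrangian c) p j i * vectorComp ξ c.base p.1 i
  else 0

open Classical in
/-- The coordinate expression of the form `ℬ(ξ)`. -/
def balanceForm (L : JetFunction (m := m) o π r) (ξ : VectorFieldX d X)
    (c : FiberedChart (m := m) o π) (p : JetCoord d m R) : Base d [⋀^Fin (d + 1)]→L[ℝ] ℝ :=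
  if p ∈ c.jetTarget R then
    (-∑ i, vectorComp ξ c.base p.1 i * jetBalance (L.lagrangian c) p i) • omegaZero d
  else 0

theorem contDiffOn_stressForm :
    ContDiffOn ℝ ∞ (stressForm (R := R) L ξ c) (c.jetTarget R) := by
  have h : ContDiffOn ℝ ∞ (fun p : JetCoord d m R => vecForm fun j =>
      ∑ i, jetStress (L.lagrangian c) p j i * vectorComp ξ c.base p.1 i) (c.jetTarget R) :=
    ContDiffOn.sum fun j _ => (ContDiffOn.sum fun i _ =>
      ((contDiffOn_jetStress (isOpen_jetTarget c) (contDiffOn_lagrangian L) j i).mono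
        jetTarget_subset).mul (contDiffOn_vectorComp_jet i)).smul contDiffOn_const
  exact h.congr fun p hp => if_pos hp

theorem contDiffOn_balanceForm :
    ContDiffOn ℝ ∞ (balanceForm (R := R) L ξ c) (c.jetTarget R) := by
  have h : ContDiffOn ℝ ∞ (fun p : JetCoord d m R =>
      (-∑ i, vectorComp ξ c.base p.1 i * jetBalance (L.lagrangian c) p i) • omegaZero d)
      (c.jetTarget R) :=
    (ContDiffOn.sum fun i _ => (contDiffOn_vectorComp_jet i).mul
      ((contDiffOn_jetBalance (isOpen_jetTarget c) (contDiffOn_lagrangian L) i).mono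
        jetTarget_subset)).neg.smul contDiffOn_const
  exact h.congr fun p hp => if_pos hp

/-- The energy-momentum density along a field. -/
def stressMatrix (L : JetFunction (m := m) o π r) (c : FiberedChart (m := m) o π)
    (γ : LocalField (d := d) (m := m) π) (u : Base d) : Matrix (Fin (d + 1)) (Fin (d + 1)) ℝ :=
  (2 : ℝ) • (invMetric (c.metricRep γ u) * eulerMatrix L c γ u)

theorem jetStress_jet (hR : 2 * r ≤ R) (hu : u ∈ c.fieldDomain γ) :
    jetStress (L.lagrangian c) (c.jet R γ u) = stressMatrix L c γ u :=
  jetStress_jetCoord (isOpen_jetTarget c) (contDiffOn_lagrangian L) hR (isOpen_fieldDomain γ) hu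
    contDiffOn_metricRep contDiffOn_matterRep (jet_mem hu)

theorem stressForm_jet (hR : 2 * r ≤ R) (hu : u ∈ c.fieldDomain γ) :
    stressForm L ξ c (c.jet R γ u) =
      vecForm fun j => ∑ i, stressMatrix L c γ u j i * vectorComp ξ c.base u i := by
  rw [stressForm, if_pos (jet_mem hu), jetStress_jet hR hu]
  rfl

theorem balanceForm_jet (hR : 2 * r + 1 ≤ R) (hu : u ∈ c.fieldDomain γ) :
    balanceForm L ξ c (c.jet R γ u) = (-∑ i, vectorComp ξ c.base u i *
      balance (L.lagrangian c) (c.metricRep γ) (c.matterRep γ) u i) • omegaZero d := by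
  rw [balanceForm, if_pos (jet_mem hu)]
  congr 2
  refine Finset.sum_congr rfl fun i _ => ?_
  rw [FiberedChart.jet, jetBalance_jetCoord (isOpen_jetTarget c) (contDiffOn_lagrangian L) hR
    (isOpen_fieldDomain γ) hu contDiffOn_metricRep contDiffOn_matterRep mapsTo_jet]
  rfl

theorem contDiffOn_stressMatrix (j i : Fin (d + 1)) :
    ContDiffOn ℝ ∞ (fun v => stressMatrix L c γ v j i) (c.fieldDomain γ) :=
  contDiffOn_stressM (isOpen_jetTarget c) (contDiffOn_lagrangian L) (isOpen_fieldDomain γ)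
    contDiffOn_metricRep contDiffOn_matterRep mapsTo_jet j i

theorem differentiableAt_vectorComp (hu : u ∈ c.fieldDomain γ) (i : Fin (d + 1)) :
    DifferentiableAt ℝ (fun z => vectorComp ξ c.base z i) u :=
  differentiableAt_of_contDiffOn (contDiffOn_vectorComp c.base_mem ξ i) c.base.open_target hu.1

theorem evolutionary_eq (j k : Fin (d + 1)) : evolutionary c γ ξ u j k =
    lieMatrix (c.metricRep γ) (vectorComp ξ c.base) u j k :=
  (lieMatrix_apply j k).symm

theorem contractedSource_eq_splitting (hu : u ∈ c.fieldDomain γ) :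
    contractedSource L c γ ξ u = balanceForm L ξ c (c.jet (2 * r + 1) γ u) +
      extDeriv (fun v => stressForm L ξ c (c.jet (2 * r) γ v)) u := by
  have h1 : (fun v => stressForm L ξ c (c.jet (2 * r) γ v)) =ᶠ[𝓝 u] fun v =>
      vecForm fun j => ∑ i, stressMatrix L c γ v j i * vectorComp ξ c.base v i := by
    filter_upwards [(isOpen_fieldDomain γ).mem_nhds hu] with v hv
    exact stressForm_jet le_rfl hv
  have h2 (j i) : DifferentiableAt ℝ (fun v => stressMatrix L c γ v j i) u :=
    differentiableAt_of_contDiffOn (contDiffOn_stressMatrix j i) (isOpen_fieldDomain γ) hu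
  rw [balanceForm_jet le_rfl hu, h1.extDeriv_eq, extDeriv_vecForm (V := fun v j =>
      ∑ i, stressMatrix L c γ v j i * vectorComp ξ c.base v i) fun j =>
    DifferentiableAt.fun_sum fun i _ => (h2 j i).mul (differentiableAt_vectorComp hu i),
    ← add_smul]
  have h3 := splitting (isOpen_jetTarget c) (contDiffOn_lagrangian L) (isOpen_fieldDomain γ) hu
    contDiffOn_metricRep contDiffOn_matterRep mapsTo_jet
    (ξ := vectorComp ξ c.base) (differentiableAt_vectorComp hu)
  rw [contractedSource]
  congr 1
  simp only [evolutionary_eq]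
  exact h3

theorem stressMatrix_change (hu : u ∈ overlap c c' γ) :
    (jac (c.change c') u).det • (stressMatrix L c' γ (c.change c' u) * jac (c.change c') u) =
      jac (c.change c') u * stressMatrix L c γ u := by
  rw [stressMatrix, stressMatrix, metricRep_change hu, eulerMatrix_change L hu]
  simp only [Matrix.mul_smul, Matrix.smul_mul, Matrix.mul_assoc]
  rw [smul_comm]

theorem stressForm_change (hR : 2 * r ≤ R) (hu : u ∈ overlap c c' γ) :
    stressForm L ξ c (c.jet R γ u) =
      (stressForm L ξ c' (c'.jet R γ (c.change c' u))).compContinuousLinearMap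
        (fderiv ℝ (c.change c') u) := by
  rw [stressForm_jet hR (overlap_subset hu), stressForm_jet hR (overlap_subset (change_mem hu))]
  symm
  refine vecForm_comp ?_ (by rw [← det_jac]; exact (det_jac_change_pos hu).ne')
  rw [← sum_smul_bas (fderiv ℝ (c.change c') u _)]
  refine Finset.sum_congr rfl fun j _ => ?_
  congr 1
  rw [jac_mulVec, ← det_jac]
  have h1 (k) : (∑ j, (∑ i, stressMatrix L c γ u j i * vectorComp ξ c.base u i) • bas d j) k =
      ∑ i, stressMatrix L c γ u k i * vectorComp ξ c.base u i := by
    simp only [WithLp.ofLp_sum, WithLp.ofLp_smul, Finset.sum_apply, Pi.smul_apply, bas_apply,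
      smul_eq_mul, mul_ite, mul_one, mul_zero, Finset.sum_ite_eq, Finset.mem_univ, if_true]
  simp only [h1, vectorComp_change hu]
  have h2 (i) : (jac (c.change c') u).det * ∑ k, stressMatrix L c' γ (c.change c' u) j k *
      jac (c.change c') u k i = ∑ k, jac (c.change c') u j k * stressMatrix L c γ u k i := by
    have := congrFun (congrFun (stressMatrix_change (L := L) hu) j) i
    rwa [Matrix.smul_apply, Matrix.mul_apply, Matrix.mul_apply, smul_eq_mul] at this
  calc (jac (c.change c') u).det * ∑ i, stressMatrix L c' γ (c.change c' u) j i *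
        ∑ k, jac (c.change c') u i k * vectorComp ξ c.base u k
      = ∑ k, ((jac (c.change c') u).det * ∑ i, stressMatrix L c' γ (c.change c' u) j i *
        jac (c.change c') u i k) * vectorComp ξ c.base u k := by
        simp only [Finset.mul_sum, Finset.sum_mul]
        rw [Finset.sum_comm]
        exact Finset.sum_congr rfl fun k _ => Finset.sum_congr rfl fun i _ => by ring
    _ = _ := by
        simp only [h2, Finset.sum_mul, Finset.mul_sum]
        rw [Finset.sum_comm]
        exact Finset.sum_congr rfl fun k _ => Finset.sum_congr rfl fun i _ => by ring

theorem contractedSource_eq_trace : contractedSource L c γ ξ u =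
    (eulerMatrix L c γ u * lieMatrix (c.metricRep γ) (vectorComp ξ c.base) u).trace •
      omegaZero d := by
  rw [contractedSource, ← sum_mul_eq_trace (eulerMatrix_transpose L)]
  simp only [evolutionary_eq]
  rfl

/-- The Euler-Lagrange matrix is a covariant tensor density and the variation of the metric a
contravariant tensor, so the trace of their product is a scalar density. -/
theorem contractedSource_change (hu : u ∈ overlap c c' γ) :
    contractedSource L c γ ξ u =
      (contractedSource L c' γ ξ (c.change c' u)).compContinuousLinearMap
        (fderiv ℝ (c.change c') u) := by
  have hd (c : FiberedChart (m := m) o π) {u} (hu : u ∈ c.fieldDomain γ) :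
      MatDiffAt (fun z => invMetric (c.metricRep γ z)) u := fun i j =>
    differentiableAt_of_contDiffOn (contDiffOn_invMetric_apply contDiffOn_metricRep i j)
      (isOpen_fieldDomain γ) hu
  have h1 := lieMatrix_change isOpen_overlap hu contDiffOn_change
    (differentiableAt_vectorComp (ξ := ξ) (overlap_subset hu))
    (differentiableAt_vectorComp (ξ := ξ) (overlap_subset (change_mem hu)))
    (fun v hv i => vectorComp_change hv ξ i) (hd c (overlap_subset hu))
    (hd c' (overlap_subset (change_mem hu))) (fun v hv => metricRep_change hv)
  have h2 (a : ℝ) (A : Base d →L[ℝ] Base d) : (a • omegaZero d).compContinuousLinearMap A =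
      (a * A.det) • omegaZero d := by
    rw [mul_smul, ← omegaZero_comp]
    rfl
  rw [contractedSource_eq_trace, contractedSource_eq_trace, h2, h1, eulerMatrix_change L hu,
    ← det_jac]
  congr 1
  rw [Matrix.smul_mul, Matrix.trace_smul, smul_eq_mul, mul_comm]
  congr 1
  rw [Matrix.mul_assoc, Matrix.mul_assoc, Matrix.trace_mul_comm, Matrix.mul_assoc]

/-- The form `ℬ(ξ)` is the difference of the contracted source and of the exterior derivative of
`𝒯(ξ)`, both of which are natural. No transformation law for `balance` has to be computed. -/
theorem balanceForm_change (hu : u ∈ overlap c c' γ) :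
    balanceForm L ξ c (c.jet (2 * r + 1) γ u) =
      (balanceForm L ξ c' (c'.jet (2 * r + 1) γ (c.change c' u))).compContinuousLinearMap
        (fderiv ℝ (c.change c') u) := by
  have hu' := change_mem hu
  have h1 := contractedSource_eq_splitting (L := L) (ξ := ξ) (overlap_subset hu)
  have h2 := contractedSource_eq_splitting (L := L) (ξ := ξ) (overlap_subset hu')
  have h3 : (fun v => stressForm L ξ c (c.jet (2 * r) γ v)) =ᶠ[𝓝 u] fun v =>
      (stressForm L ξ c' (c'.jet (2 * r) γ (c.change c' v))).compContinuousLinearMap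
        (fderiv ℝ (c.change c') v) := by
    filter_upwards [isOpen_overlap.mem_nhds hu] with v hv
    exact stressForm_change le_rfl hv
  have h4 : DifferentiableAt ℝ (fun v => stressForm L ξ c' (c'.jet (2 * r) γ v))
      (c.change c' u) := by
    refine differentiableAt_of_contDiffOn (U := c'.fieldDomain γ) ?_ (isOpen_fieldDomain γ)
      (overlap_subset hu')
    exact contDiffOn_stressForm.comp contDiffOn_jet fun v hv => jet_mem hv
  rw [h3.extDeriv_eq, extDeriv_pullback (r := ∞) h4
    (contDiffOn_change.contDiffAt (isOpen_overlap.mem_nhds hu)) (by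
      rw [minSmoothness_of_isRCLikeNormedField]; exact WithTop.coe_le_coe.2 le_top),
    contractedSource_change hu, h2] at h1
  ext v
  have h5 := congrArg (fun f => f v) h1
  exact (add_right_cancel h5).symm

/-- The energy-momentum tensor of `λ = L dV_g`. -/
def energyMomentum (L : JetFunction (m := m) o π r) (ξ : VectorFieldX d X) :
    HorizontalForm (m := m) o π d (2 * r) where
  expr := stressForm L ξ
  smooth _ := contDiffOn_stressForm
  eq_zero _ _ hq := if_neg hq
  compat c c' γ := (compat_iff (P := fun u v => stressForm L ξ c (c.jet (2 * r) γ u) =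
    (stressForm L ξ c' (c'.jet (2 * r) γ v)).compContinuousLinearMap
      (fderiv ℝ (c.change c') u))).2 fun _ hu => stressForm_change le_rfl hu

/-- The form `ℬ(ξ)` of the splitting. -/
def energyBalance (L : JetFunction (m := m) o π r) (ξ : VectorFieldX d X) :
    HorizontalForm (m := m) o π (d + 1) (2 * r + 1) where
  expr := balanceForm L ξ
  smooth _ := contDiffOn_balanceForm
  eq_zero _ _ hq := if_neg hq
  compat c c' γ := (compat_iff (P := fun u v => balanceForm L ξ c (c.jet (2 * r + 1) γ u) =
    (balanceForm L ξ c' (c'.jet (2 * r + 1) γ v)).compContinuousLinearMap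
      (fderiv ℝ (c.change c') u))).2 fun _ hu => balanceForm_change hu

theorem vectorComp_add (ξ η : VectorFieldX d X) (e : OpenPartialHomeomorph X (Base d))
    (u : Base d) (i : Fin (d + 1)) :
    vectorComp (ξ + η) e u i = vectorComp ξ e u i + vectorComp η e u i :=
  map_add (coframe e (e.symm u) i) _ _

theorem vectorComp_smul {f : X → ℝ} {ξ η : VectorFieldX d X} (h : ∀ x, η x = f x • ξ x)
    (e : OpenPartialHomeomorph X (Base d)) (u : Base d) (i : Fin (d + 1)) :
    vectorComp η e u i = f (e.symm u) * vectorComp ξ e u i := by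
  rw [vectorComp, h, map_smul]
  rfl

theorem isFunctionLinear_energyMomentum : IsFunctionLinear (energyMomentum L) := by
  refine ⟨fun ξ η c q => ?_, fun f ξ η h c q hq => ?_⟩
  · by_cases hq : q ∈ c.jetTarget (2 * r)
    · simp only [energyMomentum, stressForm, if_pos hq, vectorComp_add, mul_add,
        Finset.sum_add_distrib, vecForm, add_smul]
    · simp only [energyMomentum, stressForm, if_neg hq, add_zero]
  · simp only [energyMomentum, stressForm, if_pos hq, vectorComp_smul h, vecForm, Finset.smul_sum,
      smul_smul, Finset.mul_sum, mul_left_comm]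

theorem isFunctionLinear_energyBalance : IsFunctionLinear (energyBalance L) := by
  refine ⟨fun ξ η c q => ?_, fun f ξ η h c q hq => ?_⟩
  · by_cases hq : q ∈ c.jetTarget (2 * r + 1)
    · simp only [energyBalance, balanceForm, if_pos hq, vectorComp_add, add_mul,
        Finset.sum_add_distrib, neg_add, add_smul]
    · simp only [energyBalance, balanceForm, if_neg hq, add_zero]
  · simp only [energyBalance, balanceForm, if_pos hq, vectorComp_smul h, smul_smul, mul_neg,
      Finset.mul_sum, mul_assoc]

theorem isEnergyMomentumTensor_energyMomentum : IsEnergyMomentumTensor L (energyMomentum L) :=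
  ⟨isFunctionLinear_energyMomentum, energyBalance L, isFunctionLinear_energyBalance,
    fun _ _ _ _ hu => contractedSource_eq_splitting hu⟩

end Tensor

/-! ## Uniqueness of the energy-momentum tensor -/

section Uniqueness

variable {d m r R : ℕ}
variable {X : Type*} [TopologicalSpace X] [ChartedSpace (Base d) X] [IsManifold 𝓘(ℝ, Base d) ∞ X]
variable {Y : Type*} [TopologicalSpace Y] [ChartedSpace (Base d × Fibre m) Y]
  [IsManifold 𝓘(ℝ, Base d × Fibre m) ∞ Y]
variable {o : OrientedAtlas d X} {π : Y → X} {c : FiberedChart (m := m) o π}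
  {γ : LocalField (d := d) (m := m) π} {u : Base d} {L : JetFunction (m := m) o π r}
  {ξ : VectorFieldX d X}

/-- Every jet is the jet of a local field. -/
theorem exists_localField_of_jet {p : JetCoord d m R} (hp : p ∈ c.jetTarget R) :
    ∃ γ : LocalField (d := d) (m := m) π, p.1 ∈ c.fieldDomain γ ∧ c.jet R γ p.1 = p := by
  have hV : IsOpen {x | (p, x) ∈ taylorDomain R (c.jetTarget R)} :=
    isOpen_slice (isOpen_taylorDomain (isOpen_jetTarget c)) p
  have hmem : ∀ x ∈ {x | (p, x) ∈ taylorDomain R (c.jetTarget R)},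
      (x, taylorMatter p x) ∈ c.total.target ∧ (invMetric (taylorMetric p x)).det ≠ 0 := by
    intro x hx
    have h : (x, (jetCoord R (taylorMetric p) (taylorMatter p) x).2.2 (MultiIdx.nil d R)) ∈
        c.total.target ∧ (invMetric ((jetCoord R (taylorMetric p) (taylorMatter p) x).2.1
          (MultiIdx.nil d R))).det ≠ 0 := hx
    rwa [jetCoord_nil_metric, jetCoord_nil_matter] at h
  obtain ⟨γ, h1, h2, h3, -, -⟩ := exists_localField c hV (contDiff_taylorMetric p).contDiffOn
    (contDiff_taylorMatter p).contDiffOn (fun x hx => (hmem x hx).2) fun x hx => (hmem x hx).1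
  have hp' : p.1 ∈ {x | (p, x) ∈ taylorDomain R (c.jetTarget R)} := jetTarget_subset hp
  refine ⟨γ, h1 ▸ hp', ?_⟩
  rw [FiberedChart.jet, jetCoord_congr hV h2 h3 hp', jetCoord_taylor]

/-- The coordinate centred at `u` times a bump function equal to `1` at `u`: its differential at `u`
is `dx^a`. -/
theorem exists_test_coordinate {U : Set (Base d)} (hU : IsOpen U) (hu : u ∈ U) (a : Fin (d + 1)) :
    ∃ f : Base d → ℝ, IsTest U f ∧ f u = 0 ∧ ∀ v, fderiv ℝ f u v = v a := by
  obtain ⟨b, hb1, hb2, hb3, -, hb5⟩ := exists_contDiff_tsupport_subset (n := (⊤ : ℕ∞))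
    (hU.mem_nhds hu)
  have hb : IsTest U b := ⟨hb3, hb2, hb1⟩
  have hl : ContDiff ℝ ∞ fun v : Base d => v a - u a := by fun_prop
  refine ⟨fun v => (v a - u a) • b v, hb.smul hU hl.contDiffOn, by simp, fun v => ?_⟩
  have h1 : HasFDerivAt (fun v : Base d => v a - u a)
      (EuclideanSpace.proj a : Base d →L[ℝ] ℝ) u :=
    ((EuclideanSpace.proj a : Base d →L[ℝ] ℝ).hasFDerivAt).sub_const _
  have h2 : HasFDerivAt (fun v : Base d => (v a - u a) • b v) _ u :=
    h1.smul (hb3.differentiable (by simp) u).hasFDerivAt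
  rw [h2.fderiv]
  simp [hb5]

variable [T2Space X]

/-- Take `f` vanishing at the point with `df = dx^a`. By function linearity `ℬ(f ξ)` vanishes there
and the exterior derivative reduces to `dx^a ∧ 𝒯(ξ)`, while the left side of the splitting does not
involve `𝒯`. Letting `a` vary determines `𝒯(ξ)`. -/
theorem expr_eq_of_splitting {𝒯 𝒯' : VectorFieldX d X → HorizontalForm (m := m) o π d (2 * r)}
    (h : IsEnergyMomentumTensor L 𝒯) (h' : IsEnergyMomentumTensor L 𝒯')
    (hu : u ∈ c.fieldDomain γ) :
    (𝒯 ξ).expr c (c.jet (2 * r) γ u) = (𝒯' ξ).expr c (c.jet (2 * r) γ u) := by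
  have hsm (𝒮 : VectorFieldX d X → HorizontalForm (m := m) o π d (2 * r)) :
      DifferentiableAt ℝ (fun v => (𝒮 ξ).expr c (c.jet (2 * r) γ v)) u :=
    differentiableAt_of_contDiffOn (U := c.fieldDomain γ)
      (((𝒮 ξ).smooth c).comp contDiffOn_jet fun v hv => jet_mem hv) (isOpen_fieldDomain γ) hu
  rw [← sub_eq_zero]
  refine form_eq_zero fun a v => ?_
  obtain ⟨η, hη, hη0, hηd⟩ := exists_test_coordinate c.base.open_target hu.1 a
  obtain ⟨f, hf⟩ := exists_function c.base_mem hη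
  obtain ⟨ζ, hζ⟩ := exists_smul f ξ
  have hfu : ∀ w ∈ c.fieldDomain γ, f (c.base.symm w) = η w := fun w hw => by
    rw [hf _ (c.base.map_target hw.1), c.base.right_inv hw.1]
  have key {𝒮 : VectorFieldX d X → HorizontalForm (m := m) o π d (2 * r)}
      (hS : IsEnergyMomentumTensor L 𝒮) : contractedSource L c γ ζ u v =
      ∑ i : Fin (d + 1), (-1) ^ (i : ℕ) *
        (v i a * (𝒮 ξ).expr c (c.jet (2 * r) γ u) (i.removeNth v)) := by
    obtain ⟨hlin, ℬ, hB, hsplit⟩ := hS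
    have h1 : (ℬ ζ).expr c (c.jet (2 * r + 1) γ u) = 0 := by
      rw [hB.2 f ξ ζ hζ c _ (jet_mem hu)]
      change f (c.base.symm u) • _ = _
      rw [hfu u hu, hη0, zero_smul]
    have h2 : (fun w => (𝒮 ζ).expr c (c.jet (2 * r) γ w)) =ᶠ[𝓝 u]
        fun w => η w • (𝒮 ξ).expr c (c.jet (2 * r) γ w) := by
      filter_upwards [(isOpen_fieldDomain γ).mem_nhds hu] with w hw
      rw [hlin.2 f ξ ζ hζ c _ (jet_mem hw), ← hfu w hw]
      rfl
    rw [hsplit ζ c γ u hu, h1, zero_add, h2.extDeriv_eq, extDeriv_smul_of_eq_zero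
      (hη.contDiff.differentiable (by simp) u) (hsm 𝒮) hη0]
    simp only [hηd]
  have h3 := (key h).symm.trans (key h')
  rw [← sub_eq_zero, ← Finset.sum_sub_distrib] at h3
  rw [← h3]
  exact Finset.sum_congr rfl fun i _ => by
    rw [ContinuousAlternatingMap.sub_apply]; ring

theorem IsEnergyMomentumTensor.unique
    {𝒯 𝒯' : VectorFieldX d X → HorizontalForm (m := m) o π d (2 * r)}
    (h : IsEnergyMomentumTensor L 𝒯) (h' : IsEnergyMomentumTensor L 𝒯') : 𝒯 = 𝒯' := by
  funext ξ
  refine HorizontalForm.ext (funext fun c => funext fun p => ?_)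
  by_cases hp : p ∈ c.jetTarget (2 * r)
  · obtain ⟨γ, hu, hγ⟩ := exists_localField_of_jet hp
    rw [← hγ]
    exact expr_eq_of_splitting h h' hu
  · rw [(𝒯 ξ).eq_zero c p hp, (𝒯' ξ).eq_zero c p hp]

end Uniqueness

/-! ## Isotopies of `ℝⁿ` with compact support -/

section Isotopy

variable {d : ℕ} {η : Base d → Base d}

/-- A smooth family of diffeomorphisms of `ℝⁿ`, starting from the identity with velocity `η`,
supported in the support of `η` and preserving the orientation. -/
structure Isotopy (η : Base d → Base d) where
  map : ℝ × Base d → Base d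
  inv : ℝ × Base d → Base d
  contDiff_map : ContDiff ℝ ∞ map
  contDiff_inv : ContDiff ℝ ∞ inv
  inv_map : ∀ t u, inv (t, map (t, u)) = u
  map_inv : ∀ t u, map (t, inv (t, u)) = u
  map_of_notMem : ∀ t, ∀ u ∉ tsupport η, map (t, u) = u
  map_zero : ∀ u, map (0, u) = u
  hasDerivAt_map : ∀ u, HasDerivAt (fun t => map (t, u)) (η u) 0
  det_pos : ∀ t u, 0 < (fderiv ℝ (fun z => map (t, z)) u).det

section General

variable {E : Type*} [NormedAddCommGroup E] [NormedSpace ℝ E]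

theorem eq_zero_of_add_eq_zero {A : E →L[ℝ] E} (hA : ‖A‖ ≤ 1 / 2) {v : E} (h : v + A v = 0) :
    v = 0 := by
  have h1 : ‖v‖ = ‖A v‖ := (congrArg _ (eq_neg_of_add_eq_zero_left h)).trans (norm_neg _)
  have h2 := A.le_of_opNorm_le hA v
  have h3 : ‖v‖ = 0 := by linarith [norm_nonneg v]
  exact norm_eq_zero.1 h3

/-- Along the segment from the identity to `1 + A` every map is injective, so the determinant, which
starts at `1`, cannot change sign. -/
theorem det_one_add_pos [FiniteDimensional ℝ E] {A : E →L[ℝ] E} (hA : ‖A‖ ≤ 1 / 2) :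
    0 < (ContinuousLinearMap.id ℝ E + A).det := by
  set f : ℝ → ℝ := fun a => (ContinuousLinearMap.id ℝ E + a • A).det with hf
  have hc : Continuous f := ContinuousLinearMap.continuous_det.comp (by fun_prop)
  have h0 : f 0 = 1 := by
    simp only [hf, zero_smul, add_zero]
    exact LinearMap.det_id
  have h1 : ∀ a ∈ Icc (0 : ℝ) 1, f a ≠ 0 := by
    intro a ha h
    have hk := LinearMap.bot_lt_ker_of_det_eq_zero
      (f := ((ContinuousLinearMap.id ℝ E + a • A : E →L[ℝ] E) : E →ₗ[ℝ] E)) h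
    obtain ⟨v, hv, hv0⟩ := Submodule.exists_mem_ne_zero_of_ne_bot hk.ne'
    refine hv0 (eq_zero_of_add_eq_zero (A := a • A) ?_ hv)
    rw [norm_smul, Real.norm_eq_abs, abs_of_nonneg ha.1]
    nlinarith [ha.2, norm_nonneg A, ha.1]
  have h2 : f 1 = (ContinuousLinearMap.id ℝ E + A).det := by simp only [hf, one_smul]
  rw [← h2]
  by_contra hneg
  obtain ⟨a, ha, ha0⟩ := intermediate_value_Icc' zero_le_one hc.continuousOn
    (show (0 : ℝ) ∈ Icc (f 1) (f 0) from ⟨not_lt.1 hneg, by rw [h0]; exact zero_le_one⟩)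
  exact h1 a ha ha0

/-- The inverse of a bijective smooth map with injective derivatives is smooth. -/
theorem contDiff_inverse [FiniteDimensional ℝ E] [CompleteSpace E] {f g : E → E}
    (hf : ContDiff ℝ ∞ f) (hgf : ∀ x, g (f x) = x) (hfg : ∀ x, f (g x) = x)
    (h : ∀ x v, fderiv ℝ f x v = 0 → v = 0) : ContDiff ℝ ∞ g := by
  rw [contDiff_iff_contDiffAt]
  intro y
  set x := g y with hx
  set A : E ≃L[ℝ] E := (LinearEquiv.ofInjectiveEndo (fderiv ℝ f x : E →ₗ[ℝ] E)
    ((injective_iff_map_eq_zero _).2 fun v hv => h x v hv)).toContinuousLinearEquiv with hA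
  have hfA : HasFDerivAt f (A : E →L[ℝ] E) x := by
    have : (A : E →L[ℝ] E) = fderiv ℝ f x := by
      ext v
      rfl
    rw [this]
    exact (hf.differentiable (by simp) x).hasFDerivAt
  have hloc := hf.contDiffAt.to_localInverse hfA (by simp)
  rw [hfg] at hloc
  refine hloc.congr_of_eventuallyEq ?_
  have hev := (hf.contDiffAt.hasStrictFDerivAt' hfA (by simp)).eventually_right_inverse
  rw [hfg] at hev
  filter_upwards [hev] with z hz
  conv_lhs => rw [← hz]
  exact hgf _

end General

/-- Only the velocity at time zero is used later, so no flow is integrated: the family is `u + ε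
sin(t/ε) η(u)`. The bounded sine makes it a contractive perturbation of the identity for all times,
and its derivative at `0` is `1`. -/
theorem exists_isotopy (hc : HasCompactSupport η) (hη : ContDiff ℝ ∞ η) :
    Nonempty (Isotopy η) := by
  obtain ⟨C, hC⟩ := hη.lipschitzWith_of_hasCompactSupport hc (by simp)
  -- Chosen so that `ε` times the Lipschitz constant of `η` is at most `1/2`; adding `1` to `C`
  -- covers `C = 0`.
  set ε : ℝ := 1 / (2 * (C + 1)) with hε
  have hC0 : (0 : ℝ) ≤ C := C.2
  have hεp : 0 < ε := by positivity
  have hεC : ε * C ≤ 1 / 2 := by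
    rw [hε, div_mul_eq_mul_div, div_le_div_iff₀ (by positivity) (by norm_num)]
    linarith
  set s : ℝ → ℝ := fun t => ε * Real.sin (t / ε) with hs
  have hsc : ContDiff ℝ ∞ s := contDiff_const.mul (Real.contDiff_sin.comp (by fun_prop))
  have hs1 (t) : |s t| * C ≤ 1 / 2 := by
    refine le_trans (mul_le_mul_of_nonneg_right ?_ hC0) hεC
    rw [hs, abs_mul, abs_of_pos hεp]
    exact mul_le_of_le_one_right hεp.le (Real.abs_sin_le_one _)
  have hs0 : s 0 = 0 := by simp [hs]
  have hsd : HasDerivAt s 1 0 := by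
    have h1 := ((Real.hasDerivAt_sin (0 / ε)).comp (0 : ℝ)
      ((hasDerivAt_id (0 : ℝ)).div_const ε)).const_mul ε
    refine h1.congr_deriv ?_
    simp [hεp.ne']
  have hD (t) (u : Base d) : ‖s t • fderiv ℝ η u‖ ≤ 1 / 2 := by
    rw [norm_smul, Real.norm_eq_abs]
    exact (mul_le_mul_of_nonneg_left (norm_fderiv_le_of_lipschitz ℝ hC) (abs_nonneg _)).trans
      (hs1 t)
  have hηd (u) : HasFDerivAt η (fderiv ℝ η u) u := (hη.differentiable (by simp) u).hasFDerivAt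
  set F : ℝ × Base d → Base d := fun p => p.2 + s p.1 • η p.2 with hF
  have hFc : ContDiff ℝ ∞ F := by
    have h1 : ContDiff ℝ ∞ fun p : ℝ × Base d => s p.1 • η p.2 :=
      (hsc.comp contDiff_fst).smul (hη.comp contDiff_snd)
    exact contDiff_snd.add h1
  have hFd (t) (u : Base d) : HasFDerivAt (fun z => F (t, z))
      (ContinuousLinearMap.id ℝ (Base d) + s t • fderiv ℝ η u) u :=
    (hasFDerivAt_id u).add ((hηd u).const_smul (s t))
  have hLip (t) : LipschitzWith (1 / 2) fun u => s t • η u := by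
    refine LipschitzWith.of_dist_le_mul fun u v => ?_
    rw [dist_eq_norm, ← smul_sub, norm_smul, Real.norm_eq_abs]
    have h1 := hC.dist_le_mul u v
    rw [dist_eq_norm (η u)] at h1
    have h2 := mul_le_mul_of_nonneg_left h1 (abs_nonneg (s t))
    have h3 := mul_le_mul_of_nonneg_right (hs1 t) (dist_nonneg (x := u) (y := v))
    push_cast
    linarith
  have hinj (t) : Function.Injective fun u => F (t, u) := by
    intro u v huv
    have h1 : u - v = s t • η v - s t • η u := by
      have : u + s t • η u = v + s t • η v := huv
      rw [sub_eq_sub_iff_add_eq_add, this, add_comm]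
    have h2 := (hLip t).dist_le_mul v u
    rw [dist_eq_norm, ← h1, dist_comm, dist_eq_norm] at h2
    push_cast at h2
    have h3 : ‖u - v‖ = 0 := by linarith [norm_nonneg (u - v)]
    exact sub_eq_zero.1 (norm_eq_zero.1 h3)
  have hsurj (t) : Function.Surjective fun u => F (t, u) := by
    intro w
    -- A preimage of `w` is a fixed point of this contraction.
    have hcon : ContractingWith (1 / 2) fun u => w - s t • η u := by
      refine ⟨by rw [div_lt_one] <;> norm_num, LipschitzWith.of_dist_le_mul fun u v => ?_⟩
      rw [dist_sub_left]
      exact (hLip t).dist_le_mul u v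
    refine ⟨hcon.fixedPoint _, ?_⟩
    have h1 : w - s t • η (hcon.fixedPoint _) = hcon.fixedPoint _ := hcon.fixedPoint_isFixedPt
    exact (sub_eq_iff_eq_add.1 h1).symm
  choose P hP using hsurj
  have hPF (t) (u) : P t (F (t, u)) = u := hinj t (hP t _)
  -- Joint smoothness of the inverses in time and point comes from the inverse function theorem for
  -- `(t, u) ↦ (t, F(t, u))`.
  have hPc : ContDiff ℝ ∞ fun p : ℝ × Base d => (p.1, P p.1 p.2) := by
    refine contDiff_inverse (f := fun p : ℝ × Base d => (p.1, F p)) (contDiff_fst.prodMk hFc)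
      (fun p => Prod.ext rfl (hPF p.1 p.2)) (fun p => Prod.ext rfl (hP p.1 p.2)) fun p v hv => ?_
    have hFp := hFc.differentiable (by simp) p
    rw [(hasFDerivAt_fst.prodMk hFp.hasFDerivAt).fderiv] at hv
    have h1 : v.1 = 0 := congrArg Prod.fst hv
    have h2 : fderiv ℝ F p v = 0 := congrArg Prod.snd hv
    have h3 : HasFDerivAt (fun z => F (p.1, z))
        ((fderiv ℝ F p).comp (ContinuousLinearMap.inr ℝ ℝ (Base d))) p.2 := by
      have hr : HasFDerivAt (fun z : Base d => (p.1, z)) (ContinuousLinearMap.inr ℝ ℝ (Base d))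
        p.2 := hasFDerivAt_prodMk_right p.1 p.2
      exact HasFDerivAt.comp (g := F) p.2 hFp.hasFDerivAt hr
    have h4 : v = (0, v.2) := Prod.ext h1 rfl
    have h5 := congrArg (fun l => l v.2) (h3.unique (hFd p.1 p.2))
    rw [h4] at h2
    have h6 : v.2 + (s p.1 • fderiv ℝ η p.2) v.2 = 0 := by
      rw [← h2]
      exact h5.symm
    rw [h4, eq_zero_of_add_eq_zero (hD _ _) h6]
    rfl
  exact ⟨{ map := F
           inv := fun p => P p.1 p.2
           contDiff_map := hFc
           contDiff_inv := contDiff_snd.comp hPc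
           inv_map := hPF
           map_inv := fun t u => hP t u
           map_of_notMem := fun t u hu => by
             simp only [hF, image_eq_zero_of_notMem_tsupport hu, smul_zero, add_zero]
           map_zero := fun u => by simp only [hF, hs0, zero_smul, add_zero]
           hasDerivAt_map := fun u => by
             have h1 := (hsd.smul_const (η u)).const_add u
             rwa [one_smul] at h1
           det_pos := fun t u => by
             rw [(hFd t u).fderiv]
             exact det_one_add_pos (hD t u) }⟩

namespace Isotopy

variable (I : Isotopy η)

theorem inv_of_notMem (t : ℝ) {u : Base d} (hu : u ∉ tsupport η) : I.inv (t, u) = u := by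
  conv_lhs => rw [← I.map_of_notMem t u hu]
  exact I.inv_map t u

theorem inv_zero (u : Base d) : I.inv (0, u) = u := by
  conv_lhs => rw [← I.map_zero u]
  exact I.inv_map 0 u

theorem map_mem (t : ℝ) {u : Base d} (hu : u ∈ tsupport η) : I.map (t, u) ∈ tsupport η := by
  by_contra h
  have := I.inv_of_notMem t h
  rw [I.inv_map] at this
  exact h (this ▸ hu)

theorem inv_mem (t : ℝ) {u : Base d} (hu : u ∈ tsupport η) : I.inv (t, u) ∈ tsupport η := by
  by_contra h
  have := I.map_of_notMem t _ h
  rw [I.map_inv] at this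
  exact h (this ▸ hu)

theorem dirD_map (u : Base d) : dirD ((1 : ℝ), (0 : Base d)) I.map (0, u) = η u := by
  have h2 := ((I.contDiff_map.differentiable (by simp) (0, u)).hasFDerivAt).comp_hasDerivAt
    (0 : ℝ) ((hasDerivAt_id (0 : ℝ)).prodMk (hasDerivAt_const (0 : ℝ) u))
  exact h2.unique (I.hasDerivAt_map u)

/-- The time derivative of the Jacobian matrix. -/
theorem hasDerivAt_jac (hη : ContDiff ℝ ∞ η) (u : Base d) (i j : Fin (d + 1)) :
    HasDerivAt (fun t => jac (fun z => I.map (t, z)) u i j)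
      (derivMatrix (fun z => η z) u i j) 0 := by
  have h1 := hasDerivAt_multiPartial isOpen_univ I.contDiff_map.contDiffOn {j}
    (mem_univ ((0 : ℝ), u))
  simp only [multiPartial_singleton, I.dirD_map] at h1
  have h2 := ((EuclideanSpace.proj i : Base d →L[ℝ] ℝ).hasFDerivAt).comp_hasDerivAt (0 : ℝ) h1
  refine h2.congr_deriv ?_
  exact (dirD_clm isOpen_univ hη.contDiffOn (bas d j) (EuclideanSpace.proj i : Base d →L[ℝ] ℝ)
    (mem_univ u)).symm

theorem jac_zero (u : Base d) : jac (fun z => I.map (0, z)) u = 1 := by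
  have : (fun z => I.map (0, z)) = id := funext I.map_zero
  rw [this]
  ext i j
  simp [jac, bas_apply, Matrix.one_apply]

end Isotopy

end Isotopy

/-! ## Diffeomorphisms of `X` supported in a chart -/

section Extension

variable {d : ℕ} {X : Type*} [TopologicalSpace X] [ChartedSpace (Base d) X]
  [IsManifold 𝓘(ℝ, Base d) ∞ X] {e : OpenPartialHomeomorph X (Base d)} {x : X}
  {η : Base d → Base d}

open Classical in
/-- The extension by the identity of a map of `ℝⁿ`, read in a chart. -/
def extendMap (e : OpenPartialHomeomorph X (Base d)) (f : Base d → Base d) (x : X) : X :=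
  if x ∈ e.source then e.symm (f (e x)) else x

theorem extendMap_of_mem (f : Base d → Base d) (hx : x ∈ e.source) :
    extendMap e f x = e.symm (f (e x)) := if_pos hx

theorem extendMap_of_notMem (f : Base d → Base d) (hx : x ∉ e.source) : extendMap e f x = x :=
  if_neg hx

theorem extendMap_eq_self {f : Base d → Base d} {K : Set (Base d)} (hf : ∀ u ∉ K, f u = u)
    (hx : x ∉ e.symm '' K) : extendMap e f x = x := by
  by_cases hs : x ∈ e.source
  · rw [extendMap_of_mem f hs, hf _ fun h => hx ⟨_, h, e.left_inv hs⟩, e.left_inv hs]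
  · exact extendMap_of_notMem f hs

theorem mapsTo_target {f : Base d → Base d} {K : Set (Base d)} (hKe : K ⊆ e.target)
    (hf : ∀ u ∉ K, f u = u) (hfK : ∀ u ∈ K, f u ∈ K) {u : Base d} (hu : u ∈ e.target) :
    f u ∈ e.target := by
  by_cases hK : u ∈ K
  · exact hKe (hfK u hK)
  · rwa [hf u hK]

variable [T2Space X]

/-- Inside the chart the map is given by `H`. Away from the closed image of `K` it is the identity,
and these two open sets cover `X`. -/
theorem contMDiff_extendMap (he : e ∈ IsManifold.maximalAtlas 𝓘(ℝ, Base d) ∞ X)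
    {H : ℝ × Base d → Base d} (hH : ContDiff ℝ ∞ H) {K : Set (Base d)} (hK : IsCompact K)
    (hKe : K ⊆ e.target) (hHid : ∀ t, ∀ u ∉ K, H (t, u) = u) (hHK : ∀ t, ∀ u ∈ K, H (t, u) ∈ K) :
    ContMDiff (𝓘(ℝ, ℝ).prod 𝓘(ℝ, Base d)) 𝓘(ℝ, Base d) ∞
      (fun p : ℝ × X => extendMap e (fun u => H (p.1, u)) p.2) := by
  intro p
  by_cases hp : p.2 ∈ e.source
  · have h1 : (fun p : ℝ × X => extendMap e (fun u => H (p.1, u)) p.2) =ᶠ[𝓝 p]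
        fun p : ℝ × X => e.symm (H (p.1, e p.2)) := by
      filter_upwards [(e.open_source.preimage continuous_snd).mem_nhds hp] with q hq
      exact extendMap_of_mem _ hq
    refine ContMDiffAt.congr_of_eventuallyEq ?_ h1
    have h2 : ContMDiffAt (𝓘(ℝ, ℝ).prod 𝓘(ℝ, Base d)) 𝓘(ℝ, Base d) ∞
        (fun p : ℝ × X => e p.2) p :=
      (contMDiffAt_of_mem_maximalAtlas he hp).comp p contMDiffAt_snd
    have h3 : ContMDiffAt (𝓘(ℝ, ℝ).prod 𝓘(ℝ, Base d)) 𝓘(ℝ, Base d) ∞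
        (fun p : ℝ × X => H (p.1, e p.2)) p :=
      hH.contMDiff.contMDiffAt.comp p (contMDiffAt_fst.prodMk_space h2)
    exact (contMDiffAt_symm_of_mem_maximalAtlas he
      (mapsTo_target (f := fun u => H (p.1, u)) hKe (hHid p.1) (hHK p.1)
        (e.map_source hp))).comp p h3
  · have hx : p.2 ∉ e.symm '' K := by
      rintro ⟨u, hu, hux⟩
      exact hp (hux ▸ e.map_target (hKe hu))
    have h1 : (fun p : ℝ × X => extendMap e (fun u => H (p.1, u)) p.2) =ᶠ[𝓝 p] Prod.snd := by
      filter_upwards [((isClosed_symm_image hK hKe).isOpen_compl.preimage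
        continuous_snd).mem_nhds hx] with q hq
      exact extendMap_eq_self (hHid q.1) hq
    exact contMDiffAt_snd.congr_of_eventuallyEq h1

variable (he : e ∈ IsManifold.maximalAtlas 𝓘(ℝ, Base d) ∞ X) (hη : IsTest e.target η)
  (I : Isotopy η)

/-- The diffeomorphisms of `X` defined by an isotopy. -/
def isotopyDiff (t : ℝ) : DiffX d X where
  toFun := extendMap e fun u => I.map (t, u)
  invFun := extendMap e fun u => I.inv (t, u)
  left_inv x := by
    by_cases hx : x ∈ e.source
    · have ht := mapsTo_target (f := fun u => I.map (t, u)) hη.tsupport_subset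
        (I.map_of_notMem t) (fun u => I.map_mem t) (e.map_source hx)
      rw [extendMap_of_mem _ hx, extendMap_of_mem _ (e.map_target ht), e.right_inv ht, I.inv_map,
        e.left_inv hx]
    · rw [extendMap_of_notMem _ hx, extendMap_of_notMem _ hx]
  right_inv x := by
    by_cases hx : x ∈ e.source
    · have ht := mapsTo_target (f := fun u => I.inv (t, u)) hη.tsupport_subset
        (fun u => I.inv_of_notMem t) (fun u => I.inv_mem t) (e.map_source hx)
      rw [extendMap_of_mem _ hx, extendMap_of_mem _ (e.map_target ht), e.right_inv ht, I.map_inv,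
        e.left_inv hx]
    · rw [extendMap_of_notMem _ hx, extendMap_of_notMem _ hx]
  contMDiff_toFun := (contMDiff_extendMap he I.contDiff_map hη.hasCompactSupport.isCompact
    hη.tsupport_subset I.map_of_notMem fun t _ => I.map_mem t).comp
      (contMDiff_const.prodMk contMDiff_id)
  contMDiff_invFun := (contMDiff_extendMap he I.contDiff_inv hη.hasCompactSupport.isCompact
    hη.tsupport_subset (fun t _ => I.inv_of_notMem t) fun t _ => I.inv_mem t).comp
      (contMDiff_const.prodMk contMDiff_id)

variable {t : ℝ}

theorem isotopyDiff_apply (x : X) :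
    isotopyDiff he hη I t x = extendMap e (fun u => I.map (t, u)) x := rfl

theorem isotopyDiff_of_mem (hx : x ∈ e.source) :
    isotopyDiff he hη I t x = e.symm (I.map (t, e x)) :=
  extendMap_of_mem (fun u => I.map (t, u)) hx

theorem isotopyDiff_of_notMem (hx : x ∉ e.symm '' tsupport η) : isotopyDiff he hη I t x = x :=
  extendMap_eq_self (I.map_of_notMem t) hx

theorem map_mem_target (hη : IsTest e.target η) {u : Base d} (hu : u ∈ e.target) :
    I.map (t, u) ∈ e.target :=
  mapsTo_target (f := fun u => I.map (t, u)) hη.tsupport_subset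
    (I.map_of_notMem t) (fun _ => I.map_mem t) hu

theorem isotopyDiff_mem (hx : x ∈ e.source) : isotopyDiff he hη I t x ∈ e.source := by
  rw [isotopyDiff_apply, extendMap_of_mem _ hx]
  exact e.map_target (map_mem_target I hη (e.map_source hx))

theorem chart_isotopyDiff (hx : x ∈ e.source) :
    e (isotopyDiff he hη I t x) = I.map (t, e x) := by
  rw [isotopyDiff_apply, extendMap_of_mem _ hx,
    e.right_inv (map_mem_target I hη (e.map_source hx))]

theorem contMDiff_isotopyDiff :
    ContMDiff (𝓘(ℝ, ℝ).prod 𝓘(ℝ, Base d)) 𝓘(ℝ, Base d) ∞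
      (fun p : ℝ × X => isotopyDiff he hη I p.1 p.2) :=
  contMDiff_extendMap he I.contDiff_map hη.hasCompactSupport.isCompact
    hη.tsupport_subset I.map_of_notMem fun t _ => I.map_mem t

theorem isotopyDiff_zero (x : X) : isotopyDiff he hη I 0 x = x :=
  extendMap_eq_self (K := ∅) (fun u _ => I.map_zero u) (by simp)

theorem hasMFDerivAt_isotopyDiff (hx : x ∈ e.source) (v : Base d) :
    mfderiv 𝓘(ℝ, Base d) 𝓘(ℝ, Base d) (isotopyDiff he hη I t) x (chartDinv e x v) =
      chartDinv e (isotopyDiff he hη I t x) (fderiv ℝ (fun u => I.map (t, u)) (e x) v) := by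
  have ht := map_mem_target I (t := t) hη (e.map_source hx)
  have h1 : HasMFDerivAt 𝓘(ℝ, Base d) 𝓘(ℝ, Base d) (fun u => I.map (t, u)) (e x)
      (fderiv ℝ (fun u => I.map (t, u)) (e x)) := by
    refine HasFDerivAt.hasMFDerivAt (DifferentiableAt.hasFDerivAt ?_)
    exact ((I.contDiff_map.comp (contDiff_const.prodMk contDiff_id)).differentiable (by simp)) _
  have h2 := (mdifferentiableAt_chart_symm he ht).hasMFDerivAt.comp x
    (h1.comp x (mdifferentiableAt_chart he hx).hasMFDerivAt)
  have h3 : isotopyDiff he hη I t =ᶠ[𝓝 x] e.symm ∘ (fun u => I.map (t, u)) ∘ e := by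
    filter_upwards [e.open_source.mem_nhds hx] with z hz
    exact isotopyDiff_of_mem he hη I hz
  have h4 := (h2.congr_of_eventuallyEq h3).mfderiv
  have key : ∀ z, z = I.map (t, e x) → ∀ w : Base d,
      (show Base d from mfderiv 𝓘(ℝ, Base d) 𝓘(ℝ, Base d) e.symm (I.map (t, e x)) w) =
        mfderiv 𝓘(ℝ, Base d) 𝓘(ℝ, Base d) e.symm z w := by
    rintro _ rfl _; rfl
  have h5 : (show Base d from mfderiv 𝓘(ℝ, Base d) 𝓘(ℝ, Base d) (isotopyDiff he hη I t) x
      (chartDinv e x v)) = mfderiv 𝓘(ℝ, Base d) 𝓘(ℝ, Base d) e.symm (I.map (t, e x))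
        (fderiv ℝ (fun u => I.map (t, u)) (e x) (chartD e x (chartDinv e x v))) := by
    rw [h4]; rfl
  rw [chartD_chartDinv he hx] at h5
  exact h5.trans (key _ (chart_isotopyDiff he hη I hx) _)

theorem mfderiv_isotopyDiff_time {ξ : VectorFieldX d X}
    (hξ : ∀ x ∈ e.source, ξ x = chartDinv e x (η (e x)))
    (hξ0 : ∀ x ∉ e.symm '' tsupport η, ξ x = 0) (x : X) :
    mfderiv 𝓘(ℝ, ℝ) 𝓘(ℝ, Base d) (fun t : ℝ => isotopyDiff he hη I t x) 0 (1 : ℝ) = ξ x := by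
  by_cases hx : x ∈ e.source
  · have h0 : I.map (0, e x) = e x := I.map_zero _
    have ht : I.map (0, e x) ∈ e.target := by rw [h0]; exact e.map_source hx
    have h1 : HasMFDerivAt 𝓘(ℝ, ℝ) 𝓘(ℝ, Base d) (fun t : ℝ => I.map (t, e x)) 0
        (ContinuousLinearMap.toSpanSingleton ℝ (η (e x))) :=
      (I.hasDerivAt_map (e x)).hasFDerivAt.hasMFDerivAt
    have h2 := (mdifferentiableAt_chart_symm he ht).hasMFDerivAt.comp (0 : ℝ) h1
    have h3 : (fun t : ℝ => isotopyDiff he hη I t x) = e.symm ∘ fun t => I.map (t, e x) :=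
      funext fun t => isotopyDiff_of_mem he hη I hx
    have key : ∀ z, z = I.map (0, e x) → ∀ w : Base d,
        (show Base d from mfderiv 𝓘(ℝ, Base d) 𝓘(ℝ, Base d) e.symm (I.map (0, e x)) w) =
          mfderiv 𝓘(ℝ, Base d) 𝓘(ℝ, Base d) e.symm z w := by
      rintro _ rfl _; rfl
    rw [h3, h2.mfderiv, hξ x hx]
    have h4 : (show Base d from mfderiv 𝓘(ℝ, Base d) 𝓘(ℝ, Base d) e.symm (I.map (0, e x))
        (ContinuousLinearMap.toSpanSingleton ℝ (η (e x)) (1 : ℝ))) =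
        mfderiv 𝓘(ℝ, Base d) 𝓘(ℝ, Base d) e.symm (I.map (0, e x)) (η (e x)) := by
      rw [ContinuousLinearMap.toSpanSingleton_apply, one_smul]
    exact h4.trans (key _ h0.symm _)
  · have hx' : x ∉ e.symm '' tsupport η := by
      rintro ⟨u, hu, hux⟩
      exact hx (hux ▸ e.map_target (hη.tsupport_subset hu))
    have h3 : (fun t : ℝ => isotopyDiff he hη I t x) = fun _ => x :=
      funext fun t => isotopyDiff_of_notMem he hη I hx'
    rw [h3, hξ0 x hx', mfderiv_const]
    rfl

/-- In the chart `e` the Jacobian factors into that of the isotopy and those of two positive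
transitions. Outside the chart the diffeomorphism is locally the identity. -/
theorem preservesOrientation_isotopyDiff {o : OrientedAtlas d X} (hpos : o.IsPositive e) :
    PreservesOrientation o (isotopyDiff hpos.1 hη I t) := by
  intro e₁ h₁ e₂ h₂ x hx₁ hx₂
  have hp (e') (he' : e' ∈ o.charts) : o.IsPositive e' :=
    ⟨o.smooth he', fun e'' he'' => o.jacobian_pos e' he' e'' he''⟩
  have hcont : ContinuousAt e₁.symm (e₁ x) := e₁.continuousAt_symm (e₁.map_source hx₁)
  by_cases hx : x ∈ e.source
  · have hφ := isotopyDiff_mem hpos.1 hη I (t := t) hx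
    set φ := isotopyDiff hpos.1 hη I t with hφd
    have hev : e₂ ∘ φ ∘ e₁.symm =ᶠ[𝓝 (e₁ x)]
        (e₂ ∘ e.symm) ∘ (fun u => I.map (t, u)) ∘ (e ∘ e₁.symm) := by
      have : ∀ᶠ u in 𝓝 (e₁ x), e₁.symm u ∈ e.source :=
        hcont.eventually (e.open_source.mem_nhds (by rwa [e₁.left_inv hx₁]))
      filter_upwards [this] with u hu
      exact congrArg e₂ (isotopyDiff_of_mem hpos.1 hη I hu)
    have he1 : (e ∘ e₁.symm) (e₁ x) = e x := congrArg e (e₁.left_inv hx₁)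
    have he2 : I.map (t, e x) = e (φ x) := (chart_isotopyDiff hpos.1 hη I hx).symm
    have d1 : DifferentiableAt ℝ (e ∘ e₁.symm) (e₁ x) :=
      differentiableAt_of_contDiffOn (contDiffOn_transition (hp e₁ h₁).1 hpos.1)
        isOpen_transition ⟨e₁.map_source hx₁, by rwa [mem_preimage, e₁.left_inv hx₁]⟩
    have d2 : DifferentiableAt ℝ (fun u => I.map (t, u)) ((e ∘ e₁.symm) (e₁ x)) :=
      (I.contDiff_map.comp (contDiff_const.prodMk contDiff_id)).differentiable (by simp) _
    have d3 : DifferentiableAt ℝ (e₂ ∘ e.symm)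
        (((fun u => I.map (t, u)) ∘ (e ∘ e₁.symm)) (e₁ x)) := by
      rw [Function.comp_apply, he1, he2]
      exact differentiableAt_of_contDiffOn (contDiffOn_transition hpos.1 (hp e₂ h₂).1)
        isOpen_transition ⟨e.map_source hφ, by rwa [mem_preimage, e.left_inv hφ]⟩
    rw [hev.fderiv_eq, fderiv_comp _ d3 (d2.comp _ d1), fderiv_comp _ d2 d1, det_comp_clm,
      det_comp_clm, Function.comp_apply, he1, he2]
    exact mul_pos (hpos.det_pos (hp e₂ h₂) hφ hx₂)
      (mul_pos (I.det_pos t _) ((hp e₁ h₁).det_pos hpos hx₁ hx))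
  · have hx' : x ∉ e.symm '' tsupport η := by
      rintro ⟨u, hu, hux⟩
      exact hx (hux ▸ e.map_target (hη.tsupport_subset hu))
    have hφx : isotopyDiff hpos.1 hη I t x = x := isotopyDiff_of_notMem hpos.1 hη I hx'
    rw [hφx] at hx₂
    have hcl := isClosed_symm_image hη.hasCompactSupport.isCompact hη.tsupport_subset
    have hev : e₂ ∘ isotopyDiff hpos.1 hη I t ∘ e₁.symm =ᶠ[𝓝 (e₁ x)] e₂ ∘ e₁.symm := by
      have : ∀ᶠ u in 𝓝 (e₁ x), e₁.symm u ∈ (e.symm '' tsupport η)ᶜ :=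
        hcont.eventually (hcl.isOpen_compl.mem_nhds (by rwa [e₁.left_inv hx₁]))
      filter_upwards [this] with u hu
      exact congrArg e₂ (isotopyDiff_of_notMem hpos.1 hη I hu)
    rw [hev.fderiv_eq]
    exact o.jacobian_pos e₁ h₁ e₂ h₂ x ⟨hx₁, hx₂⟩

end Extension

/-! ## Fields transported along an isotopy -/

section Transport

variable {d m r : ℕ}
variable {X : Type*} [TopologicalSpace X] [ChartedSpace (Base d) X] [IsManifold 𝓘(ℝ, Base d) ∞ X]
variable {Y : Type*} [TopologicalSpace Y] [ChartedSpace (Base d × Fibre m) Y]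
  [IsManifold 𝓘(ℝ, Base d × Fibre m) ∞ Y]
variable {o : OrientedAtlas d X} {π : Y → X} {c : FiberedChart (m := m) o π}
  {γ : LocalField (d := d) (m := m) π} {u : Base d} {η : Base d → Base d}

theorem IsTest.mono {V : Type*} [NormedAddCommGroup V] [NormedSpace ℝ V] {U U' : Set (Base d)}
    {f : Base d → V} (hf : IsTest U f) (h : U ⊆ U') : IsTest U' f :=
  ⟨hf.contDiff, hf.hasCompactSupport, hf.tsupport_subset.trans h⟩

theorem sum_push (J M : Matrix (Fin (d + 1)) (Fin (d + 1)) ℝ) (a b : Fin (d + 1) → ℝ) :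
    ∑ i, ∑ j, a i * (J * M * J.transpose) i j * b j =
      ∑ k, ∑ l, (∑ i, J i k * a i) * M k l * ∑ j, J j l * b j := by
  have h1 (A : Matrix (Fin (d + 1)) (Fin (d + 1)) ℝ) (a b : Fin (d + 1) → ℝ) :
      ∑ i, ∑ j, a i * A i j * b j = a ⬝ᵥ A.mulVec b := by
    simp only [dotProduct, Matrix.mulVec, Finset.mul_sum, mul_assoc]
  rw [h1, h1]
  have h2 (b : Fin (d + 1) → ℝ) : (fun l => ∑ j, J j l * b j) = J.transpose.mulVec b := rfl
  rw [h2, h2, ← Matrix.mulVec_mulVec, ← Matrix.mulVec_mulVec, Matrix.dotProduct_mulVec a J,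
    ← Matrix.mulVec_transpose]

/-- The restriction of a local field to an open set. -/
def LocalField.restrict (γ : LocalField (d := d) (m := m) π) {O : Set X} (hO : IsOpen O) :
    LocalField (d := d) (m := m) π where
  dom := γ.dom ∩ O
  isOpen_dom := γ.isOpen_dom.inter hO
  metric := γ.metric
  matter := γ.matter
  isSection x hx := γ.isSection x hx.1
  metric_smooth e he := (γ.metric_smooth e he).mono fun _ hu => ⟨hu.1, hu.2.1⟩
  matter_smooth := γ.matter_smooth.mono inter_subset_left

variable [T2Space X] (hη : IsTest (c.fieldDomain γ) η) (I : Isotopy η)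
  (Λ : CanonicalLifting (d := d) (m := m) π)

theorem fieldDomain_subset_target : c.fieldDomain γ ⊆ c.base.target := fun _ hu => hu.1

/-- The diffeomorphisms which transport the field. -/
def flow (t : ℝ) : DiffX d X :=
  isotopyDiff c.base_mem (hη.mono fieldDomain_subset_target) I t

/-- The values of the transported matter field. -/
def movedMatter (q : ℝ × Base d) : Y :=
  Λ.lift (flow hη I q.1) (γ.matter (c.base.symm (I.inv q)))

/-- The domain of the transported field, in coordinates. -/
def movedDomain : Set (ℝ × Base d) :=
  {q | I.inv q ∈ c.fieldDomain γ ∧ movedMatter hη I Λ q ∈ c.total.source}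

/-- The transported metric, in coordinates. -/
def movedMetric (c : FiberedChart (m := m) o π) (γ : LocalField (d := d) (m := m) π)
    (I : Isotopy η) (q : ℝ × Base d) : SymArray d :=
  pushSym (jac (fun z => I.map (q.1, z)) (I.inv q)) (c.metricRep γ (I.inv q))

/-- The transported matter field, in coordinates. -/
def movedRep (q : ℝ × Base d) : Fibre m := (c.total (movedMatter hη I Λ q)).2

theorem contMDiffAt_movedMatter {q : ℝ × Base d} (hq : I.inv q ∈ c.fieldDomain γ) :
    ContMDiffAt 𝓘(ℝ, ℝ × Base d) 𝓘(ℝ, Base d × Fibre m) ∞ (movedMatter hη I Λ) q := by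
  have h1 := Λ.lift_smooth (flow hη I)
    (contMDiff_isotopyDiff c.base_mem (hη.mono fieldDomain_subset_target) I)
  have h2 : ContMDiffAt 𝓘(ℝ, ℝ × Base d) 𝓘(ℝ, Base d) ∞ I.inv q :=
    I.contDiff_inv.contMDiff.contMDiffAt
  have h3 : ContMDiffAt 𝓘(ℝ, ℝ × Base d) 𝓘(ℝ, Base d) ∞ (fun q => c.base.symm (I.inv q)) q :=
    (contMDiffAt_symm_of_mem_maximalAtlas c.base_mem hq.1).comp q h2
  have h4 : ContMDiffAt 𝓘(ℝ, ℝ × Base d) 𝓘(ℝ, Base d × Fibre m) ∞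
      (fun q => γ.matter (c.base.symm (I.inv q))) q :=
    (γ.matter_smooth.contMDiffAt (γ.isOpen_dom.mem_nhds hq.2.1)).comp q h3
  have h5 : ContMDiffAt 𝓘(ℝ, ℝ × Base d) 𝓘(ℝ, ℝ) ∞ (fun q : ℝ × Base d => q.1) q :=
    contDiff_fst.contMDiff.contMDiffAt
  exact h1.contMDiffAt.comp q (h5.prodMk h4)

theorem isOpen_movedDomain : IsOpen (movedDomain hη I Λ) := by
  have h1 : ContinuousOn (movedMatter hη I Λ) (I.inv ⁻¹' c.fieldDomain γ) := fun q hq =>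
    (contMDiffAt_movedMatter hη I Λ hq).continuousAt.continuousWithinAt
  exact h1.isOpen_inter_preimage ((isOpen_fieldDomain γ).preimage I.contDiff_inv.continuous)
    c.total.open_source

theorem contDiffOn_movedRep : ContDiffOn ℝ ∞ (movedRep hη I Λ) (movedDomain hη I Λ) := by
  intro q hq
  have h1 : ContMDiffAt 𝓘(ℝ, ℝ × Base d) 𝓘(ℝ, Base d × Fibre m) ∞
      (fun q => c.total (movedMatter hη I Λ q)) q :=
    (contMDiffAt_of_mem_maximalAtlas c.total_smooth hq.2).comp q
      (contMDiffAt_movedMatter hη I Λ hq.1)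
  exact (contDiff_snd.contDiffAt.comp q h1.contDiffAt).contDiffWithinAt

theorem contDiff_movedJac (i j : Fin (d + 1)) :
    ContDiff ℝ ∞ fun q : ℝ × Base d => jac (fun z => I.map (q.1, z)) (I.inv q) i j := by
  have h1 := contDiffOn_dirD_slice isOpen_univ I.contDiff_map.contDiffOn (bas d j)
  have h2 := contDiffOn_univ.1 h1
  have h3 := (EuclideanSpace.proj i : Base d →L[ℝ] ℝ).contDiff.comp h2
  exact h3.comp (contDiff_fst.prodMk I.contDiff_inv)

theorem contDiffOn_movedMetric :
    ContDiffOn ℝ ∞ (movedMetric c γ I) (I.inv ⁻¹' c.fieldDomain γ) :=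
  contDiffOn_pushSym (fun i j => (contDiff_movedJac I i j).contDiffOn)
    (contDiffOn_metricRep.comp I.contDiff_inv.contDiffOn fun _ hq => hq)

theorem total_movedMatter {q : ℝ × Base d} (hq : q ∈ movedDomain hη I Λ) :
    c.total (movedMatter hη I Λ q) = (q.2, movedRep hη I Λ q) := by
  refine Prod.ext ?_ rfl
  rw [c.fst_total _ hq.2, movedMatter, Λ.covers, γ.isSection _ hq.1.2.1, flow,
    chart_isotopyDiff _ _ _ (c.base.map_target hq.1.1), c.base.right_inv hq.1.1]
  exact I.map_inv q.1 q.2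

theorem det_movedMetric {q : ℝ × Base d} (hq : I.inv q ∈ c.fieldDomain γ) :
    (invMetric (movedMetric c γ I q)).det ≠ 0 := by
  have h1 : (jac (fun z => I.map (q.1, z)) (I.inv q)).det ≠ 0 := by
    rw [det_jac]
    exact (I.det_pos _ _).ne'
  rw [movedMetric, invMetric_pushSym, Matrix.det_mul, Matrix.det_mul, Matrix.det_transpose]
  exact mul_ne_zero (mul_ne_zero h1 (metricRep_det_ne_zero hq.1)) h1

theorem inv_mem_of_movedDomain {t : ℝ} (h : (t, I.map (t, u)) ∈ movedDomain hη I Λ) :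
    u ∈ c.fieldDomain γ := by
  have := h.1
  rwa [I.inv_map] at this

/-- The coordinates of the jet of the transported field. -/
def movedJet (r : ℕ) (q : ℝ × Base d) : JetCoord d m r :=
  jetCoord r (fun z => movedMetric c γ I (q.1, z)) (fun z => movedRep hη I Λ (q.1, z)) q.2

theorem movedJet_mem {q : ℝ × Base d} (hq : q ∈ movedDomain hη I Λ) :
    movedJet hη I Λ r q ∈ c.jetTarget r := by
  change (q.2, (jetCoord r _ _ q.2).2.2 (MultiIdx.nil d r)) ∈ _ ∧
    (invMetric ((jetCoord r _ _ q.2).2.1 (MultiIdx.nil d r))).det ≠ 0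
  rw [jetCoord_nil_metric, jetCoord_nil_matter]
  refine ⟨?_, det_movedMetric I hq.1⟩
  change (q.2, movedRep hη I Λ q) ∈ _
  rw [← total_movedMatter hη I Λ hq]
  exact c.total.map_source hq.2

/-- Realizes the moved coordinate expressions by a genuine local field, to which invariance applies.
`IsTransported` constrains every point of the source field, so `γ` is first restricted to the points
whose images stay in the fibered chart. -/
theorem exists_transported {t : ℝ} {u : Base d} (hu : (t, I.map (t, u)) ∈ movedDomain hη I Λ) :
    ∃ γ₀ γ' : LocalField (d := d) (m := m) π, IsTransported (flow hη I t)
      (Λ.lift (flow hη I t)) γ₀ γ' ∧ c.base.symm u ∈ γ₀.dom ∧ γ₀.matter = γ.matter ∧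
      c.jet r γ₀ = c.jet r γ ∧ c.jet r γ' (I.map (t, u)) = movedJet hη I Λ r (t, I.map (t, u)) ∧
      γ'.matter (flow hη I t (c.base.symm u)) ∈ c.total.source := by
  set V : Set (Base d) := {w | (t, w) ∈ movedDomain hη I Λ} with hV
  have hVo : IsOpen V := isOpen_slice (isOpen_movedDomain hη I Λ) t
  have hGs : ContDiffOn ℝ ∞ (fun z => movedMetric c γ I (t, z)) V :=
    (contDiffOn_movedMetric I).comp (contDiff_const.prodMk contDiff_id).contDiffOn
      fun z hz => hz.1
  have hys : ContDiffOn ℝ ∞ (fun z => movedRep hη I Λ (t, z)) V :=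
    (contDiffOn_movedRep hη I Λ).comp (contDiff_const.prodMk contDiff_id).contDiffOn
      fun z hz => hz
  obtain ⟨γ', -, h2, h3, h4, h5⟩ := exists_localField c hVo hGs hys
    (fun v hv => det_movedMetric I hv.1) fun v hv => by
      have := c.total.map_source hv.2
      rwa [total_movedMatter hη I Λ hv] at this
  have hO : IsOpen (c.base.source ∩ c.base ⁻¹' ((fun v => I.map (t, v)) ⁻¹' V)) :=
    c.base.isOpen_inter_preimage (hVo.preimage
      (I.contDiff_map.comp (contDiff_const.prodMk contDiff_id)).continuous)
  have hut := inv_mem_of_movedDomain hη I Λ hu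
  have hmat : ∀ x ∈ c.base.source, (t, I.map (t, c.base x)) ∈ movedDomain hη I Λ →
      γ'.matter (flow hη I t x) = Λ.lift (flow hη I t) (γ.matter x) := by
    intro x hx hxV
    rw [flow, isotopyDiff_of_mem _ _ _ hx, h5 _ hxV, ← total_movedMatter hη I Λ hxV,
      c.total.left_inv hxV.2, movedMatter, I.inv_map, c.base.left_inv hx]
    rfl
  refine ⟨γ.restrict hO, γ', ?_, ⟨hut.2.1, c.base.map_target hut.1, ?_⟩, rfl, rfl,
    jetCoord_congr hVo h2 h3 hu, ?_⟩
  · rintro x ⟨hxd, hx, hxV⟩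
    have hφ : flow hη I t x ∈ c.base.source := isotopyDiff_mem _ _ _ hx
    have hcφ : c.base (flow hη I t x) = I.map (t, c.base x) := chart_isotopyDiff _ _ _ hx
    refine ⟨?_, hmat x hx hxV, fun α β => ?_⟩
    · rw [h4]
      exact ⟨hφ, by rw [mem_preimage, hcφ]; exact hxV⟩
    · have hgram : gram c.base (γ'.metric (flow hη I t x)) =
          jac (fun z => I.map (t, z)) (c.base x) * gram c.base (γ.metric x) *
            (jac (fun z => I.map (t, z)) (c.base x)).transpose := by
        have h6 : c.metricRep γ' (I.map (t, c.base x)) = movedMetric c γ I (t, I.map (t, c.base x)) :=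
          h2 hxV
        rw [← metricRep_eq_gram hφ, hcφ, h6, movedMetric, invMetric_pushSym, I.inv_map,
          metricRep_eq_gram hx]
      have hD (α : TangentSpace 𝓘(ℝ, Base d) (flow hη I t x) →L[ℝ] ℝ) (k : Fin (d + 1)) :
          (α.comp (mfderiv 𝓘(ℝ, Base d) 𝓘(ℝ, Base d) (flow hη I t) x))
            (chartDinv c.base x (bas d k)) =
          ∑ i, jac (fun z => I.map (t, z)) (c.base x) i k *
            α (chartDinv c.base (flow hη I t x) (bas d i)) := by
        rw [ContinuousLinearMap.comp_apply]
        have h6 := hasMFDerivAt_isotopyDiff (t := t) c.base_mem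
          (hη.mono fieldDomain_subset_target) I hx (bas d k)
        refine (congrArg α h6).trans ?_
        change (α.comp (chartDinv c.base (flow hη I t x))) (fderiv ℝ (fun u => I.map (t, u)) _ _) = _
        rw [fderiv_bas, map_sum]
        refine Finset.sum_congr rfl fun i _ => ?_
        rw [map_smul]
        rfl
      rw [metric_apply c.base_mem hφ, hgram, sum_push]
      refine Eq.trans ?_ (metric_apply c.base_mem hx (γ.metric x) _ _).symm
      simp only [hD]
  · rw [mem_preimage, c.base.right_inv hut.1]
    exact hu
  · rw [hmat _ (c.base.map_target hut.1) (by rw [c.base.right_inv hut.1]; exact hu)]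
    have := hu.2
    rwa [movedMatter, I.inv_map] at this

/-- Invariance of the Lagrangian density. -/
theorem lagrangian_movedJet {L : JetFunction (m := m) o π r} (hL : L.IsInvariant Λ) {t : ℝ}
    (hu : (t, I.map (t, u)) ∈ movedDomain hη I Λ) :
    (jac (fun z => I.map (t, z)) u).det *
      L.lagrangian c (movedJet hη I Λ r (t, I.map (t, u))) = L.lagrangian c (c.jet r γ u) := by
  obtain ⟨γ₀, γ', h1, h2, h3, h4, h5, h6⟩ := exists_transported (r := r) hη I Λ hu
  have hut := inv_mem_of_movedDomain hη I Λ hu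
  have h7 := hL (flow hη I t) (preservesOrientation_isotopyDiff _ I c.base_positive) γ₀ γ' h1 c c
    (c.base.symm u) h2 (by rw [h3]; exact hut.2.2) h6
  have h8 : c.base (flow hη I t (c.base.symm u)) = I.map (t, u) := by
    rw [flow, chart_isotopyDiff _ _ _ (c.base.map_target hut.1), c.base.right_inv hut.1]
  rw [h8, c.base.right_inv hut.1, h4, h5] at h7
  have h9 : (movedJet hη I Λ r (t, I.map (t, u))).2.1 (MultiIdx.nil d r) =
      movedMetric c γ I (t, I.map (t, u)) := jetCoord_nil_metric
  have h10 : (c.jet r γ u).2.1 (MultiIdx.nil d r) = c.metricRep γ u := jetCoord_nil_metric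
  have h11 := volDensity_transform (A := c.metricRep γ u)
    (A' := movedMetric c γ I (t, I.map (t, u))) (J := jac (fun z => I.map (t, z)) u)
    (by rw [det_jac]; exact I.det_pos t u) (by rw [movedMetric, I.inv_map, invMetric_pushSym])
  rw [JetFunction.lagrangian, JetFunction.lagrangian, h7, h9, h10, h11]
  ring

end Transport

/-! ## Infinitesimal invariance and the conservation law -/

section Conservation

open MeasureTheory

variable {d m r : ℕ}
variable {X : Type*} [TopologicalSpace X] [ChartedSpace (Base d) X] [IsManifold 𝓘(ℝ, Base d) ∞ X]
variable {Y : Type*} [TopologicalSpace Y] [ChartedSpace (Base d × Fibre m) Y]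
  [IsManifold 𝓘(ℝ, Base d × Fibre m) ∞ Y]
variable {o : OrientedAtlas d X} {π : Y → X} {c : FiberedChart (m := m) o π}
  {γ : LocalField (d := d) (m := m) π} {u : Base d} {η : Base d → Base d}
  {L : JetFunction (m := m) o π r}

/-- The lift of the identity is an injective idempotent. -/
theorem CanonicalLifting.lift_refl (Λ : CanonicalLifting (d := d) (m := m) π) (y : Y) :
    Λ.lift (Diffeomorph.refl _ _ _) y = y := by
  have h := Λ.lift_comp (Diffeomorph.refl _ _ _) (Diffeomorph.refl _ _ _)
  rw [Diffeomorph.trans_refl] at h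
  have h1 := congrArg (fun f : DiffY d m Y => f y) h
  exact ((Λ.lift (Diffeomorph.refl _ _ _)).injective h1).symm

theorem hasDerivAt_of_dirD {E V : Type*} [NormedAddCommGroup E] [NormedSpace ℝ E]
    [NormedAddCommGroup V] [NormedSpace ℝ V] {f : ℝ × E → V} {σ : ℝ → E} {t : ℝ} {v : E}
    (hf : DifferentiableAt ℝ f (t, σ t)) (hσ : HasDerivAt σ v t) :
    HasDerivAt (fun τ => f (τ, σ τ))
      (dirD ((1 : ℝ), (0 : E)) f (t, σ t) + dirD ((0 : ℝ), v) f (t, σ t)) t := by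
  have h := HasFDerivAt.comp_hasDerivAt (l := f) t hf.hasFDerivAt ((hasDerivAt_id t).prodMk hσ)
  refine h.congr_deriv ?_
  rw [dirD, dirD, ← map_add]
  simp

/-! ### First-order variation of the fields and of the Lagrangian at time zero. -/

variable [T2Space X] (hη : IsTest (c.fieldDomain γ) η) (I : Isotopy η)
  (Λ : CanonicalLifting (d := d) (m := m) π)

theorem flow_zero : flow hη I 0 = Diffeomorph.refl _ _ _ := by
  ext x
  exact isotopyDiff_zero _ _ _ x

theorem movedMatter_zero (z : Base d) :
    movedMatter hη I Λ (0, z) = γ.matter (c.base.symm z) := by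
  rw [movedMatter, flow_zero, Λ.lift_refl, I.inv_zero]

theorem movedRep_zero (z : Base d) : movedRep hη I Λ (0, z) = c.matterRep γ z := by
  rw [movedRep, movedMatter_zero]
  rfl

theorem movedMetric_zero (z : Base d) : movedMetric c γ I (0, z) = c.metricRep γ z := by
  have h : invMetric (movedMetric c γ I (0, z)) = invMetric (c.metricRep γ z) := by
    rw [movedMetric, invMetric_pushSym, I.jac_zero, Matrix.one_mul, Matrix.transpose_one,
      Matrix.mul_one, I.inv_zero]
  exact Subtype.ext h

theorem zero_mem_movedDomain (hu : u ∈ c.fieldDomain γ) :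
    ((0 : ℝ), u) ∈ movedDomain hη I Λ := by
  refine ⟨by rwa [I.inv_zero], ?_⟩
  rw [movedMatter_zero]
  exact hu.2.2

theorem movedJet_zero (u : Base d) : movedJet hη I Λ r (0, u) = c.jet r γ u := by
  simp only [movedJet, movedMetric_zero, movedRep_zero]
  rfl

theorem contDiffOn_movedMetric_of_movedDomain :
    ContDiffOn ℝ ∞ (movedMetric c γ I) (movedDomain hη I Λ) :=
  (contDiffOn_movedMetric I).mono fun _ hq => hq.1

/-- The variation of the metric field. -/
def metricVariation (c : FiberedChart (m := m) o π) (γ : LocalField (d := d) (m := m) π)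
    (I : Isotopy η) (u : Base d) : SymArray d :=
  dirD ((1 : ℝ), (0 : Base d)) (movedMetric c γ I) (0, u)

/-- The variation of the matter field. -/
def matterVariation (u : Base d) : Fibre m :=
  dirD ((1 : ℝ), (0 : Base d)) (movedRep hη I Λ) (0, u)

theorem differentiableAt_movedMetric (hu : u ∈ c.fieldDomain γ) :
    DifferentiableAt ℝ (movedMetric c γ I) (0, u) :=
  differentiableAt_of_contDiffOn (contDiffOn_movedMetric I)
    ((isOpen_fieldDomain γ).preimage I.contDiff_inv.continuous) (by
      rw [mem_preimage, I.inv_zero]; exact hu)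

theorem contDiff_jac_time (u : Base d) (i j : Fin (d + 1)) :
    ContDiff ℝ ∞ fun t => jac (fun z => I.map (t, z)) u i j := by
  have h1 := contDiffOn_dirD_slice isOpen_univ I.contDiff_map.contDiffOn (bas d j)
  have h3 := (EuclideanSpace.proj i : Base d →L[ℝ] ℝ).contDiff.comp (contDiffOn_univ.1 h1)
  exact h3.comp (contDiff_id.prodMk contDiff_const)

theorem matDiffAt_jac (u : Base d) : MatDiffAt (fun t => jac (fun z => I.map (t, z)) u) 0 :=
  fun i j => (contDiff_jac_time I u i j).differentiable (by simp) 0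

theorem matD_jac (hs : ContDiff ℝ ∞ η) (u : Base d) :
    matD (1 : ℝ) (fun t => jac (fun z => I.map (t, z)) u) 0 = derivMatrix (fun z => η z) u := by
  ext i j
  exact (I.hasDerivAt_jac hs u i j).deriv

/-- Along the trajectory `(t, I.map (t, u))` the moved metric is `J g⁻¹(u) Jᵀ`. Its time derivative
is the variation at the fixed point plus the derivative of the metric along `η`; solving for the
former gives minus the Lie derivative. -/
theorem invMetric_metricVariation (hs : ContDiff ℝ ∞ η) (hu : u ∈ c.fieldDomain γ) :
    invMetric (metricVariation c γ I u) = lieMatrix (c.metricRep γ) (fun z => η z) u := by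
  have hd := differentiableAt_movedMetric I hu
  have h0 : I.map (0, u) = u := I.map_zero u
  have h1 := hasDerivAt_of_dirD (f := movedMetric c γ I) (σ := fun t => I.map (t, u)) (t := 0)
    (by simpa only [h0] using hd) (I.hasDerivAt_map u)
  simp only [h0] at h1
  have h2 : dirD ((0 : ℝ), η u) (movedMetric c γ I) (0, u) = dirD (η u) (c.metricRep γ) u := by
    rw [← dirD_slice ((isOpen_fieldDomain γ).preimage I.contDiff_inv.continuous)
      (contDiffOn_movedMetric I) (η u) (by rw [mem_preimage, I.inv_zero]; exact hu)]
    simp only [movedMetric_zero]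
  have h3 : matD (1 : ℝ) (fun t => jac (fun z => I.map (t, z)) u * invMetric (c.metricRep γ u) *
      (jac (fun z => I.map (t, z)) u).transpose) 0 =
      derivMatrix (fun z => η z) u * invMetric (c.metricRep γ u) +
        (derivMatrix (fun z => η z) u * invMetric (c.metricRep γ u)).transpose := by
    have hJ := matDiffAt_jac I u
    have hc : MatDiffAt (fun _ : ℝ => invMetric (c.metricRep γ u)) 0 := fun i j =>
      differentiableAt_const _
    have hc0 : matD (1 : ℝ) (fun _ : ℝ => invMetric (c.metricRep γ u)) 0 = 0 := by
      ext i j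
      simp [matD, dirD]
    rw [matD_mul (hJ.mul hc) hJ.transpose, matD_mul hJ hc, matD_transpose, matD_jac I hs, hc0,
      I.jac_zero]
    simp only [Matrix.mul_zero, add_zero, Matrix.transpose_one, Matrix.mul_one, Matrix.one_mul,
      Matrix.transpose_mul, invMetric_transpose]
  rw [lieMatrix, ← h3, eq_sub_iff_add_eq]
  ext i j
  have h4 := ((symComp i j).hasFDerivAt.comp_hasDerivAt (0 : ℝ) h1).deriv
  have h5 : (⇑(symComp i j) ∘ fun t => movedMetric c γ I (t, I.map (t, u))) = fun t =>
      (jac (fun z => I.map (t, z)) u * invMetric (c.metricRep γ u) *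
        (jac (fun z => I.map (t, z)) u).transpose) i j := by
    funext t
    change invMetric (movedMetric c γ I (t, I.map (t, u))) i j = _
    rw [movedMetric, I.inv_map, invMetric_pushSym]
  rw [h5, h2, map_add] at h4
  have h6 : symComp i j (dirD (η u) (c.metricRep γ) u) =
      matD (∑ i, η u i • bas d i) (fun z => invMetric (c.metricRep γ z)) u i j := by
    rw [sum_smul_bas]
    exact (dirD_clm (isOpen_fieldDomain γ) contDiffOn_metricRep (η u) (symComp i j) hu).symm
  rw [h6] at h4
  exact h4.symm

theorem derivMatrix_eq_zero {u : Base d} (hu : u ∉ tsupport η) :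
    derivMatrix (fun z => η z) u = 0 := by
  ext i j
  have h : EqOn (fun z => η z i) (fun _ => 0) (tsupport η)ᶜ := fun z hz => by
    simp only [image_eq_zero_of_notMem_tsupport hz, PiLp.zero_apply]
  have h1 := dirD_congr (isClosed_tsupport η).isOpen_compl h (bas d j) hu
  refine h1.trans ?_
  simp [dirD]

theorem metricVariation_eq_zero (hs : ContDiff ℝ ∞ η) (hu : u ∈ c.fieldDomain γ)
    (hut : u ∉ tsupport η) : metricVariation c γ I u = 0 := by
  have h := invMetric_metricVariation I hs hu
  rw [lieMatrix, derivMatrix_eq_zero hut, image_eq_zero_of_notMem_tsupport hut] at h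
  have h0 : matD (∑ i, (0 : Base d) i • bas d i) (fun z => invMetric (c.metricRep γ z)) u = 0 := by
    ext i j
    simp [matD, dirD]
  rw [h0, Matrix.zero_mul, Matrix.transpose_zero, add_zero, sub_zero] at h
  exact Subtype.ext h

theorem differentiableAt_movedRep (hu : u ∈ c.fieldDomain γ) :
    DifferentiableAt ℝ (movedRep hη I Λ) (0, u) :=
  differentiableAt_of_contDiffOn (contDiffOn_movedRep hη I Λ) (isOpen_movedDomain hη I Λ)
    (zero_mem_movedDomain hη I Λ hu)

/-- The lift of a diffeomorphism is not assumed to be local, so off the support of `η` the matter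
field might move for `t ≠ 0`. The support condition on `l` shows that its velocity at `t = 0`
vanishes there, which gives the variation the compact support needed for integration by parts. -/
theorem matterVariation_eq_zero (hu : u ∈ c.fieldDomain γ) (hut : u ∉ tsupport η) :
    matterVariation hη I Λ u = 0 := by
  have hηt := hη.mono fieldDomain_subset_target
  obtain ⟨ξ, hξ, hξ0⟩ := exists_vectorField c.base_mem hηt
  set y := γ.matter (c.base.symm u) with hy
  have hx : c.base.symm u ∉ c.base.symm '' tsupport η := by
    rintro ⟨v, hv, hvu⟩
    have := congrArg c.base hvu
    rw [c.base.right_inv (hηt.tsupport_subset hv), c.base.right_inv hu.1] at this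
    exact hut (this ▸ hv)
  have hl : Λ.l ξ y = 0 := by
    by_contra hne
    have h1 := Λ.l_support ξ (mem_image_of_mem π (subset_closure (show y ∈ {y | Λ.l ξ y ≠ 0}
      from hne)))
    rw [hy, γ.isSection _ hu.2.1] at h1
    refine hx (closure_minimal ?_ (isClosed_symm_image hηt.hasCompactSupport.isCompact
      hηt.tsupport_subset) h1)
    intro z hz
    by_contra hz'
    exact hz (hξ0 z hz')
  -- The vector field generated by the lifted family is `l ξ`, where `ξ` is the field on `X` with
  -- components `η`; at the point `y` it is zero.
  have hgen := Λ.l_generates (flow hη I) ξ (contMDiff_isotopyDiff c.base_mem hηt I)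
    (isotopyDiff_zero _ _ _) (mfderiv_isotopyDiff_time _ _ _ hξ hξ0) y
  rw [hl] at hgen
  have hsm : ContMDiff 𝓘(ℝ, ℝ) 𝓘(ℝ, Base d × Fibre m) ∞ fun t => Λ.lift (flow hη I t) y :=
    (Λ.lift_smooth (flow hη I) (contMDiff_isotopyDiff c.base_mem hηt I)).comp
      (contMDiff_id.prodMk contMDiff_const)
  have h0 : Λ.lift (flow hη I 0) y = y := by rw [flow_zero, Λ.lift_refl]
  have hmd : MDifferentiableAt 𝓘(ℝ, Base d × Fibre m) 𝓘(ℝ, Base d × Fibre m) c.total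
      (Λ.lift (flow hη I 0) y) :=
    (contMDiffAt_of_mem_maximalAtlas c.total_smooth (by rw [h0]; exact hu.2.2)).mdifferentiableAt
      (by simp)
  have h2 := hmd.hasMFDerivAt.comp (0 : ℝ)
    (hsm.contMDiffAt.mdifferentiableAt (by simp) (x := (0 : ℝ))).hasMFDerivAt
  have h3 : HasDerivAt (fun t => c.total (Λ.lift (flow hη I t) y)) 0 0 := by
    set B : ℝ →L[ℝ] Base d × Fibre m :=
      (show Base d × Fibre m →L[ℝ] Base d × Fibre m from
        mfderiv 𝓘(ℝ, Base d × Fibre m) 𝓘(ℝ, Base d × Fibre m) c.total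
          (Λ.lift (flow hη I 0) y)).comp
        (show ℝ →L[ℝ] Base d × Fibre m from
          mfderiv 𝓘(ℝ, ℝ) 𝓘(ℝ, Base d × Fibre m) (fun t => Λ.lift (flow hη I t) y) 0) with hB
    have hF : HasFDerivAt (fun t => c.total (Λ.lift (flow hη I t) y)) B 0 := h2.hasFDerivAt
    have hB1 : B 1 = 0 := (congrArg (show Base d × Fibre m →L[ℝ] Base d × Fibre m from
        mfderiv 𝓘(ℝ, Base d × Fibre m) 𝓘(ℝ, Base d × Fibre m) c.total
          (Λ.lift (flow hη I 0) y)) hgen).trans (map_zero _)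
    exact hF.hasDerivAt.congr_deriv hB1
  have h4 : HasDerivAt (fun t => movedRep hη I Λ (t, u)) 0 0 := by
    have h5 := (ContinuousLinearMap.snd ℝ (Base d) (Fibre m)).hasFDerivAt.comp_hasDerivAt
      (0 : ℝ) h3
    rw [map_zero] at h5
    refine h5.congr_of_eventuallyEq (Eventually.of_forall fun t => ?_)
    change (c.total (movedMatter hη I Λ (t, u))).2 = (c.total (Λ.lift (flow hη I t) y)).2
    rw [movedMatter, I.inv_of_notMem t hut]
  have h6 := hasDerivAt_of_dirD (f := movedRep hη I Λ) (σ := fun _ => u) (t := 0)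
    (differentiableAt_movedRep hη I Λ hu) (hasDerivAt_const _ _)
  have h7 : dirD ((0 : ℝ), (0 : Base d)) (movedRep hη I Λ) (0, u) = 0 := by
    rw [dirD, Prod.mk_zero_zero, map_zero]
  rw [h7, add_zero] at h6
  exact h6.unique h4

theorem hasDerivAt_det_jac (hs : ContDiff ℝ ∞ η) (u : Base d) :
    HasDerivAt (fun t => (jac (fun z => I.map (t, z)) u).det)
      (∑ j, dirD (bas d j) (fun z => η z j) u) 0 := by
  have h1 : ContDiffOn ℝ ∞ (fun t => (jac (fun z => I.map (t, z)) u).det) univ :=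
    contDiffOn_det fun i j => (contDiff_jac_time I u i j).contDiffOn
  have h2 := (differentiableAt_of_contDiffOn h1 isOpen_univ (mem_univ (0 : ℝ))).hasDerivAt
  refine h2.congr_deriv ?_
  have h3 := dirD_det (matDiffAt_jac I u) (1 : ℝ)
  rw [matD_jac I hs, I.jac_zero, Matrix.adjugate_one, Matrix.one_mul] at h3
  exact h3

/-- The Lagrangian along the moved fields. -/
def movedLagrangian (L : JetFunction (m := m) o π r) (q : ℝ × Base d) : ℝ :=
  L.lagrangian c (movedJet hη I Λ r q)

theorem contDiffOn_movedLagrangian :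
    ContDiffOn ℝ ∞ (movedLagrangian hη I Λ L) (movedDomain hη I Λ) := by
  have h1 : ContDiffOn ℝ ∞ (movedJet hη I Λ r) (movedDomain hη I Λ) :=
    contDiffOn_jetCoord_family (isOpen_movedDomain hη I Λ)
      (contDiffOn_movedMetric_of_movedDomain hη I Λ) (contDiffOn_movedRep hη I Λ)
  exact (contDiffOn_lagrangian L).comp h1 fun q hq => movedJet_mem hη I Λ hq

theorem movedLagrangian_zero (z : Base d) :
    movedLagrangian hη I Λ L (0, z) = L.lagrangian c (c.jet r γ z) := by
  rw [movedLagrangian, movedJet_zero]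

theorem differentiableAt_movedLagrangian (hu : u ∈ c.fieldDomain γ) :
    DifferentiableAt ℝ (movedLagrangian hη I Λ L) (0, u) :=
  differentiableAt_of_contDiffOn (contDiffOn_movedLagrangian hη I Λ) (isOpen_movedDomain hη I Λ)
    (zero_mem_movedDomain hη I Λ hu)

theorem dirD_comp_jetCoord_time {D : Set (ℝ × Base d)} (hD : IsOpen D)
    {H : ℝ × Base d → SymArray d} {w : ℝ × Base d → Fibre m} (hH : ContDiffOn ℝ ∞ H D)
    (hw : ContDiffOn ℝ ∞ w D) {Ω : Set (JetCoord d m r)} (hΩ : IsOpen Ω)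
    {Lag : JetCoord d m r → ℝ} (hLag : ContDiffOn ℝ ∞ Lag Ω)
    (hj : ∀ q ∈ D, jetCoord r (fun z => H (q.1, z)) (fun z => w (q.1, z)) q.2 ∈ Ω)
    {t : ℝ} (hx : (t, u) ∈ D) :
    dirD ((1 : ℝ), (0 : Base d))
        (fun q => Lag (jetCoord r (fun z => H (q.1, z)) (fun z => w (q.1, z)) q.2)) (t, u) =
      fderiv ℝ Lag (jetCoord r (fun z => H (t, z)) (fun z => w (t, z)) u)
        (0, fun s => multiPartial (s.2 : Multiset (Fin (d + 1)))
            (fun z => dirD ((1 : ℝ), (0 : Base d)) H (t, z)) u,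
          fun s => multiPartial (s.2 : Multiset (Fin (d + 1)))
            (fun z => dirD ((1 : ℝ), (0 : Base d)) w (t, z)) u) := by
  have d1 := hasDerivAt_comp_jetCoord hD hH hw hΩ hLag hx (hj _ hx)
  have hA : DifferentiableAt ℝ
      (fun q : ℝ × Base d => Lag (jetCoord r (fun z => H (q.1, z)) (fun z => w (q.1, z)) q.2))
      (t, u) :=
    differentiableAt_of_contDiffOn (hLag.comp (contDiffOn_jetCoord_family hD hH hw) hj) hD hx
  have d2 := hasDerivAt_of_dirD (σ := fun _ => u) (t := t) hA (hasDerivAt_const _ _)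
  have h7 : dirD ((0 : ℝ), (0 : Base d))
      (fun q : ℝ × Base d => Lag (jetCoord r (fun z => H (q.1, z)) (fun z => w (q.1, z)) q.2))
      (t, u) = 0 := by
    rw [dirD, Prod.mk_zero_zero, map_zero]
  rw [h7, add_zero] at d2
  exact d2.unique d1

theorem dirD_movedLagrangian_time (hu : u ∈ c.fieldDomain γ) :
    dirD ((1 : ℝ), (0 : Base d)) (movedLagrangian hη I Λ L) (0, u) =
    fderiv ℝ (L.lagrangian c) (c.jet r γ u)
      (0, fun s => multiPartial (s.2 : Multiset (Fin (d + 1))) (metricVariation c γ I) u,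
        fun s => multiPartial (s.2 : Multiset (Fin (d + 1))) (matterVariation hη I Λ) u) := by
  have h := dirD_comp_jetCoord_time (isOpen_movedDomain hη I Λ)
    (contDiffOn_movedMetric_of_movedDomain hη I Λ)
    (contDiffOn_movedRep hη I Λ) (isOpen_jetTarget c) (contDiffOn_lagrangian L)
    (fun _ hq => movedJet_mem hη I Λ hq) (zero_mem_movedDomain hη I Λ hu)
  have hj0 : jetCoord r (fun z => movedMetric c γ I (0, z)) (fun z => movedRep hη I Λ (0, z)) u =
      c.jet r γ u := movedJet_zero hη I Λ u
  rw [hj0] at h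
  exact h

theorem det_jac_mul_movedLagrangian (hL : L.IsInvariant Λ) (hu : u ∈ c.fieldDomain γ) :
    (fun t => (jac (fun z => I.map (t, z)) u).det * movedLagrangian hη I Λ L (t, I.map (t, u)))
      =ᶠ[𝓝 0] fun _ => L.lagrangian c (c.jet r γ u) := by
  have hcont : ContinuousAt (fun t : ℝ => (t, I.map (t, u))) 0 :=
    (continuous_id.prodMk (I.contDiff_map.continuous.comp
      (continuous_id.prodMk continuous_const))).continuousAt
  have h0 : ((0 : ℝ), I.map (0, u)) ∈ movedDomain hη I Λ := by
    rw [I.map_zero]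
    exact zero_mem_movedDomain hη I Λ hu
  filter_upwards [hcont.eventually ((isOpen_movedDomain hη I Λ).mem_nhds h0)] with t ht
  exact lagrangian_movedJet hη I Λ hL ht

theorem dirD_movedLagrangian_space (hu : u ∈ c.fieldDomain γ) (v : Base d) :
    dirD ((0 : ℝ), v) (movedLagrangian hη I Λ L) (0, u) =
      dirD v (fun z => L.lagrangian c (c.jet r γ z)) u := by
  rw [← dirD_slice (isOpen_movedDomain hη I Λ) (contDiffOn_movedLagrangian hη I Λ) v
    (zero_mem_movedDomain hη I Λ hu)]
  simp only [movedLagrangian_zero]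

theorem contDiffOn_lagrangian_jet :
    ContDiffOn ℝ ∞ (fun z => L.lagrangian c (c.jet r γ z)) (c.fieldDomain γ) :=
  (contDiffOn_lagrangian L).comp contDiffOn_jet fun _ hv => jet_mem hv

/-- The infinitesimal form of the invariance of the Lagrangian. -/
theorem infinitesimal_invariance (hL : L.IsInvariant Λ) (hu : u ∈ c.fieldDomain γ) :
    fderiv ℝ (L.lagrangian c) (c.jet r γ u)
      (0, fun s => multiPartial (s.2 : Multiset (Fin (d + 1))) (metricVariation c γ I) u,
        fun s => multiPartial (s.2 : Multiset (Fin (d + 1))) (matterVariation hη I Λ) u) =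
      -∑ j, dirD (bas d j) (fun z => L.lagrangian c (c.jet r γ z) * η z j) u := by
  rw [← dirD_movedLagrangian_time hη I Λ hu]
  have hmap0 : I.map (0, u) = u := I.map_zero u
  have hA := differentiableAt_movedLagrangian (L := L) hη I Λ hu
  -- By invariance the Lagrangian density along a trajectory, times the Jacobian determinant, is
  -- constant for small times. Its derivative splits into the divergence of `η`, the variation at
  -- the fixed point and the derivative along `η`.
  have d3 := (hasDerivAt_det_jac I hη.contDiff u).fun_mul
    (hasDerivAt_of_dirD (f := movedLagrangian hη I Λ L)
    (σ := fun t => I.map (t, u)) (t := 0) (by rw [hmap0]; exact hA) (I.hasDerivAt_map u))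
  have d4 := d3.unique ((hasDerivAt_const _ _).congr_of_eventuallyEq
    (det_jac_mul_movedLagrangian hη I Λ hL hu))
  rw [hmap0, I.jac_zero, Matrix.det_one, one_mul, movedLagrangian_zero,
    dirD_movedLagrangian_space hη I Λ hu] at d4
  have hLd : DifferentiableAt ℝ (fun z => L.lagrangian c (c.jet r γ z)) u :=
    differentiableAt_of_contDiffOn contDiffOn_lagrangian_jet (isOpen_fieldDomain γ) hu
  have hηd (j) : DifferentiableAt ℝ (fun z => η z j) u :=
    (EuclideanSpace.proj j : Base d →L[ℝ] ℝ).differentiableAt.comp u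
      (hη.contDiff.differentiable (by simp) u)
  have h9 : ∑ j, dirD (bas d j) (fun z => L.lagrangian c (c.jet r γ z) * η z j) u =
      dirD (η u) (fun z => L.lagrangian c (c.jet r γ z)) u +
        (∑ j, dirD (bas d j) (fun z => η z j) u) * L.lagrangian c (c.jet r γ u) := by
    have h10 : dirD (η u) (fun z => L.lagrangian c (c.jet r γ z)) u =
        ∑ j, η u j * dirD (bas d j) (fun z => L.lagrangian c (c.jet r γ z)) u := by
      conv_lhs => rw [← sum_smul_bas (η u), dirD_sum_smul]
      simp only [smul_eq_mul]
    rw [h10, Finset.sum_mul, ← Finset.sum_add_distrib]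
    refine Finset.sum_congr rfl fun j _ => ?_
    rw [dirD_fun_mul hLd (hηd j)]
    ring
  rw [h9]
  linarith

theorem contDiffOn_balance {Lag : JetCoord d m r → ℝ} {Ω : Set (JetCoord d m r)} (hΩ : IsOpen Ω)
    (hLag : ContDiffOn ℝ ∞ Lag Ω) {U : Set (Base d)} (hU : IsOpen U) {G : Base d → SymArray d}
    {y : Base d → Fibre m} (hG : ContDiffOn ℝ ∞ G U) (hy : ContDiffOn ℝ ∞ y U)
    (hj : MapsTo (jetCoord r G y) U Ω) (i : Fin (d + 1)) :
    ContDiffOn ℝ ∞ (fun x => balance Lag G y x i) U := by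
  unfold balance
  refine (ContDiffOn.sum fun j _ => contDiffOn_dirD hU
    (contDiffOn_stressM hΩ hLag hU hG hy hj j i) (bas d j)).add
    (ContDiffOn.sum fun j _ => ContDiffOn.sum fun k _ => ContDiffOn.mul ?_
      (contDiffOn_dirD hU (contDiffOn_invMetric_apply hG j k) (bas d i)))
  exact contDiffOn_varDerivMetric hΩ hLag hU hG hy hj j k

open Classical in
include hη in
theorem isTest_metricVariation :
    IsTest (c.fieldDomain γ) fun z => if z ∈ c.fieldDomain γ then metricVariation c γ I z else 0 := by
  refine isTest_of_contDiffOn hη.hasCompactSupport.isCompact hη.tsupport_subset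
    (isOpen_fieldDomain γ) ?_ fun z hz => ?_
  · have h1 := contDiffOn_dirD ((isOpen_fieldDomain γ).preimage I.contDiff_inv.continuous)
      (contDiffOn_movedMetric (c := c) I) ((1 : ℝ), (0 : Base d))
    have h2 : ContDiffOn ℝ ∞ (metricVariation c γ I) (c.fieldDomain γ) :=
      h1.comp (contDiff_const.prodMk contDiff_id).contDiffOn fun z hz => by
        change I.inv (0, z) ∈ c.fieldDomain γ
        rwa [I.inv_zero]
    exact h2.congr fun z hz => if_pos hz
  · split_ifs with h
    · exact metricVariation_eq_zero I hη.contDiff h hz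
    · rfl

open Classical in
theorem isTest_matterVariation :
    IsTest (c.fieldDomain γ) fun z =>
      if z ∈ c.fieldDomain γ then matterVariation hη I Λ z else 0 := by
  refine isTest_of_contDiffOn hη.hasCompactSupport.isCompact hη.tsupport_subset
    (isOpen_fieldDomain γ) ?_ fun z hz => ?_
  · have h1 := contDiffOn_dirD (isOpen_movedDomain hη I Λ)
      (contDiffOn_movedRep hη I Λ) ((1 : ℝ), (0 : Base d))
    have h2 : ContDiffOn ℝ ∞ (matterVariation hη I Λ) (c.fieldDomain γ) :=
      h1.comp (contDiff_const.prodMk contDiff_id).contDiffOn fun z hz =>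
        zero_mem_movedDomain hη I Λ hz
    exact h2.congr fun z hz => if_pos hz
  · split_ifs with h
    · exact matterVariation_eq_zero hη I Λ h hz
    · rfl

include hη in
theorem isTest_mul {f : Base d → ℝ} (hf : ContDiffOn ℝ ∞ f (c.fieldDomain γ)) (j : Fin (d + 1)) :
    IsTest (c.fieldDomain γ) fun z => f z * η z j :=
  (hη.clm (EuclideanSpace.proj j : Base d →L[ℝ] ℝ)).smul (isOpen_fieldDomain γ) hf

-- The first variation is evaluated twice. Infinitesimal invariance makes it the divergence of a
-- compactly supported field, with integral zero. The first variation formula, the matter equations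
-- and `splitting` make its integral that of another compactly supported divergence minus the
-- asserted integrand.
include hη in
theorem integral_balance (hL : L.IsInvariant Λ) (hon : L.OnShell γ) :
    ∫ x, ∑ i, η x i * balance (L.lagrangian c) (c.metricRep γ) (c.matterRep γ) x i = 0 := by
  classical
  obtain ⟨I⟩ := exists_isotopy hη.hasCompactSupport hη.contDiff
  have hU := isOpen_fieldDomain (c := c) γ
  have th := isTest_metricVariation hη I
  have tk := isTest_matterVariation hη I Λ
  have hv := integral_first_variation (isOpen_jetTarget c) (contDiffOn_lagrangian L) hU
    contDiffOn_metricRep contDiffOn_matterRep mapsTo_jet th tk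
  have tA (j) := isTest_mul hη (f := fun z => L.lagrangian c (c.jet r γ z))
    ((contDiffOn_lagrangian L).comp contDiffOn_jet fun v hv => jet_mem hv) j
  have tS (j) : IsTest (c.fieldDomain γ) fun z => ∑ i, stressMatrix L c γ z j i * η z i := by
    have h1 (i) := isTest_mul hη (contDiffOn_stressMatrix (L := L) (c := c) (γ := γ) j i) i
    refine isTest_of_contDiffOn hη.hasCompactSupport.isCompact hη.tsupport_subset hU
      (ContDiffOn.sum fun i _ => (h1 i).contDiff.contDiffOn) fun x hx => ?_
    simp [image_eq_zero_of_notMem_tsupport hx]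
  have e1 : ∀ x, fderiv ℝ (L.lagrangian c) (jetCoord r (c.metricRep γ) (c.matterRep γ) x)
      (0, fun s => multiPartial (s.2 : Multiset (Fin (d + 1)))
          (fun z => if z ∈ c.fieldDomain γ then metricVariation c γ I z else 0) x,
        fun s => multiPartial (s.2 : Multiset (Fin (d + 1)))
          (fun z => if z ∈ c.fieldDomain γ then matterVariation hη I Λ z else 0) x) =
      -∑ j, dirD (bas d j) (fun z => L.lagrangian c (c.jet r γ z) * η z j) x := by
    intro x
    by_cases hx : x ∈ c.fieldDomain γ
    · rw [← infinitesimal_invariance hη I Λ hL hx]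
      congr 1
      refine Prod.ext rfl (Prod.ext ?_ ?_) <;> funext s
      · exact multiD_congr hU (fun z hz => if_pos hz) (bas d) _ hx
      · exact multiD_congr hU (fun z hz => if_pos hz) (bas d) _ hx
    · have h1 : ((0 : Base d), (fun s : MultiIdx d r => multiPartial
          (s.2 : Multiset (Fin (d + 1))) (fun z => if z ∈ c.fieldDomain γ then metricVariation c γ I z else 0) x),
          (fun s : MultiIdx d r => multiPartial (s.2 : Multiset (Fin (d + 1)))
            (fun z => if z ∈ c.fieldDomain γ then matterVariation hη I Λ z else 0) x)) = 0 := by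
        refine Prod.ext rfl (Prod.ext ?_ ?_) <;> funext s
        · exact (th.multiPartial _).eq_zero hx
        · exact (tk.multiPartial _).eq_zero hx
      rw [h1, map_zero, Finset.sum_eq_zero fun j _ => ((tA j).dirD (bas d j)).eq_zero hx, neg_zero]
  -- On-shell the matter terms disappear, and the metric variation is the expression contracted with
  -- the Euler-Lagrange matrix in `splitting`. Off the field domain the extensions by zero make both
  -- sides vanish.
  have e2 : ∀ x, ((∑ i, ∑ j, varDerivMetric (L.lagrangian c) (c.metricRep γ) (c.matterRep γ) x i j *
        symComp i j (if x ∈ c.fieldDomain γ then metricVariation c γ I x else 0)) +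
      ∑ σ, varDerivMatter (L.lagrangian c) (c.metricRep γ) (c.matterRep γ) x σ *
        (if x ∈ c.fieldDomain γ then matterVariation hη I Λ x else 0) σ) =
      ∑ j, dirD (bas d j) (fun z => ∑ i, stressMatrix L c γ z j i * η z i) x -
        ∑ i, η x i * balance (L.lagrangian c) (c.metricRep γ) (c.matterRep γ) x i := by
    intro x
    by_cases hx : x ∈ c.fieldDomain γ
    · have h1 := splitting (isOpen_jetTarget c) (contDiffOn_lagrangian L) hU hx
        contDiffOn_metricRep contDiffOn_matterRep mapsTo_jet (ξ := fun z => η z) fun i =>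
          (EuclideanSpace.proj i : Base d →L[ℝ] ℝ).differentiableAt.comp x
            (hη.contDiff.differentiable (by simp) x)
      rw [Finset.sum_eq_zero (s := (Finset.univ : Finset (Fin m))) fun σ _ => by
        rw [hon c x hx σ, zero_mul], add_zero]
      simp only [if_pos hx]
      have h2 (i j) : symComp i j (metricVariation c γ I x) =
          lieMatrix (c.metricRep γ) (fun z => η z) x i j :=
        congrFun (congrFun (invMetric_metricVariation I hη.contDiff hx) i) j
      simp only [h2]
      rw [sub_eq_neg_add]
      exact h1
    · rw [Finset.sum_eq_zero (f := fun j => dirD (bas d j) _ x) fun j _ =>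
        ((tS j).dirD (bas d j)).eq_zero hx]
      simp [if_neg hx, hη.eq_zero hx]
  replace hv := (integral_congr_ae (Eventually.of_forall e1)).symm.trans
    (hv.trans (integral_congr_ae (Eventually.of_forall e2)))
  simp only at hv
  have i1 (j) : Integrable (dirD (bas d j) fun z => L.lagrangian c (c.jet r γ z) * η z j) :=
    ((tA j).dirD _).integrable
  have i2 (j) : Integrable (dirD (bas d j) fun z => ∑ i, stressMatrix L c γ z j i * η z i) :=
    ((tS j).dirD _).integrable
  have i3 : Integrable fun x => ∑ i, η x i *
      balance (L.lagrangian c) (c.metricRep γ) (c.matterRep γ) x i := by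
    refine integrable_finsetSum _ fun i _ => ?_
    have hb : ContDiffOn ℝ ∞ (fun x =>
        balance (L.lagrangian c) (c.metricRep γ) (c.matterRep γ) x i) (c.fieldDomain γ) :=
      contDiffOn_balance (isOpen_jetTarget c) (contDiffOn_lagrangian L) hU contDiffOn_metricRep contDiffOn_matterRep mapsTo_jet i
    simpa only [mul_comm] using (isTest_mul hη hb i).integrable
  rw [integral_neg, integral_finsetSum _ fun j _ => i1 j,
    integral_sub (integrable_finsetSum _ fun j _ => i2 j) i3,
    integral_finsetSum _ fun j _ => i2 j,
    Finset.sum_eq_zero fun j _ => (tA j).integral_dirD (bas d j),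
    Finset.sum_eq_zero fun j _ => (tS j).integral_dirD (bas d j)] at hv
  linarith

/-- The vector fields `ρ e_i`, with `ρ` an arbitrary test function, separate the components in
`integral_balance`; the fundamental lemma then gives vanishing at every point. -/
theorem balance_eq_zero (hL : L.IsInvariant Λ) (hon : L.OnShell γ) (hu : u ∈ c.fieldDomain γ)
    (i : Fin (d + 1)) :
    balance (L.lagrangian c) (c.metricRep γ) (c.matterRep γ) u i = 0 := by
  have hb : ContDiffOn ℝ ∞ (fun x =>
      balance (L.lagrangian c) (c.metricRep γ) (c.matterRep γ) x i) (c.fieldDomain γ) :=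
    contDiffOn_balance (isOpen_jetTarget c) (contDiffOn_lagrangian L) (isOpen_fieldDomain γ) contDiffOn_metricRep contDiffOn_matterRep mapsTo_jet i
  refine eqOn_zero_of_integral_mul_eq_zero (isOpen_fieldDomain γ) hb.continuousOn
    (fun ρ hρ => ?_) u hu
  rw [← integral_balance (hρ.smul_const (bas d i)) Λ hL hon]
  refine integral_congr_ae (Eventually.of_forall fun x => ?_)
  simp only [PiLp.smul_apply, bas_apply, smul_eq_mul, mul_ite, mul_one, mul_zero, ite_mul,
    zero_mul, Finset.sum_ite_eq', Finset.mem_univ, if_true]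
  exact mul_comm _ _

end Conservation

/-! ## The components of the energy-momentum tensor -/

section Components

variable {d m r : ℕ}
variable {X : Type*} [TopologicalSpace X] [ChartedSpace (Base d) X] [IsManifold 𝓘(ℝ, Base d) ∞ X]
variable {Y : Type*} [TopologicalSpace Y] [ChartedSpace (Base d × Fibre m) Y]
  [IsManifold 𝓘(ℝ, Base d × Fibre m) ∞ Y]
variable {o : OrientedAtlas d X} {π : Y → X} {c : FiberedChart (m := m) o π}
  {γ : LocalField (d := d) (m := m) π} {u : Base d} {L : JetFunction (m := m) o π r}

/-- The components `T^j_i` of the energy-momentum tensor in a fibered chart. -/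
def stressTensor (L : JetFunction (m := m) o π r) (c : FiberedChart (m := m) o π)
    (p : JetCoord d m (2 * r)) : Matrix (Fin (d + 1)) (Fin (d + 1)) ℝ :=
  (volDensity (p.2.1 (MultiIdx.nil d (2 * r))))⁻¹ • jetStress (L.lagrangian c) p

theorem areComponents_stressTensor : AreComponents (energyMomentum L) c (stressTensor L c) := by
  intro ξ p hp
  have hv := (volDensity_pos hp.2).ne'
  change stressForm L ξ c p = _
  rw [stressForm, if_pos hp, vecForm]
  refine Finset.sum_congr rfl fun j _ => congrArg (· • omega j) ?_
  refine Finset.sum_congr rfl fun i _ => ?_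
  rw [stressTensor, Matrix.smul_apply, smul_eq_mul]
  field_simp

theorem stressTensor_jet (hu : u ∈ c.fieldDomain γ) :
    stressTensor L c (c.jet (2 * r) γ u) =
      (volDensity (c.metricRep γ u))⁻¹ • stressMatrix L c γ u := by
  rw [stressTensor, jetStress_jet le_rfl hu, FiberedChart.jet, jetCoord_nil_metric]

theorem covMetric_mul_stressTensor (hu : u ∈ c.fieldDomain γ) :
    covMetric (c.metricRep γ u) * stressTensor L c (c.jet (2 * r) γ u) =
      (2 / volDensity (c.metricRep γ u)) • eulerMatrix L c γ u := by
  rw [stressTensor_jet hu, stressMatrix, smul_smul, Matrix.mul_smul, ← Matrix.mul_assoc, covMetric,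
    Matrix.nonsing_inv_mul _ (isUnit_iff_ne_zero.2 (metricRep_det_ne_zero hu.1)), Matrix.one_mul,
    inv_mul_eq_div]

/-- `covDivergence_eq` identifies the density times the divergence with the balance, and the density
is nowhere zero. -/
theorem covDivergence_stressTensor [T2Space X] (Λ : CanonicalLifting (d := d) (m := m) π)
    (hL : L.IsInvariant Λ) (hon : L.OnShell γ) (hu : u ∈ c.fieldDomain γ) (i : Fin (d + 1)) :
    covDivergence (c.metricRep γ) (fun v => stressTensor L c (c.jet (2 * r) γ v)) u i = 0 := by
  have hdet : ∀ z ∈ c.fieldDomain γ, (invMetric (c.metricRep γ z)).det ≠ 0 := fun z hz =>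
    metricRep_det_ne_zero hz.1
  have h := covDivergence_eq (isOpen_fieldDomain γ) contDiffOn_metricRep hdet hu
    (S := stressMatrix L c γ) (T := fun v => stressTensor L c (c.jet (2 * r) γ v))
    (contDiffOn_stressMatrix (L := L)) (fun z hz j i => by rw [stressTensor_jet hz]; rfl)
    (eulerMatrix_transpose L) rfl i
  have hb := balance_eq_zero Λ hL hon hu i
  exact (mul_eq_zero.1 (h.trans hb)).resolve_left (volDensity_pos (hdet u hu)).ne'

end Components

end MetricBackground

end

theorem mainTheorem6 {d m r : ℕ}
    {X : Type*} [TopologicalSpace X] [T2Space X] [SecondCountableTopology X]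
    [ChartedSpace (Base d) X] [IsManifold 𝓘(ℝ, Base d) ∞ X]
    {Y : Type*} [TopologicalSpace Y] [T2Space Y] [SecondCountableTopology Y]
    [ChartedSpace (Base d × Fibre m) Y] [IsManifold 𝓘(ℝ, Base d × Fibre m) ∞ Y]
    (o : OrientedAtlas d X) (π : Y → X) (hπ : Function.Surjective π)
    (hsub : Manifold.IsSubmersionOfComplement (Fibre m) 𝓘(ℝ, Base d × Fibre m) 𝓘(ℝ, Base d) ∞ π)
    (Λ : CanonicalLifting (d := d) (m := m) π)
    (L : JetFunction (m := m) o π r) (hL : L.IsInvariant Λ) :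
    ∃ 𝒯 : VectorFieldX d X → HorizontalForm (m := m) o π d (2 * r),
      IsEnergyMomentumTensor L 𝒯 ∧
      (∀ 𝒯' : VectorFieldX d X → HorizontalForm (m := m) o π d (2 * r),
        IsEnergyMomentumTensor L 𝒯' → 𝒯' = 𝒯) ∧
      ∀ c : FiberedChart (m := m) o π,
        ∃ T : JetCoord d m (2 * r) → Matrix (Fin (d + 1)) (Fin (d + 1)) ℝ,
          AreComponents 𝒯 c T ∧
          ∀ γ : LocalField (d := d) (m := m) π,
            (∀ u ∈ c.fieldDomain γ, ∀ i j : Fin (d + 1),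
              ∑ h, covMetric (c.metricRep γ u) i h * T (c.jet (2 * r) γ u) h j =
                2 / volDensity (c.metricRep γ u) *
                  varDerivMetric (L.lagrangian c) (c.metricRep γ) (c.matterRep γ) u i j) ∧
            (L.OnShell γ → ∀ u ∈ c.fieldDomain γ, ∀ i : Fin (d + 1),
              covDivergence (c.metricRep γ) (fun u' => T (c.jet (2 * r) γ u')) u i = 0) := by
  refine ⟨energyMomentum L, isEnergyMomentumTensor_energyMomentum,
    fun 𝒯' h => h.unique isEnergyMomentumTensor_energyMomentum, fun c =>
    ⟨stressTensor L c, areComponents_stressTensor, fun γ => ⟨fun u hu i j => ?_, fun hon u hu i =>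
      covDivergence_stressTensor Λ hL hon hu i⟩⟩⟩
  exact congrFun (congrFun (covMetric_mul_stressTensor hu) i) j
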